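/- Let $N\ge 1$, $p\ge 1$, and let $K\subset\mathbb R^N$ be a bounded, convex, symmetric set with $0$ in its interior. Put $\|x\|_K=\inf\{\lambda>0: x/\lambda\in K\}$ and $|z|_p=(|\Re z|^p+|\Im z|^p)^{1/p}$ for $z\in\mathbb C$; for $v\in\mathbb C^N$ put $$\|v\|_{Z_p^*K}=\Big(\frac{N+p}{p}\int_K|v\cdot x|_p^p\,dx\Big)^{1/p},$$ and for $v\in\mathbb R^N$ let $\|v\|_{Z_1^*K^*}=\sup\{\langle v,w\rangle: w\in\mathbb R^N,\ \|w\|_{Z_1^*K}\le1\}$. Let $A:\mathbb R^N\to\mathbb R^N$ be Lipschitz. Let $W^{1,p}_{A,K}(\mathbb R^N)$ be the space of $u\in L^p(\mathbb R^N,\mathbb C)$ with weak gradient $\nabla u\in L^1_{\rm loc}$ such that $\int_{\mathbb R^N}\|\nabla u-iA(x)u\|_{Z_p^*K}^p\,dx<\infty$. Let $|Du|_{A,K}=C_1+C_2$, where $$C_1=\sup_\varphi\int_{\mathbb R^N}\big(\Re u\,\mathrm{div}\,\varphi-A\cdot\varphi\,\Im u\big)\,dx,\qquad C_2=\sup_\varphi\int_{\mathbb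 R^N}\big(\Im u\,\mathrm{div}\,\varphi+A\cdot\varphi\,\Re u\big)\,dx,$$ the suprema being over $\varphi\in C^1_c(\mathbb R^N,\mathbb R^N)$ with $\|\varphi(x)\|_{Z_1^*K^*}\le1$ for all $x$, and let $BV_{A,K}(\mathbb R^N)=\{u\in L^1(\mathbb R^N,\mathbb C):|Du|_{A,K}<\infty\}$. Put $\Psi_u(x,y)=e^{i(x-y)\cdot A((x+y)/2)}u(y)$. Let $\rho_n:(0,\infty)\to[0,\infty)$, $n\in\mathbb N$, be measurable with $$\lim_{n\to\infty}\int_\delta^\infty\rho_n(r)r^{N-1-p}\,dr=0\ \text{ for all }\delta>0,\qquad \int_0^1\rho_n(r)r^{N-1}\,dr=1\ \text{ for all } n.\qquad(*)$$ (i) For every $u\in W^{1,p}_{A,K}(\mathbb R^N)$, $$\lim_{n\to\infty}\iint_{\mathbb R^{2N}}\frac{|\Psi_u(x,y)-\Psi_u(x,x)|_p^p}{\|x-y\|_K^p}\,\rho_n(\|x-y\|_K)\,dx\,dy=p\int_{\mathbb R^N}\|\nabla u-iA(x)u\|^p_{Z_p^*K}\,dx.$$ (ii) If $p=1$ and $u\in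 BV_{A,K}(\mathbb R^N)$, then the same limit exists and equals $|Du|_{A,K}$. (iii) If $0<s_n<1$ and $s_n\to1$, then $\rho_n(r)=p(1-s_n)r^{p-N-ps_n}$ satisfies $(*)$. Consequently (Ludwig's formula), for every real-valued $u\in W^{1,p}(\mathbb R^N)$, $$\lim_{s\nearrow1}(1-s)\iint_{\mathbb R^{2N}}\frac{|u(x)-u(y)|^p}{\|x-y\|_K^{N+ps}}\,dx\,dy=\int_{\mathbb R^N}\|\nabla u\|_{Z_p^*K}^p\,dx,$$ and for $p=1$ and real-valued $u\in BV(\mathbb R^N)$ the same limit equals $|Du|_{0,K}$. -/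

import Mathlib

open MeasureTheory Set Filter Topology
open scoped ENNReal

noncomputable section

namespace AnisotropicBBM

/-- The Euclidean space `ℝ^N`. -/
abbrev RN (N : ℕ) : Type := EuclideanSpace ℝ (Fin N)

/-- The complex space `ℂ^N`. -/
abbrev CN (N : ℕ) : Type := EuclideanSpace ℂ (Fin N)

/-- `|z|_p = (|Re z|^p + |Im z|^p)^(1/p)` for a complex number `z`. -/
def absP (p : ℝ) (z : ℂ) : ℝ := (|z.re| ^ p + |z.im| ^ p) ^ (1 / p)

/-- The complex number `v · x = ∑ v_j x_j`, for `v ∈ ℂ^N` and `x ∈ ℝ^N`. -/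
def cdot {N : ℕ} (v : CN N) (x : RN N) : ℂ := ∑ j, v j * (x j : ℂ)

/-- The inclusion of `ℝ^N` into `ℂ^N`. -/
def toCN {N : ℕ} (x : RN N) : CN N := WithLp.toLp 2 (fun j => (x j : ℂ))

/-- The norm of the complex polar `L_p`-moment body of `K`,
`‖v‖ = ((N + p) / p * ∫_K |v · x|_p^p dx)^(1/p)` for `v ∈ ℂ^N`. -/
def polarMomentNorm {N : ℕ} (p : ℝ) (K : Set (RN N)) (v : CN N) : ℝ :=
  (((N : ℝ) + p) / p * ∫ x in K, absP p (cdot v x) ^ p) ^ (1 / p)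

/-- The dual, on `ℝ^N`, of the restriction to `ℝ^N` of the norm `polarMomentNorm 1 K`. -/
def dualMomentNorm {N : ℕ} (K : Set (RN N)) (v : RN N) : ℝ :=
  sSup {t : ℝ | ∃ w : RN N, polarMomentNorm 1 K (toCN w) ≤ 1 ∧ t = inner ℝ v w}

/-- `g` is the weak (distributional) gradient of `u : ℝ^N → ℂ`: both are locally integrable and
`∫ u ∂_j φ = - ∫ φ g_j` for all real test functions `φ` and all `j`. -/
def IsWeakGradient {N : ℕ} (u : RN N → ℂ) (g : RN N → CN N) : Prop :=
  LocallyIntegrable u volume ∧ LocallyIntegrable g volume ∧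
    ∀ φ : RN N → ℝ, ContDiff ℝ ((⊤ : ℕ∞) : WithTop ℕ∞) φ → HasCompactSupport φ → ∀ j : Fin N,
      ∫ x, (fderiv ℝ φ x (EuclideanSpace.single j (1 : ℝ)) : ℂ) * u x
        = - ∫ x, (φ x : ℂ) * g x j

/-- `∫ ‖g - i A u‖^p dx` in the norm of the polar `L_p`-moment body of `K`; for `g = ∇u` this is
the `p`-th power of the magnetic Sobolev seminorm. -/
def magEnergy {N : ℕ} (p : ℝ) (K : Set (RN N)) (A : RN N → RN N) (u : RN N → ℂ)
    (g : RN N → CN N) : ℝ≥0∞ :=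
  ∫⁻ x, ENNReal.ofReal
    (polarMomentNorm p K (g x - (Complex.I * u x) • toCN (A x)) ^ p)

/-- The anisotropic magnetic Sobolev space `W^{1,p}_{A,K}(ℝ^N)`. -/
def MemMagSobolev {N : ℕ} (p : ℝ) (K : Set (RN N)) (A : RN N → RN N) (u : RN N → ℂ) : Prop :=
  MemLp u (ENNReal.ofReal p) volume ∧
    ∃ g : RN N → CN N, IsWeakGradient u g ∧ magEnergy p K A u g < ⊤

/-- The divergence of a vector field. -/
def divergence {N : ℕ} (φ : RN N → RN N) (x : RN N) : ℝ :=
  ∑ j, (fderiv ℝ φ x (EuclideanSpace.single j (1 : ℝ))) j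

/-- The admissible fields: `φ ∈ C^1_c(ℝ^N, ℝ^N)` with values in the unit ball of the dual norm. -/
def IsAdmissible {N : ℕ} (K : Set (RN N)) (φ : RN N → RN N) : Prop :=
  ContDiff ℝ 1 φ ∧ HasCompactSupport φ ∧ ∀ x, dualMomentNorm K (φ x) ≤ 1

/-- `sup_φ ∫ Re u div φ - (A · φ) Im u`. As `φ = 0` is admissible the supremum is nonnegative, so
truncating negative values by `ENNReal.ofReal` does not change it. -/
def variationRe {N : ℕ} (K : Set (RN N)) (A : RN N → RN N) (u : RN N → ℂ) : ℝ≥0∞ :=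
  ⨆ (φ : RN N → RN N) (_ : IsAdmissible K φ),
    ENNReal.ofReal (∫ x, ((u x).re * divergence φ x - inner ℝ (A x) (φ x) * (u x).im))

/-- `sup_φ ∫ Im u div φ + (A · φ) Re u`. -/
def variationIm {N : ℕ} (K : Set (RN N)) (A : RN N → RN N) (u : RN N → ℂ) : ℝ≥0∞ :=
  ⨆ (φ : RN N → RN N) (_ : IsAdmissible K φ),
    ENNReal.ofReal (∫ x, ((u x).im * divergence φ x + inner ℝ (A x) (φ x) * (u x).re))

/-- The anisotropic magnetic total variation `|Du|_{A,K}`. -/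
def magVariation {N : ℕ} (K : Set (RN N)) (A : RN N → RN N) (u : RN N → ℂ) : ℝ≥0∞ :=
  variationRe K A u + variationIm K A u

/-- The anisotropic magnetic space `BV_{A,K}(ℝ^N)`. -/
def MemMagBV {N : ℕ} (K : Set (RN N)) (A : RN N → RN N) (u : RN N → ℂ) : Prop :=
  MemLp u 1 volume ∧ magVariation K A u < ⊤

/-- `Ψ_u(x,y) = exp(i (x - y) · A((x + y) / 2)) u(y)`. -/
def Psi {N : ℕ} (A : RN N → RN N) (u : RN N → ℂ) (x y : RN N) : ℂ :=
  Complex.exp (Complex.I * ((inner ℝ (x - y) (A ((2 : ℝ)⁻¹ • (x + y))) : ℝ) : ℂ)) * u y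

/-- The nonlocal functional
`∬ |Ψ_u(x,y) - Ψ_u(x,x)|_p^p / ‖x - y‖_K^p * ρ(‖x - y‖_K) dx dy`,
where `‖·‖_K` is the Minkowski functional `gauge K`. -/
def nonlocalEnergy {N : ℕ} (p : ℝ) (K : Set (RN N)) (A : RN N → RN N) (ρ : ℝ → ℝ)
    (u : RN N → ℂ) : ℝ≥0∞ :=
  ∫⁻ z : RN N × RN N, ENNReal.ofReal
    (absP p (Psi A u z.1 z.2 - Psi A u z.1 z.1) ^ p / gauge K (z.1 - z.2) ^ p
      * ρ (gauge K (z.1 - z.2)))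

/-- A sequence of radial profiles `ρ_n : (0,∞) → [0,∞)` with
`∫_δ^∞ ρ_n(r) r^(N-1-p) dr → 0` for every `δ > 0` and `∫_0^1 ρ_n(r) r^(N-1) dr = 1`. -/
structure IsMollifierSeq (N : ℕ) (p : ℝ) (ρ : ℕ → ℝ → ℝ) : Prop where
  aemeasurable : ∀ n, AEMeasurable (ρ n) (volume.restrict (Ioi 0))
  nonneg : ∀ n, ∀ r : ℝ, 0 < r → 0 ≤ ρ n r
  tail : ∀ δ : ℝ, 0 < δ →
    Tendsto (fun n => ∫⁻ r in Ioi δ, ENNReal.ofReal (ρ n r * r ^ ((N : ℝ) - 1 - p)))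
      atTop (𝓝 0)
  mass : ∀ n, ∫⁻ r in Ioo (0 : ℝ) 1, ENNReal.ofReal (ρ n r * r ^ ((N : ℝ) - 1)) = 1

/-- `∬ |u(x) - u(y)|^p / ‖x - y‖_K^(N + p s) dx dy` for real-valued `u`. -/
def fractionalEnergy {N : ℕ} (p s : ℝ) (K : Set (RN N)) (u : RN N → ℝ) : ℝ≥0∞ :=
  ∫⁻ z : RN N × RN N, ENNReal.ofReal
    (|u z.1 - u z.2| ^ p / gauge K (z.1 - z.2) ^ ((N : ℝ) + p * s))

end AnisotropicBBM

end

noncomputable section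

namespace AnisotropicBBM

/-! Put `y = x + h`. The double integral becomes `∫ S(h) ρ_n(‖h‖_K) ‖h‖_K^(-p) dh`, where `S(h)`
(`shiftEnergy`) integrates `|·|_p^p` of the magnetic difference `e^{-i h·A(x+h/2)} u(x+h) - u(x)`;
see `nonlocalEnergy_eq_lintegral`. If `S` were homogeneous of degree `p`, polar coordinates adapted
to `K` would factor this into `(N+p) ∫_K S` times the radial mass of `ρ_n`
(`lintegral_mul_comp_gauge`). Since `ρ_n` concentrates at `0`, homogeneity up to `o(|h|^p)` is
enough: `limsup_radial_le` and `le_liminf_radial_add` turn one-sided comparisons with a homogeneous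
function near `0` into bounds for the limsup and the liminf. The limit has the right form because
Fubini gives `p ∫ ‖G‖^p = (N+p) ∫_K D_G` with `D_G(h) = ∫ |G(x)·h|_p^p dx`
(`ofReal_mul_lintegral_polarMomentNorm`).

For Sobolev `u` take `G = ∇u - iAu`. The main step is that the magnetic difference equals `G·h +
o(|h|)` in `L^p` (`exists_magShift_sub_sub_small`). It comes from differentiating `t ↦ e^{-itα}
u_φ(x+th)`, with `α = h·A(x+h/2)` and `u_φ` a mollification (`exists_magShift_moll_sub_eq`). Three
errors appear: the oscillation of `G` on the segment, controlled by continuity of translations; the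
commutator of mollification with multiplication by `A`, controlled by the Lipschitz bound; and the
factor `e^{-itα} - 1`, controlled by dominated convergence, since `A` may be unbounded.

For `u` in BV there is no function `G`, so one works with `G_φ = ∇u_φ - i φ*(Au)`. Integration by
parts against mollified fields and duality of the moment norm show that the energy of `G_φ` never
exceeds `|Du|_{A,K}`, and that for narrow `φ` it nearly attains it, already on a fixed ball
(`lintegral_partNorm_magGrad_le`, `exists_eventually_magVariation_le`). The lower bound fixes one
narrow `φ` and uses that mollification increases `S` only slightly (`exists_dirEnergy_magGrad_le`).
The upper bound compares `S` near `0` with the homogeneous function `liminf_k D_{G_k}`, with a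
radius independent of `k` (`exists_shiftEnergy_le_liminf`), and concludes by Fatou.

Ludwig's formula is the case `A = 0` with power kernels. -/

/-! ### Polar integration with respect to the gauge of `K`. -/

theorem lintegral_eq_lintegral_sphere {N : ℕ} (hN : 1 ≤ N) {f : RN N → ℝ≥0∞}
    (hf : Measurable f) :
    ∫⁻ x, f x = ∫⁻ θ : Metric.sphere (0 : RN N) 1, ∫⁻ r in Ioi (0 : ℝ),
      ENNReal.ofReal (r ^ (N - 1)) * f (r • (θ : RN N)) ∂volume ∂(volume : Measure (RN N)).toSphere := by
  have : Nontrivial (RN N) := by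
    have : Nonempty (Fin N) := ⟨⟨0, hN⟩⟩
    infer_instance
  have hmp := (volume : Measure (RN N)).measurePreserving_homeomorphUnitSphereProd
  have hdim : Module.finrank ℝ (RN N) = N := by simp
  rw [hdim] at hmp
  have h1 : ∫⁻ x, f x = ∫⁻ x : ({(0 : RN N)}ᶜ : Set (RN N)), f x
      ∂((volume : Measure (RN N)).comap Subtype.val) := by
    rw [lintegral_subtype_comap (measurableSet_singleton _).compl]
    rw [restrict_compl_singleton]
  rw [h1]
  have hg : Measurable (fun z : Metric.sphere (0 : RN N) 1 × Ioi (0 : ℝ) =>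
      f ((z.2 : ℝ) • (z.1 : RN N))) := by
    apply hf.comp; fun_prop
  have h2 := hmp.lintegral_comp hg
  have h3 : ∀ x : ({(0 : RN N)}ᶜ : Set (RN N)),
      f (((homeomorphUnitSphereProd (RN N) x).2 : ℝ) •
        ((homeomorphUnitSphereProd (RN N) x).1 : RN N)) = f x := by
    intro x
    congr 1
    have hx : ‖(x : RN N)‖ ≠ 0 := norm_ne_zero_iff.2 x.2
    simp [homeomorphUnitSphereProd, smul_smul, hx]
  simp only [h3] at h2
  rw [h2, lintegral_prod _ hg.aemeasurable]
  apply lintegral_congr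
  intro θ
  rw [Measure.volumeIoiPow, lintegral_withDensity_eq_lintegral_mul _ (by fun_prop) (by fun_prop)]
  exact lintegral_subtype_comap (μ := volume) measurableSet_Ioi
    (fun r : ℝ => ENNReal.ofReal (r ^ (N - 1)) * f (r • (θ : RN N)))

theorem lintegral_Ioi_comp_mul_right {c : ℝ} (hc : 0 < c) {f : ℝ → ℝ≥0∞} (hf : Measurable f) :
    ∫⁻ r in Ioi (0 : ℝ), f (r * c) = ENNReal.ofReal c⁻¹ * ∫⁻ r in Ioi (0 : ℝ), f r := by
  rw [← lintegral_indicator measurableSet_Ioi, ← lintegral_indicator measurableSet_Ioi]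
  have h := Real.map_volume_mul_right hc.ne'
  have : ∀ r, (Ioi (0 : ℝ)).indicator (fun r => f (r * c)) r
      = (Ioi (0 : ℝ)).indicator f (r * c) := by
    intro r
    simp only [indicator, mem_Ioi, mul_pos_iff_of_pos_right hc]
  simp only [this]
  have hm : Measurable ((Ioi (0 : ℝ)).indicator f) := hf.indicator measurableSet_Ioi
  rw [← lintegral_map hm (measurable_mul_const c), h, lintegral_smul_measure]
  rw [abs_of_pos (inv_pos.2 hc)]
  rfl

theorem lintegral_Ioo_rpow {a : ℝ} (ha : -1 < a) {δ : ℝ} (hδ : 0 < δ) :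
    ∫⁻ r in Ioo (0 : ℝ) δ, ENNReal.ofReal (r ^ a) = ENNReal.ofReal (δ ^ (a + 1) / (a + 1)) := by
  have hi : IntegrableOn (fun r : ℝ => r ^ a) (Ioo 0 δ) :=
    (intervalIntegral.integrableOn_Ioo_rpow_iff hδ).2 ha
  rw [← ofReal_integral_eq_lintegral_ofReal hi]
  · rw [← integral_Ioc_eq_integral_Ioo, ← intervalIntegral.integral_of_le hδ.le,
      integral_rpow (Or.inl ha), Real.zero_rpow (by linarith)]
    simp
  · filter_upwards [ae_restrict_mem measurableSet_Ioo] with r hr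
    exact Real.rpow_nonneg hr.1.le _

section Gauge

variable {N : ℕ} {K : Set (RN N)}

theorem gauge_pos_iff_ne_zero (hKb : Bornology.IsBounded K) (hK0 : (0 : RN N) ∈ interior K)
    {x : RN N} : 0 < gauge K x ↔ x ≠ 0 :=
  gauge_pos (absorbent_nhds_zero (mem_interior_iff_mem_nhds.1 hK0))
    (NormedSpace.isVonNBounded_iff ℝ |>.2 hKb)

theorem ae_eq_gauge_lt_one (hKc : Convex ℝ K) (hK0 : (0 : RN N) ∈ interior K) :
    (K : Set (RN N)) =ᵐ[volume] {x | gauge K x < 1} := by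
  rw [setOfPred_gauge_lt_one_eq_interior hKc (mem_interior_iff_mem_nhds.1 hK0)]
  exact (interior_ae_eq_of_null_frontier (hKc.addHaar_frontier volume)).symm

/-- On the ray through a unit vector `θ`, the substitution `r ↦ r · gauge K θ` separates the radial
integral from a factor depending only on `θ`. The resulting angular constant does not depend on `ρ`,
so one test profile determines it. -/
theorem lintegral_mul_comp_gauge (hN : 1 ≤ N) (hKc : Convex ℝ K) (hKb : Bornology.IsBounded K)
    (hK0 : (0 : RN N) ∈ interior K) {q : ℝ} (hq : 0 ≤ q) {f : RN N → ℝ≥0∞} (hf : Measurable f)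
    (hom : ∀ t : ℝ, 0 < t → ∀ h, f (t • h) = ENNReal.ofReal (t ^ q) * f h)
    {ρ : ℝ → ℝ≥0∞} (hρ : Measurable ρ) :
    ∫⁻ h, f h * ρ (gauge K h) = ENNReal.ofReal (N + q) * (∫⁻ h in K, f h) *
      ∫⁻ r in Ioi (0 : ℝ), ρ r * ENNReal.ofReal (r ^ ((N : ℝ) - 1 + q)) := by
  have hgc : Continuous (gauge K) := continuous_gauge hKc (mem_interior_iff_mem_nhds.1 hK0)
  have hN' : (1 : ℝ) ≤ N := by exact_mod_cast hN
  obtain ⟨c, hc⟩ : ∃ c : ℝ≥0∞, ∀ ρ : ℝ → ℝ≥0∞, Measurable ρ →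
      ∫⁻ h, f h * ρ (gauge K h) = c *
        ∫⁻ r in Ioi (0 : ℝ), ρ r * ENNReal.ofReal (r ^ ((N : ℝ) - 1 + q)) := by
    refine ⟨∫⁻ θ : Metric.sphere (0 : RN N) 1, f θ *
      ENNReal.ofReal (gauge K θ ^ (-((N : ℝ) + q))) ∂(volume : Measure (RN N)).toSphere, ?_⟩
    intro ρ hρ
    have hm : Measurable (fun r => ρ r * ENNReal.ofReal (r ^ ((N : ℝ) - 1 + q))) := by
      fun_prop
    rw [lintegral_eq_lintegral_sphere hN (by fun_prop), ← lintegral_mul_const _ (by fun_prop)]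
    apply lintegral_congr
    intro θ
    have hθ : (θ : RN N) ≠ 0 := by
      intro h0
      have := θ.2
      rw [h0] at this
      simp at this
    have hg : 0 < gauge K (θ : RN N) := (gauge_pos_iff_ne_zero hKb hK0).2 hθ
    have h1 : ∫⁻ r in Ioi (0 : ℝ), ENNReal.ofReal (r ^ (N - 1)) *
          (f (r • (θ : RN N)) * ρ (gauge K (r • (θ : RN N))))
        = ∫⁻ r in Ioi (0 : ℝ), (f θ * ENNReal.ofReal (gauge K θ ^ (-((N : ℝ) - 1 + q)))) *
          (fun r => ρ r * ENNReal.ofReal (r ^ ((N : ℝ) - 1 + q))) (r * gauge K θ) := by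
      apply setLIntegral_congr_fun measurableSet_Ioi
      intro r hr
      have hr : 0 < r := hr
      simp only
      rw [hom r hr, gauge_smul_of_nonneg hr.le, smul_eq_mul]
      have e1 : r ^ (N - 1) = r ^ ((N : ℝ) - 1) := by
        rw [← Real.rpow_natCast, Nat.cast_sub hN, Nat.cast_one]
      have e2 : r ^ ((N : ℝ) - 1) * r ^ q
          = gauge K θ ^ (-((N : ℝ) - 1 + q)) * (r * gauge K θ) ^ ((N : ℝ) - 1 + q) := by
        rw [Real.mul_rpow hr.le hg.le, mul_left_comm, ← Real.rpow_add hg, ← Real.rpow_add hr,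
          neg_add_cancel, Real.rpow_zero, mul_one]
      have e3 : ENNReal.ofReal (r ^ ((N : ℝ) - 1)) * ENNReal.ofReal (r ^ q)
          = ENNReal.ofReal (gauge K θ ^ (-((N : ℝ) - 1 + q))) *
            ENNReal.ofReal ((r * gauge K θ) ^ ((N : ℝ) - 1 + q)) := by
        rw [← ENNReal.ofReal_mul (by positivity), e2, ENNReal.ofReal_mul (by positivity)]
      rw [e1]
      calc _ = (ENNReal.ofReal (r ^ ((N : ℝ) - 1)) * ENNReal.ofReal (r ^ q)) * f θ *
            ρ (r * gauge K θ) := by ring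
        _ = _ := by rw [e3]; ring
    rw [h1, lintegral_const_mul _ (by fun_prop), lintegral_Ioi_comp_mul_right hg hm,
      ← mul_assoc, mul_assoc (f θ), ← ENNReal.ofReal_mul (by positivity)]
    congr 4
    rw [← Real.rpow_neg_one, ← Real.rpow_add hg]
    congr 1; ring
  -- The profile `1_{r<1}` turns the left side into `∫_K f`, as the frontier of a convex set is
  -- null, and the radial integral into `1/(N+q)`.
  have h1 := hc ((Iio 1).indicator 1) (measurable_one.indicator measurableSet_Iio)
  have h2 : ∫⁻ h, f h * (Iio (1 : ℝ)).indicator 1 (gauge K h) = ∫⁻ h in K, f h := by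
    rw [setLIntegral_congr (ae_eq_gauge_lt_one hKc hK0),
      ← lintegral_indicator (measurableSet_lt hgc.measurable measurable_const)]
    apply lintegral_congr
    intro h
    by_cases hh : gauge K h < 1 <;> simp [indicator, hh]
  have h3 : ∫⁻ r in Ioi (0 : ℝ), (Iio (1 : ℝ)).indicator 1 r *
      ENNReal.ofReal (r ^ ((N : ℝ) - 1 + q)) = ENNReal.ofReal (N + q)⁻¹ := by
    have : ∀ r : ℝ, (Iio (1 : ℝ)).indicator (1 : ℝ → ℝ≥0∞) r * ENNReal.ofReal (r ^ ((N : ℝ) - 1 + q))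
        = (Iio (1 : ℝ)).indicator (fun r => ENNReal.ofReal (r ^ ((N : ℝ) - 1 + q))) r := by
      intro r
      by_cases hh : r < 1 <;> simp [indicator, hh]
    simp only [this]
    rw [setLIntegral_indicator measurableSet_Iio, inter_comm, Ioi_inter_Iio,
      lintegral_Ioo_rpow (by linarith) one_pos]
    congr 1
    rw [Real.one_rpow, one_div]; congr 1; ring
  rw [h2, h3] at h1
  rw [hc ρ hρ, h1]
  congr 1
  rw [mul_comm c, ← mul_assoc, ← ENNReal.ofReal_mul (by positivity),
    mul_inv_cancel₀ (by positivity), ENNReal.ofReal_one, one_mul]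

end Gauge

section Gauge

variable {N : ℕ} {K : Set (RN N)}

/-- The polar formula with `f = 1`, `q = 0`, applied to the indicator of a null measurable superset,
shows that the gauge pulls null sets of radii back to null sets. This allows profiles that are only
a.e. measurable on `(0,∞)`. -/
theorem ae_comp_gauge (hN : 1 ≤ N) (hKc : Convex ℝ K) (hKb : Bornology.IsBounded K)
    (hK0 : (0 : RN N) ∈ interior K) {P : ℝ → Prop}
    (hP : ∀ᵐ r ∂(volume.restrict (Ioi (0 : ℝ))), P r) : ∀ᵐ h : RN N, P (gauge K h) := by
  have hgc : Continuous (gauge K) := continuous_gauge hKc (mem_interior_iff_mem_nhds.1 hK0)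
  have : Nontrivial (RN N) := by
    have : Nonempty (Fin N) := ⟨⟨0, hN⟩⟩
    infer_instance
  obtain ⟨B, hsub, hBm, hB0⟩ := exists_measurable_superset_of_null (ae_iff.1 hP)
  have h1 := lintegral_mul_comp_gauge hN hKc hKb hK0 (q := 0) le_rfl (f := fun _ => 1)
    measurable_const (by simp) (ρ := B.indicator 1) (measurable_one.indicator hBm)
  have h2 : ∫⁻ r in Ioi (0 : ℝ), B.indicator 1 r * ENNReal.ofReal (r ^ ((N : ℝ) - 1 + 0)) = 0 := by
    rw [← lintegral_zero (μ := volume.restrict (Ioi (0 : ℝ)))]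
    apply lintegral_congr_ae
    filter_upwards [measure_eq_zero_iff_ae_notMem.1 hB0] with r hr
    simp [hr]
  have hmeas : Measurable (fun h : RN N => (1 : ℝ≥0∞) * B.indicator 1 (gauge K h)) :=
    measurable_const.mul ((measurable_one.indicator hBm).comp hgc.measurable)
  rw [h2, mul_zero, lintegral_eq_zero_iff hmeas] at h1
  filter_upwards [h1] with h hh
  by_contra hcon
  have : gauge K h ∈ B := hsub hcon
  simp [this] at hh

theorem aemeasurable_comp_gauge (hN : 1 ≤ N) (hKc : Convex ℝ K) (hKb : Bornology.IsBounded K)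
    (hK0 : (0 : RN N) ∈ interior K) {ρ : ℝ → ℝ≥0∞}
    (hρ : AEMeasurable ρ (volume.restrict (Ioi 0))) :
    AEMeasurable (fun h : RN N => ρ (gauge K h)) := by
  have hgc : Continuous (gauge K) := continuous_gauge hKc (mem_interior_iff_mem_nhds.1 hK0)
  exact ⟨fun h => hρ.mk ρ (gauge K h), hρ.measurable_mk.comp hgc.measurable,
    ae_comp_gauge hN hKc hKb hK0 hρ.ae_eq_mk⟩

theorem lintegral_mul_comp_gauge' (hN : 1 ≤ N) (hKc : Convex ℝ K) (hKb : Bornology.IsBounded K)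
    (hK0 : (0 : RN N) ∈ interior K) {q : ℝ} (hq : 0 ≤ q) {f : RN N → ℝ≥0∞} (hf : Measurable f)
    (hom : ∀ t : ℝ, 0 < t → ∀ h, f (t • h) = ENNReal.ofReal (t ^ q) * f h)
    {ρ : ℝ → ℝ≥0∞} (hρ : AEMeasurable ρ (volume.restrict (Ioi 0))) :
    ∫⁻ h, f h * ρ (gauge K h) = ENNReal.ofReal (N + q) * (∫⁻ h in K, f h) *
      ∫⁻ r in Ioi (0 : ℝ), ρ r * ENNReal.ofReal (r ^ ((N : ℝ) - 1 + q)) := by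
  have h1 : ∫⁻ h, f h * ρ (gauge K h) = ∫⁻ h, f h * hρ.mk ρ (gauge K h) := by
    apply lintegral_congr_ae
    filter_upwards [ae_comp_gauge hN hKc hKb hK0 hρ.ae_eq_mk] with h hh
    rw [hh]
  have h2 : ∫⁻ r in Ioi (0 : ℝ), ρ r * ENNReal.ofReal (r ^ ((N : ℝ) - 1 + q))
      = ∫⁻ r in Ioi (0 : ℝ), hρ.mk ρ r * ENNReal.ofReal (r ^ ((N : ℝ) - 1 + q)) := by
    apply lintegral_congr_ae
    filter_upwards [hρ.ae_eq_mk] with h hh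
    rw [hh]
  rw [h1, h2, lintegral_mul_comp_gauge hN hKc hKb hK0 hq hf hom hρ.measurable_mk]

theorem exists_norm_le_mul_gauge (hKb : Bornology.IsBounded K)
    (hK0 : (0 : RN N) ∈ interior K) : ∃ R : ℝ, 0 < R ∧ ∀ h, ‖h‖ ≤ R * gauge K h := by
  obtain ⟨R, hR0, hR⟩ := hKb.subset_closedBall_lt 0 (0 : RN N)
  refine ⟨R, hR0, fun h => ?_⟩
  have := le_gauge_of_subset_closedBall (x := h)
    (absorbent_nhds_zero (mem_interior_iff_mem_nhds.1 hK0)) hR0.le hR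
  rw [div_le_iff₀ hR0] at this
  linarith

/-- The radial kernel `ρ(r) / r^p`. -/
def kern (p : ℝ) (ρ : ℝ → ℝ) (r : ℝ) : ℝ≥0∞ := ENNReal.ofReal (ρ r / r ^ p)

/-- `(N + q) ∫_K f`, the value of the polar integral of a `q`-homogeneous function. -/
def coneMass (K : Set (RN N)) (q : ℝ) (f : RN N → ℝ≥0∞) : ℝ≥0∞ :=
  ENNReal.ofReal (N + q) * ∫⁻ h in K, f h

theorem coneMass_norm_lt_top (hKb : Bornology.IsBounded K) {q : ℝ} (hq : 0 ≤ q) :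
    coneMass K q (fun h => ENNReal.ofReal (‖h‖ ^ q)) < ⊤ := by
  obtain ⟨R, hR⟩ := hKb.subset_closedBall (0 : RN N)
  refine ENNReal.mul_lt_top ENNReal.ofReal_lt_top ?_
  calc ∫⁻ h in K, ENNReal.ofReal (‖h‖ ^ q) ≤ ∫⁻ h in Metric.closedBall (0 : RN N) R,
        ENNReal.ofReal (‖h‖ ^ q) := lintegral_mono_set hR
    _ ≤ ∫⁻ h in Metric.closedBall (0 : RN N) R, ENNReal.ofReal (R ^ q) := by
        apply setLIntegral_mono measurable_const
        intro h hh
        rw [mem_closedBall_zero_iff] at hh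
        gcongr
    _ < ⊤ := by
        rw [setLIntegral_const]
        exact ENNReal.mul_lt_top ENNReal.ofReal_lt_top measure_closedBall_lt_top

/-! ### The concentrating kernels tested on homogeneous functions. -/

section Mollifier

variable {p : ℝ} {ρ : ℕ → ℝ → ℝ}

theorem aemeasurable_kern (hρ : IsMollifierSeq N p ρ) (n : ℕ) :
    AEMeasurable (kern p (ρ n)) (volume.restrict (Ioi 0)) := by
  have := hρ.aemeasurable n
  unfold kern
  fun_prop

theorem lintegral_inner (hN : 1 ≤ N) (hp : 0 ≤ p) (hKc : Convex ℝ K)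
    (hKb : Bornology.IsBounded K) (hK0 : (0 : RN N) ∈ interior K) (hρ : IsMollifierSeq N p ρ)
    {f : RN N → ℝ≥0∞} (hf : Measurable f)
    (hom : ∀ t : ℝ, 0 < t → ∀ h, f (t • h) = ENNReal.ofReal (t ^ p) * f h) (δ : ℝ) (n : ℕ) :
    ∫⁻ h in {h | gauge K h ≤ δ}, f h * kern p (ρ n) (gauge K h) = coneMass K p f *
      ∫⁻ r in Ioc (0 : ℝ) δ, ENNReal.ofReal (ρ n r * r ^ ((N : ℝ) - 1)) := by
  have hgc : Continuous (gauge K) := continuous_gauge hKc (mem_interior_iff_mem_nhds.1 hK0)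
  have h1 := lintegral_mul_comp_gauge' hN hKc hKb hK0 hp hf hom
    (ρ := (Iic δ).indicator (kern p (ρ n))) ((aemeasurable_kern hρ n).indicator measurableSet_Iic)
  rw [← lintegral_indicator (measurableSet_le hgc.measurable measurable_const)]
  have h2 : ∀ h, {h | gauge K h ≤ δ}.indicator (fun h => f h * kern p (ρ n) (gauge K h)) h
      = f h * (Iic δ).indicator (kern p (ρ n)) (gauge K h) := by
    intro h
    by_cases hh : gauge K h ≤ δ <;> simp [indicator, hh]
  simp only [h2]
  rw [h1]
  unfold coneMass
  congr 1
  have h3 : ∀ r : ℝ, (Iic δ).indicator (kern p (ρ n)) r * ENNReal.ofReal (r ^ ((N : ℝ) - 1 + p))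
      = (Iic δ).indicator (fun r => kern p (ρ n) r * ENNReal.ofReal (r ^ ((N : ℝ) - 1 + p))) r := by
    intro r
    by_cases hh : r ≤ δ <;> simp [indicator, hh]
  simp only [h3]
  rw [setLIntegral_indicator measurableSet_Iic, inter_comm, Ioi_inter_Iic]
  apply setLIntegral_congr_fun measurableSet_Ioc
  intro r hr
  have hr0 := hr.1
  have := hρ.nonneg n r hr0
  simp only [kern]
  rw [← ENNReal.ofReal_mul (by positivity)]
  congr 1
  rw [Real.rpow_add hr0]
  field_simp

theorem lintegral_outer (hN : 1 ≤ N) (hKc : Convex ℝ K)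
    (hKb : Bornology.IsBounded K) (hK0 : (0 : RN N) ∈ interior K) (hρ : IsMollifierSeq N p ρ)
    {δ : ℝ} (hδ : 0 < δ) (n : ℕ) :
    ∫⁻ h in {h | gauge K h ≤ δ}ᶜ, kern p (ρ n) (gauge K h) = coneMass K 0 (fun _ => 1) *
      ∫⁻ r in Ioi δ, ENNReal.ofReal (ρ n r * r ^ ((N : ℝ) - 1 - p)) := by
  have hgc : Continuous (gauge K) := continuous_gauge hKc (mem_interior_iff_mem_nhds.1 hK0)
  have h1 := lintegral_mul_comp_gauge' hN hKc hKb hK0 (q := 0) le_rfl (f := fun _ => 1)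
    measurable_const (by simp)
    (ρ := (Ioi δ).indicator (kern p (ρ n))) ((aemeasurable_kern hρ n).indicator measurableSet_Ioi)
  rw [← lintegral_indicator (measurableSet_le hgc.measurable measurable_const).compl]
  have h2 : ∀ h, {h | gauge K h ≤ δ}ᶜ.indicator (fun h => kern p (ρ n) (gauge K h)) h
      = 1 * (Ioi δ).indicator (kern p (ρ n)) (gauge K h) := by
    intro h
    by_cases hh : gauge K h ≤ δ <;> simp [indicator, hh]
  simp only [h2]
  rw [h1]
  unfold coneMass
  congr 1
  have h3 : ∀ r : ℝ, (Ioi δ).indicator (kern p (ρ n)) r * ENNReal.ofReal (r ^ ((N : ℝ) - 1 + 0))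
      = (Ioi δ).indicator (fun r => kern p (ρ n) r * ENNReal.ofReal (r ^ ((N : ℝ) - 1 + 0))) r := by
    intro r
    by_cases hh : δ < r <;> simp [indicator, hh]
  simp only [h3]
  rw [setLIntegral_indicator measurableSet_Ioi,
    inter_eq_left.2 (Ioi_subset_Ioi hδ.le)]
  apply setLIntegral_congr_fun measurableSet_Ioi
  intro r hr
  have hr0 : 0 < r := hδ.trans hr
  have := hρ.nonneg n r hr0
  simp only [kern]
  rw [← ENNReal.ofReal_mul (by positivity)]
  congr 1
  rw [Real.rpow_sub hr0 _ p, add_zero]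
  field_simp

theorem innerMass_le_one (hρ : IsMollifierSeq N p ρ) {δ : ℝ} (hδ : δ < 1) (n : ℕ) :
    ∫⁻ r in Ioc (0 : ℝ) δ, ENNReal.ofReal (ρ n r * r ^ ((N : ℝ) - 1)) ≤ 1 := by
  rw [← hρ.mass n]
  exact lintegral_mono_set (fun r hr => ⟨hr.1, hr.2.trans_lt hδ⟩)

/-- The mass on `(0,1)` is `1`, and the part on `(δ,1)` is dominated by the vanishing tail because
`r^(-p) ≥ 1` for `r < 1`. -/
theorem tendsto_innerMass (hp : 0 ≤ p) (hρ : IsMollifierSeq N p ρ) {δ : ℝ} (h0 : 0 < δ)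
    (hδ : δ < 1) :
    Tendsto (fun n => ∫⁻ r in Ioc (0 : ℝ) δ, ENNReal.ofReal (ρ n r * r ^ ((N : ℝ) - 1)))
      atTop (𝓝 1) := by
  have hlow : Tendsto (fun n => 1 - ∫⁻ r in Ioi δ, ENNReal.ofReal (ρ n r * r ^ ((N : ℝ) - 1 - p)))
      atTop (𝓝 1) := by
    have := ENNReal.Tendsto.sub (tendsto_const_nhds (x := (1 : ℝ≥0∞)) (f := atTop))
      (hρ.tail δ h0) (Or.inl ENNReal.one_ne_top)
    simpa using this
  refine tendsto_of_tendsto_of_tendsto_of_le_of_le hlow tendsto_const_nhds ?_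
    (fun n => innerMass_le_one hρ hδ n)
  intro n
  simp only [tsub_le_iff_right]
  have hun : Ioo (0 : ℝ) 1 = Ioc 0 δ ∪ Ioo δ 1 := (Ioc_union_Ioo_eq_Ioo h0.le hδ).symm
  calc (1 : ℝ≥0∞) = ∫⁻ r in Ioc 0 δ ∪ Ioo δ 1, ENNReal.ofReal (ρ n r * r ^ ((N : ℝ) - 1)) := by
        rw [← hun, hρ.mass n]
    _ ≤ _ := lintegral_union_le _ _ _
    _ ≤ _ := by
        refine add_le_add le_rfl ?_
        calc ∫⁻ r in Ioo δ 1, ENNReal.ofReal (ρ n r * r ^ ((N : ℝ) - 1))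
            ≤ ∫⁻ r in Ioo δ 1, ENNReal.ofReal (ρ n r * r ^ ((N : ℝ) - 1 - p)) := by
              apply setLIntegral_mono' measurableSet_Ioo
              intro r hr
              have hr0 : 0 < r := h0.trans hr.1
              have := hρ.nonneg n r hr0
              apply ENNReal.ofReal_le_ofReal
              apply mul_le_mul_of_nonneg_left _ this
              exact Real.rpow_le_rpow_of_exponent_ge hr0 hr.2.le (by linarith)
          _ ≤ _ := lintegral_mono_set (fun r hr => hr.1)

theorem norm_smul_rpow_homogeneous (q : ℝ) (t : ℝ) (ht : 0 < t) (h : RN N) :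
    ENNReal.ofReal (‖t • h‖ ^ q) = ENNReal.ofReal (t ^ q) * ENNReal.ofReal (‖h‖ ^ q) := by
  rw [norm_smul, Real.norm_of_nonneg ht.le, Real.mul_rpow ht.le (norm_nonneg _),
    ENNReal.ofReal_mul (by positivity)]

theorem exists_gauge_le_imp (hKb : Bornology.IsBounded K) (hK0 : (0 : RN N) ∈ interior K)
    {δ : ℝ} (hδ : 0 < δ) : ∃ δ', 0 < δ' ∧ δ' < 1 ∧ ∀ h, gauge K h ≤ δ' → ‖h‖ < δ := by
  obtain ⟨R, hR0, hR⟩ := exists_norm_le_mul_gauge hKb hK0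
  refine ⟨min (1 / 2) (δ / (2 * R)), by positivity, ?_, fun h hh => ?_⟩
  · exact (min_le_left _ _).trans_lt (by norm_num)
  · calc ‖h‖ ≤ R * gauge K h := hR h
      _ ≤ R * (δ / (2 * R)) := by gcongr; exact hh.trans (min_le_right _ _)
      _ = δ / 2 := by field_simp
      _ < δ := by linarith

/-- Near `0` the comparison function is homogeneous, and the inner mass is at most `1`; away from
`0` the global bound `C` multiplies a tail that tends to zero. The slack `a‖h‖^p` is homogeneous too
and costs only a multiple of `a`. -/
theorem limsup_radial_le (hN : 1 ≤ N) (hp : 0 ≤ p) (hKc : Convex ℝ K)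
    (hKb : Bornology.IsBounded K) (hK0 : (0 : RN N) ∈ interior K) (hρ : IsMollifierSeq N p ρ)
    {D f : RN N → ℝ≥0∞} (hf : Measurable f)
    (hom : ∀ t : ℝ, 0 < t → ∀ h, f (t • h) = ENNReal.ofReal (t ^ p) * f h)
    {C : ℝ≥0∞} (hC : C ≠ ⊤) (hD : ∀ h, D h ≤ C) {a : ℝ≥0∞} {δ : ℝ} (hδ : 0 < δ)
    (hDf : ∀ h, ‖h‖ < δ → D h ≤ f h + a * ENNReal.ofReal (‖h‖ ^ p)) :
    limsup (fun n => ∫⁻ h, D h * kern p (ρ n) (gauge K h)) atTop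
      ≤ coneMass K p f + a * coneMass K p (fun h => ENNReal.ofReal (‖h‖ ^ p)) := by
  have hgc : Continuous (gauge K) := continuous_gauge hKc (mem_interior_iff_mem_nhds.1 hK0)
  obtain ⟨δ', h0, h1, hsub⟩ := exists_gauge_le_imp hKb hK0 hδ
  have hms : MeasurableSet {h : RN N | gauge K h ≤ δ'} :=
    measurableSet_le hgc.measurable measurable_const
  set B := coneMass K p f + a * coneMass K p (fun h => ENNReal.ofReal (‖h‖ ^ p)) with hB
  have key : ∀ n, ∫⁻ h, D h * kern p (ρ n) (gauge K h) ≤ B + C * (coneMass K 0 (fun _ => 1) *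
      ∫⁻ r in Ioi δ', ENNReal.ofReal (ρ n r * r ^ ((N : ℝ) - 1 - p))) := by
    intro n
    rw [← lintegral_add_compl _ hms]
    gcongr
    · calc ∫⁻ h in {h | gauge K h ≤ δ'}, D h * kern p (ρ n) (gauge K h)
          ≤ ∫⁻ h in {h | gauge K h ≤ δ'}, (f h * kern p (ρ n) (gauge K h) +
            a * (ENNReal.ofReal (‖h‖ ^ p) * kern p (ρ n) (gauge K h))) := by
            apply setLIntegral_mono' hms
            intro h hh
            rw [← mul_assoc, ← add_mul]
            gcongr
            exact hDf h (hsub h hh)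
        _ = B * ∫⁻ r in Ioc (0 : ℝ) δ', ENNReal.ofReal (ρ n r * r ^ ((N : ℝ) - 1)) := by
            have hk := (aemeasurable_comp_gauge hN hKc hKb hK0 (aemeasurable_kern hρ n)).restrict
              (s := {h | gauge K h ≤ δ'})
            have hk2 : AEMeasurable (fun h : RN N => ENNReal.ofReal (‖h‖ ^ p) *
              kern p (ρ n) (gauge K h)) (volume.restrict {h | gauge K h ≤ δ'}) := by fun_prop
            rw [lintegral_add_right' _ (hk2.const_mul a), lintegral_const_mul'' _ hk2, lintegral_inner hN hp hKc hKb hK0 hρ hf hom,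
              lintegral_inner hN hp hKc hKb hK0 hρ (by fun_prop)
                (norm_smul_rpow_homogeneous p)]
            rw [hB]; ring
        _ ≤ B * 1 := by gcongr; exact innerMass_le_one hρ h1 n
        _ = B := mul_one _
    · calc ∫⁻ h in {h | gauge K h ≤ δ'}ᶜ, D h * kern p (ρ n) (gauge K h)
          ≤ ∫⁻ h in {h | gauge K h ≤ δ'}ᶜ, C * kern p (ρ n) (gauge K h) := by
            gcongr; exact hD _
        _ = _ := by
            rw [lintegral_const_mul' _ _ hC, lintegral_outer hN hKc hKb hK0 hρ h0]
  have hcone : coneMass K 0 (fun _ : RN N => 1) ≠ ⊤ := by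
    have := coneMass_norm_lt_top hKb (q := 0) le_rfl
    simpa using this.ne
  have hlim : Tendsto (fun n => B + C * (coneMass K 0 (fun _ => 1) *
      ∫⁻ r in Ioi δ', ENNReal.ofReal (ρ n r * r ^ ((N : ℝ) - 1 - p)))) atTop (𝓝 B) := by
    have := (ENNReal.Tendsto.const_mul (ENNReal.Tendsto.const_mul (hρ.tail δ' h0)
      (Or.inr hcone)) (Or.inr hC)).const_add B
    simpa using this
  rw [← hlim.limsup_eq]
  exact limsup_le_limsup (Eventually.of_forall key)

/-- Here the outer region is simply discarded, so no global bound on `D` is needed; the inner mass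
must now tend to `1`. The error stays on the right because subtraction in `ℝ≥0∞` truncates. -/
theorem le_liminf_radial_add (hN : 1 ≤ N) (hp : 0 ≤ p) (hKc : Convex ℝ K)
    (hKb : Bornology.IsBounded K) (hK0 : (0 : RN N) ∈ interior K) (hρ : IsMollifierSeq N p ρ)
    {D f : RN N → ℝ≥0∞} (hf : Measurable f)
    (hom : ∀ t : ℝ, 0 < t → ∀ h, f (t • h) = ENNReal.ofReal (t ^ p) * f h)
    {a : ℝ≥0∞} (ha : a ≠ ⊤) {δ : ℝ} (hδ : 0 < δ)
    (hDf : ∀ h, ‖h‖ < δ → f h ≤ D h + a * ENNReal.ofReal (‖h‖ ^ p)) :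
    coneMass K p f ≤ liminf (fun n => ∫⁻ h, D h * kern p (ρ n) (gauge K h)) atTop
      + a * coneMass K p (fun h => ENNReal.ofReal (‖h‖ ^ p)) := by
  have hgc : Continuous (gauge K) := continuous_gauge hKc (mem_interior_iff_mem_nhds.1 hK0)
  obtain ⟨δ', h0, h1, hsub⟩ := exists_gauge_le_imp hKb hK0 hδ
  have hms : MeasurableSet {h : RN N | gauge K h ≤ δ'} :=
    measurableSet_le hgc.measurable measurable_const
  set c := coneMass K p (fun h : RN N => ENNReal.ofReal (‖h‖ ^ p))
  have hc : c ≠ ⊤ := (coneMass_norm_lt_top hKb hp).ne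
  have key : ∀ n, coneMass K p f *
      (∫⁻ r in Ioc (0 : ℝ) δ', ENNReal.ofReal (ρ n r * r ^ ((N : ℝ) - 1))) - a * c
      ≤ ∫⁻ h, D h * kern p (ρ n) (gauge K h) := by
    intro n
    rw [tsub_le_iff_right]
    have hk := (aemeasurable_comp_gauge hN hKc hKb hK0 (aemeasurable_kern hρ n)).restrict
      (s := {h | gauge K h ≤ δ'})
    rw [← lintegral_inner hN hp hKc hKb hK0 hρ hf hom]
    calc ∫⁻ h in {h | gauge K h ≤ δ'}, f h * kern p (ρ n) (gauge K h)
        ≤ ∫⁻ h in {h | gauge K h ≤ δ'}, (D h * kern p (ρ n) (gauge K h) +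
            a * (ENNReal.ofReal (‖h‖ ^ p) * kern p (ρ n) (gauge K h))) := by
          apply setLIntegral_mono' hms
          intro h hh
          rw [← mul_assoc, ← add_mul]
          gcongr
          exact hDf h (hsub h hh)
      _ = (∫⁻ h in {h | gauge K h ≤ δ'}, D h * kern p (ρ n) (gauge K h)) + a * (c *
          ∫⁻ r in Ioc (0 : ℝ) δ', ENNReal.ofReal (ρ n r * r ^ ((N : ℝ) - 1))) := by
          have hk2 : AEMeasurable (fun h : RN N => ENNReal.ofReal (‖h‖ ^ p) *
            kern p (ρ n) (gauge K h)) (volume.restrict {h | gauge K h ≤ δ'}) := by fun_prop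
          rw [lintegral_add_right' _ (hk2.const_mul a), lintegral_const_mul'' _ hk2,
            lintegral_inner hN hp hKc hKb hK0 hρ (f := fun h => ENNReal.ofReal (‖h‖ ^ p)) (by fun_prop)
              (norm_smul_rpow_homogeneous p)]
      _ ≤ (∫⁻ h, D h * kern p (ρ n) (gauge K h)) + a * (c * 1) := by
          refine add_le_add (setLIntegral_le_lintegral _ _) ?_
          gcongr
          exact innerMass_le_one hρ h1 n
      _ = _ := by rw [mul_one]
  have hlim : Tendsto (fun n => coneMass K p f *
      (∫⁻ r in Ioc (0 : ℝ) δ', ENNReal.ofReal (ρ n r * r ^ ((N : ℝ) - 1))) - a * c) atTop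
      (𝓝 (coneMass K p f - a * c)) := by
    have h2 := ENNReal.Tendsto.const_mul (a := coneMass K p f) (tendsto_innerMass hp hρ h0 h1)
      (Or.inl one_ne_zero)
    rw [mul_one] at h2
    exact ENNReal.Tendsto.sub h2 tendsto_const_nhds (Or.inr (ENNReal.mul_ne_top ha hc))
  rw [← tsub_le_iff_right, ← hlim.liminf_eq]
  exact liminf_le_liminf (Eventually.of_forall key)

end Mollifier

end Gauge

/-! ### Averages and translations in `L^p`. -/

section Lp

theorem lintegral_rpow_le_of_isProbabilityMeasure {Z : Type*} [MeasurableSpace Z] {κ : Measure Z}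
    [IsProbabilityMeasure κ] {p : ℝ} (hp : 1 ≤ p) {f : Z → ℝ≥0∞} (hf : AEMeasurable f κ) :
    (∫⁻ z, f z ∂κ) ^ p ≤ ∫⁻ z, f z ^ p ∂κ := by
  have h := eLpNorm'_le_eLpNorm'_of_exponent_le one_pos hp κ hf.aestronglyMeasurable
  simp only [eLpNorm', enorm_eq_self, ENNReal.rpow_one, div_one] at h
  calc (∫⁻ z, f z ∂κ) ^ p ≤ ((∫⁻ z, f z ^ p ∂κ) ^ (1 / p)) ^ p := by gcongr
    _ = ∫⁻ z, f z ^ p ∂κ := by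
      rw [← ENNReal.rpow_mul, one_div_mul_cancel (by positivity), ENNReal.rpow_one]

theorem eLpNorm_ofReal_rpow {X ε : Type*} [MeasurableSpace X] [ENorm ε] {μ : Measure X} {p : ℝ}
    (hp : 1 ≤ p) (f : X → ε) :
    eLpNorm f (ENNReal.ofReal p) μ ^ p = ∫⁻ x, ‖f x‖ₑ ^ p ∂μ := by
  have hp0 : 0 < p := by linarith
  rw [eLpNorm_eq_lintegral_rpow_enorm_toReal (by simpa using hp0) ENNReal.ofReal_ne_top,
    ENNReal.toReal_ofReal hp0.le, ← ENNReal.rpow_mul, one_div_mul_cancel hp0.ne', ENNReal.rpow_one]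

/-- A form of Minkowski's integral inequality for averages: Jensen in `z`, then Tonelli. It serves
both for averages over a bump and for averages over the segment parameter. -/
theorem eLpNorm_le_of_enorm_le_lintegral {X Z ε : Type*} [MeasurableSpace X] [MeasurableSpace Z]
    [ENorm ε] {μ : Measure X} [SFinite μ] {κ : Measure Z} [IsProbabilityMeasure κ] {p : ℝ}
    (hp : 1 ≤ p) {F : X → ε} {H : X → Z → ℝ≥0∞}
    (hH : AEMeasurable (Function.uncurry H) (μ.prod κ))
    (hF : ∀ᵐ x ∂μ, ‖F x‖ₑ ≤ ∫⁻ z, H x z ∂κ) {M : ℝ≥0∞}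
    (hM : ∀ᵐ z ∂κ, eLpNorm (fun x => H x z) (ENNReal.ofReal p) μ ≤ M) :
    eLpNorm F (ENNReal.ofReal p) μ ≤ M := by
  have hp0 : 0 < p := by linarith
  rw [← ENNReal.rpow_le_rpow_iff hp0, eLpNorm_ofReal_rpow hp]
  calc ∫⁻ x, ‖F x‖ₑ ^ p ∂μ ≤ ∫⁻ x, ∫⁻ z, H x z ^ p ∂κ ∂μ := by
        apply lintegral_mono_ae
        filter_upwards [hF, hH.aestronglyMeasurable.prodMk_left] with x hx hx2
        exact (ENNReal.rpow_le_rpow hx hp0.le).trans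
          (lintegral_rpow_le_of_isProbabilityMeasure hp hx2.aemeasurable)
    _ = ∫⁻ z, ∫⁻ x, H x z ^ p ∂μ ∂κ := by
        apply lintegral_lintegral_swap
        exact hH.pow_const p
    _ ≤ ∫⁻ z, M ^ p ∂κ := by
        apply lintegral_mono_ae
        filter_upwards [hM] with z hz
        have := ENNReal.rpow_le_rpow hz hp0.le
        rw [eLpNorm_ofReal_rpow hp] at this
        simpa using this
    _ = M ^ p := by simp

variable {N : ℕ} {V : Type*} [NormedAddCommGroup V] {p : ℝ}

theorem eLpNorm_comp_add_right {f : RN N → V} (hf : AEStronglyMeasurable f volume) (q : ℝ≥0∞)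
    (k : RN N) : eLpNorm (fun x => f (x + k)) q volume = eLpNorm f q volume :=
  eLpNorm_comp_measurePreserving hf (measurePreserving_add_right volume k)

theorem eLpNorm_sub_right {f : RN N → V} (hf : AEStronglyMeasurable f volume) (q : ℝ≥0∞)
    (k : RN N) : eLpNorm (fun x => f (x - k)) q volume = eLpNorm f q volume :=
  eLpNorm_comp_measurePreserving hf (measurePreserving_sub_right volume k)

/-- Translations depend continuously on the vector in the compact-open topology, and composition
with measure preserving maps is continuous on `L^p` for that topology. -/
theorem exists_translation_close (hp : 1 ≤ p) {f : RN N → V}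
    (hf : MemLp f (ENNReal.ofReal p) volume) {e : ℝ≥0∞} (he : 0 < e) :
    ∃ δ > 0, ∀ k : RN N, ‖k‖ < δ →
      eLpNorm (fun x => f (x + k) - f x) (ENNReal.ofReal p) volume ≤ e := by
  have : Fact (1 ≤ ENNReal.ofReal p) := ⟨by simpa using hp⟩
  set F : Lp V (ENNReal.ofReal p) (volume : Measure (RN N)) := hf.toLp f
  let g : RN N → C(RN N, RN N) := fun k => ⟨fun x => x + k, by fun_prop⟩
  have hg : Tendsto g (𝓝 0) (𝓝 (g 0)) := by
    have : Continuous g :=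
      ContinuousMap.continuous_of_continuous_uncurry _ (by
        simp only [g, ContinuousMap.coe_mk, Function.uncurry_def]; fun_prop)
    exact this.tendsto 0
  have hmp : ∀ k, MeasurePreserving (g k) (volume : Measure (RN N)) volume := fun k =>
    measurePreserving_add_right volume k
  have h := Filter.Tendsto.compMeasurePreservingLp (tendsto_const_nhds (x := F)) hg hmp (hmp 0)
    ENNReal.ofReal_ne_top
  have hev := h (Metric.eball_mem_nhds _ he)
  obtain ⟨δ, hδ, hsub⟩ := Metric.mem_nhds_iff.1 hev
  refine ⟨δ, hδ, fun k hk => ?_⟩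
  have h1 : edist (Lp.compMeasurePreserving (g k) (hmp k) F)
      (Lp.compMeasurePreserving (g 0) (hmp 0) F) < e := hsub (by simpa using hk)
  rw [Lp.edist_def] at h1
  refine le_trans (le_of_eq ?_) h1.le
  apply eLpNorm_congr_ae
  have hF := hf.coeFn_toLp
  filter_upwards [Lp.coeFn_compMeasurePreserving F (hmp k), Lp.coeFn_compMeasurePreserving F (hmp 0),
    (hmp k).quasiMeasurePreserving.ae hF, hF] with x h1 h2 h3 h4
  simp only [Pi.sub_apply, h1, h2, Function.comp_apply]
  rw [h3]
  have : (g 0) x = x := by simp [g]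
  rw [this, h4]
  rfl

end Lp

/-! ### Mollification by normalized bumps. -/

section Moll

variable {N : ℕ} {V : Type*} [NormedAddCommGroup V]

/-- The probability measure with density the normalized bump `φ`. -/
def bumpMeasure (φ : ContDiffBump (0 : RN N)) : Measure (RN N) :=
  (volume : Measure (RN N)).withDensity (fun z => ENNReal.ofReal (φ.normed volume z))

theorem measurable_ofReal_normed (φ : ContDiffBump (0 : RN N)) :
    Measurable (fun z => ENNReal.ofReal (φ.normed volume z)) :=
  φ.continuous_normed.measurable.ennreal_ofReal

instance (φ : ContDiffBump (0 : RN N)) : IsProbabilityMeasure (bumpMeasure φ) := by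
  constructor
  rw [bumpMeasure, withDensity_apply _ MeasurableSet.univ, Measure.restrict_univ,
    ← ofReal_integral_eq_lintegral_ofReal φ.integrable_normed
      (Eventually.of_forall φ.nonneg_normed), φ.integral_normed, ENNReal.ofReal_one]

theorem bumpMeasure_absolutelyContinuous (φ : ContDiffBump (0 : RN N)) :
    bumpMeasure φ ≪ volume := withDensity_absolutelyContinuous _ _

theorem ae_bumpMeasure_norm_lt (φ : ContDiffBump (0 : RN N)) :
    ∀ᵐ z ∂bumpMeasure φ, ‖z‖ < φ.rOut := by
  rw [bumpMeasure, ae_withDensity_iff (measurable_ofReal_normed φ)]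
  refine Eventually.of_forall fun z hz => ?_
  have : z ∈ Function.support (φ.normed volume) := by
    intro h; simp [h] at hz
  rw [φ.support_normed_eq] at this
  simpa using this

theorem lintegral_normed_mul (φ : ContDiffBump (0 : RN N)) (f : RN N → ℝ≥0∞) :
    ∫⁻ z, ENNReal.ofReal (φ.normed volume z) * f z = ∫⁻ z, f z ∂bumpMeasure φ := by
  rw [bumpMeasure, lintegral_withDensity_eq_lintegral_mul_non_measurable _
    (measurable_ofReal_normed φ) (by simp)]
  rfl

/-- The mollification of `‖f‖`. -/
def eMoll (φ : ContDiffBump (0 : RN N)) (f : RN N → V) (x : RN N) : ℝ≥0∞ :=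
  ∫⁻ z, ‖f (x - z)‖ₑ ∂bumpMeasure φ

theorem aemeasurable_sub_prod {f : RN N → V} (hf : AEStronglyMeasurable f volume)
    (φ : ContDiffBump (0 : RN N)) :
    AEMeasurable (Function.uncurry fun x z : RN N => ‖f (x - z)‖ₑ)
      ((volume : Measure (RN N)).prod (bumpMeasure φ)) := by
  have h1 : AEStronglyMeasurable (fun q : RN N × RN N => f (q.1 - q.2))
      ((volume : Measure (RN N)).prod volume) :=
    hf.comp_quasiMeasurePreserving (quasiMeasurePreserving_sub volume volume)
  exact (h1.mono_ac (Measure.AbsolutelyContinuous.rfl.prod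
    (bumpMeasure_absolutelyContinuous φ))).enorm

theorem measurable_eMoll {f : RN N → V} (hf : StronglyMeasurable f)
    (φ : ContDiffBump (0 : RN N)) : Measurable (eMoll φ f) := by
  have : Measurable (fun q : RN N × RN N => ‖f (q.1 - q.2)‖ₑ) :=
    (hf.comp_measurable measurable_sub).enorm
  exact this.lintegral_prod_right'

variable {p : ℝ}

theorem eLpNorm_eMoll_le (hp : 1 ≤ p) {f : RN N → V} (hf : AEStronglyMeasurable f volume)
    (φ : ContDiffBump (0 : RN N)) :
    eLpNorm (eMoll φ f) (ENNReal.ofReal p) volume ≤ eLpNorm f (ENNReal.ofReal p) volume := by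
  refine eLpNorm_le_of_enorm_le_lintegral hp (aemeasurable_sub_prod hf φ)
    (Eventually.of_forall fun x => ?_) (Eventually.of_forall fun z => ?_)
  · simp [eMoll]
  · rw [← eLpNorm_sub_right hf _ z]
    exact eLpNorm_mono_enorm fun x => by simp

variable [NormedSpace ℝ V]

/-- The mollification of `f` by the normalized bump `φ`. -/
def moll (φ : ContDiffBump (0 : RN N)) (f : RN N → V) : RN N → V :=
  convolution (φ.normed volume) f (ContinuousLinearMap.lsmul ℝ ℝ) volume

theorem moll_apply (φ : ContDiffBump (0 : RN N)) (f : RN N → V) (x : RN N) :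
    moll φ f x = ∫ z, φ.normed volume z • f (x - z) := rfl

theorem moll_apply_swap (φ : ContDiffBump (0 : RN N)) (f : RN N → V) (x : RN N) :
    moll φ f x = ∫ y, φ.normed volume (x - y) • f y := by
  rw [moll, convolution_eq_swap]; rfl

theorem enorm_integral_normed_smul_le (φ : ContDiffBump (0 : RN N)) (f : RN N → V) :
    ‖∫ z, φ.normed volume z • f z‖ₑ ≤ ∫⁻ z, ‖f z‖ₑ ∂bumpMeasure φ := by
  refine (enorm_integral_le_lintegral_enorm _).trans ?_
  rw [← lintegral_normed_mul]
  gcongr with z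
  rw [enorm_smul, Real.enorm_of_nonneg (φ.nonneg_normed z)]

theorem enorm_moll_le (φ : ContDiffBump (0 : RN N)) (f : RN N → V) (x : RN N) :
    ‖moll φ f x‖ₑ ≤ eMoll φ f x :=
  enorm_integral_normed_smul_le φ _

theorem eLpNorm_moll_le (hp : 1 ≤ p) {f : RN N → V} (hf : AEStronglyMeasurable f volume)
    (φ : ContDiffBump (0 : RN N)) :
    eLpNorm (moll φ f) (ENNReal.ofReal p) volume ≤ eLpNorm f (ENNReal.ofReal p) volume :=
  (eLpNorm_mono_enorm fun x => by simpa using enorm_moll_le φ f x).trans (eLpNorm_eMoll_le hp hf φ)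

theorem integrable_normed_smul {f : RN N → V} (hf : LocallyIntegrable f volume)
    (φ : ContDiffBump (0 : RN N)) (x : RN N) :
    Integrable (fun z => φ.normed volume z • f (x - z)) :=
  (φ.hasCompactSupport_normed.convolutionExists_left (ContinuousLinearMap.lsmul ℝ ℝ)
    φ.continuous_normed hf) x

theorem moll_sub_eq [CompleteSpace V] {f : RN N → V} (hf : LocallyIntegrable f volume)
    (φ : ContDiffBump (0 : RN N)) (x : RN N) (v : V) :
    moll φ f x - v = ∫ z, φ.normed volume z • (f (x - z) - v) := by
  rw [moll_apply]
  simp_rw [smul_sub]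
  rw [integral_sub (integrable_normed_smul hf φ x) (φ.integrable_normed.smul_const v),
    φ.integral_normed_smul]

/-- `moll φ f - f` is an average of translation differences of `f` by vectors shorter than `φ.rOut`,
so a bound for those differences passes to it. -/
theorem eLpNorm_moll_sub_le (hp : 1 ≤ p) [CompleteSpace V] {f : RN N → V}
    (hf : LocallyIntegrable f volume) (φ : ContDiffBump (0 : RN N)) {M : ℝ≥0∞}
    (hM : ∀ k : RN N, ‖k‖ < φ.rOut →
      eLpNorm (fun x => f (x + k) - f x) (ENNReal.ofReal p) volume ≤ M) :
    eLpNorm (fun x => moll φ f x - f x) (ENNReal.ofReal p) volume ≤ M := by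
  have hfm := hf.aestronglyMeasurable
  refine eLpNorm_le_of_enorm_le_lintegral (κ := bumpMeasure φ)
    (H := fun x z => ‖f (x - z) - f x‖ₑ) hp ?_
    (Eventually.of_forall fun x => ?_) ?_
  · have h1 : AEStronglyMeasurable (fun q : RN N × RN N => f (q.1 - q.2) - f q.1)
        ((volume : Measure (RN N)).prod volume) :=
      (hfm.comp_quasiMeasurePreserving (quasiMeasurePreserving_sub volume volume)).sub
        hfm.comp_fst
    exact (h1.mono_ac (Measure.AbsolutelyContinuous.rfl.prod
      (bumpMeasure_absolutelyContinuous φ))).enorm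
  · rw [moll_sub_eq hf]
    exact enorm_integral_normed_smul_le φ _
  · filter_upwards [ae_bumpMeasure_norm_lt φ] with z hz
    refine le_trans (eLpNorm_mono_enorm fun x => ?_) (hM (-z) (by simpa using hz))
    simp [sub_eq_add_neg]

theorem contDiff_moll {f : RN N → V} [CompleteSpace V] (hf : LocallyIntegrable f volume)
    (φ : ContDiffBump (0 : RN N)) (n : ℕ∞) : ContDiff ℝ n (moll φ f) :=
  φ.hasCompactSupport_normed.contDiff_convolution_left _ φ.contDiff_normed hf

theorem continuous_moll {f : RN N → V} [CompleteSpace V] (hf : LocallyIntegrable f volume)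
    (φ : ContDiffBump (0 : RN N)) : Continuous (moll φ f) :=
  (contDiff_moll hf φ 0).continuous

theorem fderiv_moll {f : RN N → V} [CompleteSpace V] (hf : LocallyIntegrable f volume)
    (φ : ContDiffBump (0 : RN N)) (x h : RN N) :
    fderiv ℝ (moll φ f) x h = ∫ y, fderiv ℝ (φ.normed volume) (x - y) h • f y := by
  have h1 := φ.hasCompactSupport_normed (μ := volume) |>.hasFDerivAt_convolution_left
    (ContinuousLinearMap.lsmul ℝ ℝ) (φ.contDiff_normed (n := 1)) hf x
  have h2 : fderiv ℝ (moll φ f) x = _ := h1.fderiv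
  have hc : Continuous (fderiv ℝ (φ.normed volume)) :=
    (φ.contDiff_normed (μ := volume) (n := 1)).continuous_fderiv (by simp)
  have h3 := φ.hasCompactSupport_normed (μ := volume) |>.fderiv (𝕜 := ℝ) |>.convolutionExists_left
    ((ContinuousLinearMap.lsmul ℝ ℝ).precompL (RN N) : _ →L[ℝ] V →L[ℝ] _) hc hf x
  rw [h2, convolution_eq_swap, ContinuousLinearMap.integral_apply h3.integrable_swap]
  rfl

end Moll

/-! ### The pairing of `ℂ^N` with `ℝ^N`. -/

section Dot

variable {N : ℕ}

/-- The continuous linear map `v ↦ v · h` on `ℂ^N`. -/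
def cdotCLM (h : RN N) : CN N →L[ℝ] ℂ :=
  (∑ j, (h j : ℂ) • (EuclideanSpace.proj j : CN N →L[ℂ] ℂ)).restrictScalars ℝ

@[simp] theorem cdotCLM_apply (h : RN N) (v : CN N) : cdotCLM h v = cdot v h := by
  simp [cdotCLM, cdot, mul_comm]

theorem norm_toCN (h : RN N) : ‖toCN h‖ = ‖h‖ := by
  simp [toCN, EuclideanSpace.norm_eq]

theorem cdot_eq_inner (v : CN N) (h : RN N) : cdot v h = inner ℂ (toCN h) v := by
  simp [cdot, toCN, PiLp.inner_apply]

theorem norm_cdot_le (v : CN N) (h : RN N) : ‖cdot v h‖ ≤ ‖h‖ * ‖v‖ := by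
  rw [cdot_eq_inner, ← norm_toCN h]
  exact norm_inner_le_norm _ _

theorem enorm_cdot_le (v : CN N) (h : RN N) : ‖cdot v h‖ₑ ≤ ‖h‖ₑ * ‖v‖ₑ := by
  rw [← ofReal_norm, ← ofReal_norm, ← ofReal_norm, ← ENNReal.ofReal_mul (norm_nonneg _)]
  exact ENNReal.ofReal_le_ofReal (norm_cdot_le v h)

theorem cdot_add_left (v w : CN N) (h : RN N) : cdot (v + w) h = cdot v h + cdot w h := by
  simp [← cdotCLM_apply]

theorem cdot_sub_left (v w : CN N) (h : RN N) : cdot (v - w) h = cdot v h - cdot w h := by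
  simp [← cdotCLM_apply]

theorem cdot_smul_left (c : ℂ) (v : CN N) (h : RN N) : cdot (c • v) h = c * cdot v h := by
  simp [cdot, Finset.mul_sum, mul_assoc]

theorem cdot_smul_right (v : CN N) (t : ℝ) (h : RN N) : cdot v (t • h) = t * cdot v h := by
  simp [cdot, Finset.mul_sum, mul_left_comm]

theorem cdot_toCN (a h : RN N) : cdot (toCN a) h = ((inner ℝ h a : ℝ) : ℂ) := by
  simp [cdot, toCN, PiLp.inner_apply]

theorem continuous_cdot : Continuous (fun q : CN N × RN N => cdot q.1 q.2) := by
  unfold cdot; fun_prop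

theorem continuous_toCN : Continuous (toCN : RN N → CN N) := by
  unfold toCN; fun_prop

end Dot

/-! ### The magnetic shift and its derivative along a segment. -/

section Shift

variable {N : ℕ}

/-- The magnetic phase of the shift by `h`. -/
def magPhase (A : RN N → RN N) (h x : RN N) : ℝ := inner ℝ h (A (x + (2 : ℝ)⁻¹ • h))

/-- The magnetic translation of `u` by `h`. -/
def magShift (A : RN N → RN N) (h : RN N) (u : RN N → ℂ) (x : RN N) : ℂ :=
  Complex.exp (((-magPhase A h x : ℝ) : ℂ) * Complex.I) * u (x + h)

theorem Psi_add_eq_magShift (A : RN N → RN N) (u : RN N → ℂ) (x h : RN N) :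
    Psi A u x (x + h) = magShift A h u x := by
  have h1 : (2 : ℝ)⁻¹ • (x + (x + h)) = x + (2 : ℝ)⁻¹ • h := by
    rw [← add_assoc, ← two_smul ℝ x, smul_add, smul_smul]; norm_num
  simp only [Psi, magShift, magPhase, h1, sub_add_cancel_left, inner_neg_left]
  rw [mul_comm Complex.I]

theorem Psi_self (A : RN N → RN N) (u : RN N → ℂ) (x : RN N) : Psi A u x x = u x := by
  simp [Psi]

/-- The mollified magnetic gradient `∇(φ * u) - i φ * (A u)`. -/
def magGrad (φ : ContDiffBump (0 : RN N)) (A : RN N → RN N) (u : RN N → ℂ) (y : RN N) : CN N :=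
  WithLp.toLp 2 fun j => fderiv ℝ (moll φ u) y (EuclideanSpace.single j (1 : ℝ))
    - Complex.I * moll φ (fun z => (A z j : ℂ) * u z) y

variable {A : RN N → RN N} {u : RN N → ℂ}

theorem locallyIntegrable_ofReal_mul {f : RN N → ℝ} (hf : Continuous f)
    (hu : LocallyIntegrable u volume) : LocallyIntegrable (fun z => (f z : ℂ) * u z) volume :=
  hu.continuous_mul (Complex.continuous_ofReal.comp hf)

/-- The magnetic gradient mollifies the product `A u` rather than multiplying `A` by the
mollification of `u`; this is what makes it the mollification of `∇u - iAu` when `u` has a weak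
gradient. -/
theorem fderiv_moll_eq_cdot_magGrad (hA : Continuous A) (hu : LocallyIntegrable u volume)
    (φ : ContDiffBump (0 : RN N)) (y h : RN N) :
    fderiv ℝ (moll φ u) y h = cdot (magGrad φ A u y) h
      + Complex.I * moll φ (fun z => ((inner ℝ h (A z) : ℝ) : ℂ) * u z) y := by
  have hh : h = ∑ j, h j • EuclideanSpace.single j (1 : ℝ) := by
    ext i
    simp [Finset.sum_apply, Pi.single_apply]
  have hAj : ∀ j, LocallyIntegrable (fun z => (A z j : ℂ) * u z) volume := fun j =>
    locallyIntegrable_ofReal_mul (by fun_prop) hu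
  have h1 : moll φ (fun z => ((inner ℝ h (A z) : ℝ) : ℂ) * u z) y
      = ∑ j, (h j : ℂ) * moll φ (fun z => (A z j : ℂ) * u z) y := by
    simp only [moll_apply]
    simp_rw [← integral_const_mul]
    rw [← integral_finsetSum]
    · congr 1 with z
      simp [PiLp.inner_apply, Finset.sum_mul, Finset.mul_sum]
      refine Finset.sum_congr rfl fun j _ => by ring
    · intro j _
      exact (integrable_normed_smul (hAj j) φ y).const_mul _
  rw [h1]
  conv_lhs => rw [hh]
  simp only [map_sum, map_smul, cdot, magGrad, Finset.mul_sum, ← Finset.sum_add_distrib]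
  refine Finset.sum_congr rfl fun j _ => ?_
  rw [Complex.real_smul]
  ring

theorem continuous_magGrad (hA : Continuous A) (hu : LocallyIntegrable u volume)
    (φ : ContDiffBump (0 : RN N)) : Continuous (magGrad φ A u) := by
  refine (PiLp.continuous_toLp 2 _).comp (continuous_pi fun j => ?_)
  refine Continuous.sub ?_ (continuous_const.mul (continuous_moll
    (locallyIntegrable_ofReal_mul (by fun_prop) hu) φ))
  exact ((contDiff_moll hu φ 1).continuous_fderiv (by simp)).clm_apply continuous_const

theorem magPhase_close {L : NNReal} (hA : LipschitzWith L A) (h x z : RN N) {t : ℝ}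
    (ht : t ∈ Icc (0 : ℝ) 1) :
    |inner ℝ h (A (x + t • h - z)) - magPhase A h x| ≤ ‖h‖ * L * (‖z‖ + ‖h‖) := by
  rw [magPhase, ← inner_sub_right]
  refine (abs_real_inner_le_norm _ _).trans ?_
  rw [mul_assoc]
  gcongr
  have h1 := hA.dist_le_mul (x + t • h - z) (x + (2 : ℝ)⁻¹ • h)
  rw [dist_eq_norm, dist_eq_norm] at h1
  refine h1.trans ?_
  gcongr
  have h2 : x + t • h - z - (x + (2 : ℝ)⁻¹ • h) = (t - 2⁻¹) • h - z := by
    rw [sub_smul]; abel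
  rw [h2]
  calc ‖(t - 2⁻¹) • h - z‖ ≤ ‖(t - 2⁻¹) • h‖ + ‖z‖ := norm_sub_le _ _
    _ ≤ 1 * ‖h‖ + ‖z‖ := by
      rw [norm_smul]
      gcongr
      rw [Real.norm_eq_abs, abs_le]
      constructor <;> linarith [ht.1, ht.2]
    _ = ‖z‖ + ‖h‖ := by ring

/-- The fundamental theorem of calculus for `t ↦ e^{-itα} u_φ(x+th)` with `α` frozen at the midpoint
value. The remainder `R` is `i` times the mollification at `x+th` of `(h·A - α)u`; the Lipschitz
condition makes it small, of size `‖h‖ (rOut + ‖h‖)` times the mollified `|u|`. -/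
theorem exists_magShift_moll_sub_eq {L : NNReal} (hA : LipschitzWith L A)
    (hu : LocallyIntegrable u volume) (φ : ContDiffBump (0 : RN N)) (h x : RN N) :
    ∃ R : ℝ → ℂ, Continuous R ∧
      (∀ t ∈ Icc (0 : ℝ) 1, ‖R t‖ₑ ≤ ENNReal.ofReal (‖h‖ * L * (φ.rOut + ‖h‖)) *
        eMoll φ u (x + t • h)) ∧
      magShift A h (moll φ u) x - moll φ u x = ∫ t in Ioc (0 : ℝ) 1,
        Complex.exp (((-(t * magPhase A h x) : ℝ) : ℂ) * Complex.I) *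
          (cdot (magGrad φ A u (x + t • h)) h + R t) := by
  have hAc := hA.continuous
  set α := magPhase A h x with hα
  have hAh : LocallyIntegrable (fun z => ((inner ℝ h (A z) : ℝ) : ℂ) * u z) volume :=
    locallyIntegrable_ofReal_mul (by fun_prop) hu
  have hcm := continuous_moll hu φ
  have hcm2 := continuous_moll hAh φ
  have hcg := continuous_magGrad hAc hu φ
  refine ⟨fun t => Complex.I * (moll φ (fun z => ((inner ℝ h (A z) : ℝ) : ℂ) * u z) (x + t • h)
    - α * moll φ u (x + t • h)), by fun_prop, ?_, ?_⟩
  · intro t ht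
    have h1 : moll φ (fun z => ((inner ℝ h (A z) : ℝ) : ℂ) * u z) (x + t • h)
        - α * moll φ u (x + t • h) = ∫ z, φ.normed volume z •
          (((inner ℝ h (A (x + t • h - z)) - α : ℝ) : ℂ) * u (x + t • h - z)) := by
      rw [moll_apply, moll_apply, ← integral_const_mul, ← integral_sub
        (integrable_normed_smul hAh φ _) ((integrable_normed_smul hu φ _).const_mul _)]
      congr 1 with z
      simp only [Complex.real_smul]
      push_cast; ring
    rw [enorm_mul, h1]
    have hI : ‖Complex.I‖ₑ = 1 := by
      rw [← ofReal_norm, Complex.norm_I, ENNReal.ofReal_one]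
    rw [hI, one_mul]
    refine (enorm_integral_normed_smul_le φ _).trans ?_
    rw [eMoll, ← lintegral_const_mul' _ _ ENNReal.ofReal_ne_top]
    apply lintegral_mono_ae
    filter_upwards [ae_bumpMeasure_norm_lt φ] with z hz
    rw [enorm_mul]
    gcongr
    rw [← ofReal_norm, Complex.norm_real, Real.norm_eq_abs]
    apply ENNReal.ofReal_le_ofReal
    refine (magPhase_close hA h x z ht).trans ?_
    gcongr
  · have hder : ∀ t : ℝ, HasDerivAt (fun t : ℝ =>
        Complex.exp (((-(t * α) : ℝ) : ℂ) * Complex.I) * moll φ u (x + t • h))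
        (Complex.exp (((-(t * α) : ℝ) : ℂ) * Complex.I) *
          (cdot (magGrad φ A u (x + t • h)) h + Complex.I *
            (moll φ (fun z => ((inner ℝ h (A z) : ℝ) : ℂ) * u z) (x + t • h)
              - α * moll φ u (x + t • h)))) t := by
      intro t
      have e1 : HasDerivAt (fun t : ℝ => (((-(t * α) : ℝ) : ℂ) * Complex.I))
          (((-(1 * α) : ℝ) : ℂ) * Complex.I) t :=
        (((hasDerivAt_id t).mul_const α).neg.ofReal_comp).mul_const _
      have e2 := e1.cexp
      have e3 : HasDerivAt (fun t : ℝ => x + t • h) h t := by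
        simpa using ((hasDerivAt_id t).smul_const h).const_add x
      have e4 : HasFDerivAt (moll φ u) (fderiv ℝ (moll φ u) (x + t • h)) (x + t • h) :=
        ((contDiff_moll hu φ 1).differentiable (by simp) _).hasFDerivAt
      have e5 := e4.comp_hasDerivAt t e3
      have e6 := e2.mul e5
      rw [fderiv_moll_eq_cdot_magGrad hAc hu φ] at e6
      refine e6.congr_deriv ?_
      simp only [Function.comp_apply]
      push_cast
      ring
    have hint := intervalIntegral.integral_eq_sub_of_hasDerivAt (a := 0) (b := 1)
      (fun t _ => hder t) (Continuous.intervalIntegrable (by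
        have := continuous_cdot (N := N)
        have h2 : Continuous fun t : ℝ => cdot (magGrad φ A u (x + t • h)) h :=
          this.comp (Continuous.prodMk (hcg.comp (by fun_prop)) continuous_const)
        fun_prop) _ _)
    rw [intervalIntegral.integral_of_le zero_le_one] at hint
    rw [hint]
    simp [magShift, hα]

end Shift

theorem eLpNorm_const_mul_ennreal {X : Type*} [MeasurableSpace X] {μ : Measure X} {p : ℝ}
    (hp : 1 ≤ p) {c : ℝ≥0∞} (hc : c ≠ ⊤) (f : X → ℝ≥0∞) :
    eLpNorm (fun x => c * f x) (ENNReal.ofReal p) μ = c * eLpNorm f (ENNReal.ofReal p) μ := by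
  have hp0 : 0 < p := by linarith
  have h1 : eLpNorm (fun x => c * f x) (ENNReal.ofReal p) μ ^ p
      = (c * eLpNorm f (ENNReal.ofReal p) μ) ^ p := by
    rw [ENNReal.mul_rpow_of_nonneg _ _ hp0.le, eLpNorm_ofReal_rpow hp, eLpNorm_ofReal_rpow hp,
      ← lintegral_const_mul' _ _ (ENNReal.rpow_ne_top_of_nonneg hp0.le hc)]
    simp only [enorm_eq_self, ENNReal.mul_rpow_of_nonneg _ _ hp0.le]
  exact (ENNReal.rpow_left_injective hp0.ne') h1

theorem eLpNorm_enorm' {X V : Type*} [MeasurableSpace X] {μ : Measure X} [NormedAddCommGroup V]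
    (f : X → V) (q : ℝ≥0∞) : eLpNorm (fun x => ‖f x‖ₑ) q μ = eLpNorm f q μ :=
  le_antisymm (eLpNorm_mono_enorm fun x => by simp) (eLpNorm_mono_enorm fun x => by simp)

/-- Lets averages over the segment parameter `t` enter `eLpNorm_le_of_enorm_le_lintegral`. -/
instance isProbabilityMeasure_restrict_Ioc :
    IsProbabilityMeasure ((volume : Measure ℝ).restrict (Ioc 0 1)) := ⟨by simp⟩

/-! ### First-order error of the shift of a mollified function. -/

section Core

variable {N : ℕ} {A : RN N → RN N} {u : RN N → ℂ} {p : ℝ}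

theorem norm_exp_mul_I_sub_one_le (s : ℝ) :
    ‖Complex.exp ((s : ℂ) * Complex.I) - 1‖ ≤ min 2 |s| := by
  refine le_min ?_ ?_
  · calc ‖Complex.exp ((s : ℂ) * Complex.I) - 1‖ ≤ ‖Complex.exp ((s : ℂ) * Complex.I)‖ + ‖(1 : ℂ)‖ :=
        norm_sub_le _ _
      _ = 2 := by rw [Complex.norm_exp_ofReal_mul_I]; norm_num
  · have := Real.norm_exp_I_mul_ofReal_sub_one_le (x := s)
    rwa [mul_comm, Real.norm_eq_abs] at this

theorem enorm_exp_mul_I (s : ℝ) : ‖Complex.exp ((s : ℂ) * Complex.I)‖ₑ = 1 := by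
  rw [← ofReal_norm, Complex.norm_exp_ofReal_mul_I, ENNReal.ofReal_one]

/-- The size `min(2, |h · A(x + h/2)|)` of the magnetic phase. -/
def phaseSize (A : RN N → RN N) (h x : RN N) : ℝ≥0∞ := ENNReal.ofReal (min 2 |magPhase A h x|)

theorem phaseSize_le_two (A : RN N → RN N) (h x : RN N) : phaseSize A h x ≤ 2 := by
  refine (ENNReal.ofReal_le_ofReal (min_le_left _ _)).trans ?_
  simp

theorem continuous_magPhase (hA : Continuous A) (h : RN N) : Continuous (magPhase A h) := by
  unfold magPhase; fun_prop

theorem measurable_phaseSize (hA : Continuous A) (h : RN N) : Measurable (phaseSize A h) := by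
  have := continuous_magPhase hA h
  unfold phaseSize; fun_prop

theorem enorm_exp_mul_I_sub_one_le (h x : RN N) {t : ℝ} (ht : t ∈ Icc (0 : ℝ) 1) :
    ‖Complex.exp (((-(t * magPhase A h x) : ℝ) : ℂ) * Complex.I) - 1‖ₑ ≤ phaseSize A h x := by
  rw [← ofReal_norm]
  apply ENNReal.ofReal_le_ofReal
  refine (norm_exp_mul_I_sub_one_le _).trans ?_
  rw [abs_neg, abs_mul, abs_of_nonneg ht.1]
  gcongr
  exact mul_le_of_le_one_left (abs_nonneg _) ht.2

/-- The three terms are the oscillation of the gradient on the segment, the commutator `R`, and the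
deviation of the phase factor from `1`. Splitting off `e^{-itα} - 1` only against the gradient at
`x` keeps the last term free of translations. -/
theorem enorm_magShift_moll_sub_sub_le {L : NNReal} (hA : LipschitzWith L A)
    (hu : LocallyIntegrable u volume) (φ : ContDiffBump (0 : RN N)) (h x : RN N) :
    ‖magShift A h (moll φ u) x - moll φ u x - cdot (magGrad φ A u x) h‖ₑ ≤
      (∫⁻ t in Ioc (0 : ℝ) 1, (‖h‖ₑ * ‖magGrad φ A u (x + t • h) - magGrad φ A u x‖ₑ +
        ENNReal.ofReal (‖h‖ * L * (φ.rOut + ‖h‖)) * eMoll φ u (x + t • h))) +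
      ‖h‖ₑ * (phaseSize A h x * ‖magGrad φ A u x‖ₑ) := by
  obtain ⟨R, hRc, hR, heq⟩ := exists_magShift_moll_sub_eq hA hu φ h x
  have hcg := continuous_magGrad hA.continuous hu φ
  have hc2 : Continuous fun t : ℝ => cdot (magGrad φ A u (x + t • h)) h :=
    (continuous_cdot (N := N)).comp (Continuous.prodMk (hcg.comp (by fun_prop)) continuous_const)
  set F : ℝ → ℂ := fun t => Complex.exp (((-(t * magPhase A h x) : ℝ) : ℂ) * Complex.I) *
          (cdot (magGrad φ A u (x + t • h)) h + R t) with hF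
  have hFc : Continuous F := by fun_prop
  have hFi : IntegrableOn F (Ioc 0 1) :=
    (hFc.integrableOn_Icc).mono_set Ioc_subset_Icc_self
  have h1 : magShift A h (moll φ u) x - moll φ u x - cdot (magGrad φ A u x) h
      = ∫ t in Ioc (0 : ℝ) 1, (F t - cdot (magGrad φ A u x) h) := by
    rw [heq, integral_sub hFi (by simp)]
    simp
  rw [h1]
  refine (enorm_integral_le_lintegral_enorm _).trans ?_
  have h3 : ‖h‖ₑ * (phaseSize A h x * ‖magGrad φ A u x‖ₑ)
      = ∫⁻ t in Ioc (0 : ℝ) 1, ‖h‖ₑ * (phaseSize A h x * ‖magGrad φ A u x‖ₑ) := by simp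
  rw [h3, ← lintegral_add_right _ measurable_const]
  apply setLIntegral_mono' measurableSet_Ioc
  intro t ht
  have ht' := Ioc_subset_Icc_self ht
  have h4 : F t - cdot (magGrad φ A u x) h
      = Complex.exp (((-(t * magPhase A h x) : ℝ) : ℂ) * Complex.I) *
          (cdot (magGrad φ A u (x + t • h) - magGrad φ A u x) h + R t)
        + (Complex.exp (((-(t * magPhase A h x) : ℝ) : ℂ) * Complex.I) - 1) *
          cdot (magGrad φ A u x) h := by
    rw [cdot_sub_left]; simp only [hF]; ring
  rw [h4]
  refine (enorm_add_le _ _).trans ?_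
  rw [enorm_mul, enorm_mul, enorm_exp_mul_I, one_mul]
  refine add_le_add ((enorm_add_le _ _).trans (add_le_add (enorm_cdot_le _ _) (hR t ht'))) ?_
  calc _ ≤ phaseSize A h x * (‖h‖ₑ * ‖magGrad φ A u x‖ₑ) := by
        gcongr
        · exact enorm_exp_mul_I_sub_one_le h x ht'
        · exact enorm_cdot_le _ _
    _ = _ := by ring

theorem eLpNorm_magShift_moll_sub_sub_le (hp : 1 ≤ p) {L : NNReal} (hA : LipschitzWith L A)
    (hum : StronglyMeasurable u) (hu : LocallyIntegrable u volume)
    (φ : ContDiffBump (0 : RN N)) (h : RN N) {M : ℝ≥0∞}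
    (hM : ∀ t ∈ Ioc (0 : ℝ) 1, eLpNorm (fun x => magGrad φ A u (x + t • h) - magGrad φ A u x)
      (ENNReal.ofReal p) volume ≤ M) :
    eLpNorm (fun x => magShift A h (moll φ u) x - moll φ u x - cdot (magGrad φ A u x) h)
      (ENNReal.ofReal p) volume ≤
    ‖h‖ₑ * M + ENNReal.ofReal (‖h‖ * L * (φ.rOut + ‖h‖)) * eLpNorm u (ENNReal.ofReal p) volume +
      ‖h‖ₑ * eLpNorm (fun x => phaseSize A h x * ‖magGrad φ A u x‖ₑ) (ENNReal.ofReal p) volume := by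
  have hp' : (1 : ℝ≥0∞) ≤ ENNReal.ofReal p := by simpa using hp
  have hcg := continuous_magGrad hA.continuous hu φ
  have hme := measurable_eMoll hum φ
  have hps := measurable_phaseSize hA.continuous h
  set c := ENNReal.ofReal (‖h‖ * L * (φ.rOut + ‖h‖)) with hc
  set H : RN N → ℝ → ℝ≥0∞ := fun x t =>
    ‖h‖ₑ * ‖magGrad φ A u (x + t • h) - magGrad φ A u x‖ₑ + c * eMoll φ u (x + t • h) with hH
  have hHm : Measurable (Function.uncurry H) := by
    simp only [hH, Function.uncurry_def]
    have h1 : Measurable fun q : RN N × ℝ => q.1 + q.2 • h := by fun_prop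
    have h2 := hme.comp h1
    have h3 : Continuous fun q : RN N × ℝ => magGrad φ A u (q.1 + q.2 • h) - magGrad φ A u q.1 :=
      (hcg.comp (by fun_prop)).sub (hcg.comp (by fun_prop))
    exact (h3.measurable.enorm.const_mul _).add (h2.const_mul _)
  calc _ ≤ eLpNorm ((fun x => ∫⁻ t in Ioc (0 : ℝ) 1, H x t) + fun x =>
        ‖h‖ₑ * (phaseSize A h x * ‖magGrad φ A u x‖ₑ)) (ENNReal.ofReal p) volume :=
        eLpNorm_mono_enorm fun x => by
          simpa using enorm_magShift_moll_sub_sub_le hA hu φ h x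
    _ ≤ _ := eLpNorm_add_le hHm.lintegral_prod_right'.aestronglyMeasurable
        (by
          have := hcg.measurable.enorm
          have : Measurable fun x => ‖h‖ₑ * (phaseSize A h x * ‖magGrad φ A u x‖ₑ) := by fun_prop
          exact this.aestronglyMeasurable) hp'
    _ ≤ _ := by
        refine add_le_add ?_ (eLpNorm_const_mul_ennreal hp (by simp) _).le
        refine eLpNorm_le_of_enorm_le_lintegral (κ := volume.restrict (Ioc (0 : ℝ) 1)) hp
          hHm.aemeasurable
          (Eventually.of_forall fun x => by simp [hH]) ?_
        filter_upwards [ae_restrict_mem measurableSet_Ioc] with t ht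
        have ha : Measurable fun x => ‖magGrad φ A u (x + t • h) - magGrad φ A u x‖ₑ :=
          ((hcg.comp (by fun_prop)).sub hcg).measurable.enorm
        have hb : Measurable fun x => eMoll φ u (x + t • h) := hme.comp (by fun_prop)
        calc _ ≤ _ := eLpNorm_add_le (ha.const_mul ‖h‖ₑ).aestronglyMeasurable
              (hb.const_mul c).aestronglyMeasurable hp'
          _ ≤ _ := by
              rw [eLpNorm_const_mul_ennreal hp (by simp), eLpNorm_const_mul_ennreal hp (by simp [hc])]
              gcongr
              · rw [eLpNorm_enorm']
                exact hM t ht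
              · rw [show (fun x => eMoll φ u (x + t • h)) = eMoll φ u ∘ (fun x => x + t • h) from rfl,
                  eLpNorm_comp_measurePreserving hme.aestronglyMeasurable
                    (measurePreserving_add_right volume _)]
                exact eLpNorm_eMoll_le hp hum.aestronglyMeasurable φ

/-- The phase need not be uniformly small, since `A` may be unbounded. It tends to zero pointwise
and is at most `2`, so dominated convergence applies; this is why `phaseSize` is cut off at `2`. -/
theorem exists_phaseSize_mul_small (hp : 1 ≤ p) (hA : Continuous A) {G : RN N → CN N}
    (hG : MemLp G (ENNReal.ofReal p) volume) {e : ℝ≥0∞} (he : 0 < e) :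
    ∃ δ > 0, ∀ h : RN N, ‖h‖ < δ →
      eLpNorm (fun x => phaseSize A h x * ‖G x‖ₑ) (ENNReal.ofReal p) volume ≤ e := by
  have hp0 : 0 < p := by linarith
  have hlim : Tendsto (fun h : RN N => ∫⁻ x, (phaseSize A h x * ‖G x‖ₑ) ^ p) (𝓝 0)
      (𝓝 (∫⁻ x : RN N, (0 : ℝ≥0∞))) := by
    refine tendsto_lintegral_filter_of_dominated_convergence' (fun x => (2 * ‖G x‖ₑ) ^ p) ?_ ?_ ?_ ?_
    · refine Eventually.of_forall fun h => ?_
      have := (measurable_phaseSize hA h).aemeasurable (μ := volume)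
      have := hG.1.enorm
      fun_prop
    · refine Eventually.of_forall fun h => Eventually.of_forall fun x => ?_
      gcongr
      exact phaseSize_le_two A h x
    · simp_rw [ENNReal.mul_rpow_of_nonneg _ _ hp0.le]
      rw [lintegral_const_mul' _ _ (by simp), ← eLpNorm_ofReal_rpow hp]
      exact ENNReal.mul_ne_top (by simp) (ENNReal.rpow_ne_top_of_nonneg hp0.le hG.2.ne)
    · have hfin : ∀ᵐ x : RN N, ‖G x‖ₑ ≠ ⊤ := Eventually.of_forall fun x => by simp
      filter_upwards [hfin] with x hx
      have h1 : Tendsto (fun h : RN N => phaseSize A h x) (𝓝 0) (𝓝 0) := by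
        have hc : Continuous fun h : RN N => phaseSize A h x := by
          unfold phaseSize magPhase
          exact ENNReal.continuous_ofReal.comp (by fun_prop)
        have := hc.tendsto 0
        simpa [phaseSize, magPhase] using this
      have h2 := (ENNReal.Tendsto.mul_const h1 (Or.inr hx)).ennrpow_const p
      simpa [ENNReal.zero_rpow_of_pos hp0] using h2
  rw [lintegral_zero] at hlim
  have hev := hlim.eventually (gt_mem_nhds (ENNReal.rpow_pos_of_nonneg he hp0.le))
  obtain ⟨δ, hδ, hsub⟩ := Metric.mem_nhds_iff.1 hev
  refine ⟨δ, hδ, fun h hh => ?_⟩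
  have h1 : ∫⁻ x, (phaseSize A h x * ‖G x‖ₑ) ^ p < e ^ p := hsub (by simpa using hh)
  rw [← ENNReal.rpow_le_rpow_iff hp0, eLpNorm_ofReal_rpow hp]
  simpa using h1.le

theorem eLpNorm_magShift (hv : AEStronglyMeasurable u volume) (q : ℝ≥0∞)
    (h : RN N) : eLpNorm (magShift A h u) q volume = eLpNorm u q volume := by
  rw [← eLpNorm_comp_add_right hv q h]
  refine le_antisymm (eLpNorm_mono_enorm fun x => ?_) (eLpNorm_mono_enorm fun x => ?_) <;>
  simp only [magShift, enorm_mul, enorm_exp_mul_I, one_mul, le_refl]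

end Core

/-! ### First-order expansion of the magnetic shift in `L^p`. -/

section Sobolev

variable {N : ℕ} {A : RN N → RN N} {u : RN N → ℂ} {p : ℝ}

theorem exists_bump_rOut_lt {ε : ℝ} (hε : 0 < ε) : ∃ φ : ContDiffBump (0 : RN N), φ.rOut < ε :=
  ⟨⟨ε / 4, ε / 2, by positivity, by linarith⟩, by simp; linarith⟩

theorem moll_comp_add_right {V : Type*} [NormedAddCommGroup V] [NormedSpace ℝ V]
    (φ : ContDiffBump (0 : RN N)) (f : RN N → V) (k x : RN N) :
    moll φ (fun y => f (y + k)) x = moll φ f (x + k) := by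
  simp only [moll_apply]
  congr 1 with z
  rw [sub_add_eq_add_sub]

theorem moll_sub {V : Type*} [NormedAddCommGroup V] [NormedSpace ℝ V]
    (φ : ContDiffBump (0 : RN N)) {f g : RN N → V} (hf : LocallyIntegrable f volume)
    (hg : LocallyIntegrable g volume) (x : RN N) :
    moll φ (fun y => f y - g y) x = moll φ f x - moll φ g x := by
  simp only [moll_apply, smul_sub]
  exact integral_sub (integrable_normed_smul hf φ x) (integrable_normed_smul hg φ x)

theorem MemLp.comp_add_right {V : Type*} [NormedAddCommGroup V] {f : RN N → V} {q : ℝ≥0∞}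
    (hf : MemLp f q volume) (k : RN N) : MemLp (fun x => f (x + k)) q volume :=
  hf.comp_measurePreserving (measurePreserving_add_right volume k)

/-- `G` enters only through its mollifications `hGu`. Mollify, use the expansion for smooth
functions, and return to `u`: the error made by mollifying `u` is not multiplied by `h`, so the bump
has to depend on `h`, while `δ` depends only on `u`, `G` and `A`. -/
theorem exists_magShift_sub_sub_small (hp : 1 ≤ p) {L : NNReal} (hA : LipschitzWith L A)
    (hum : StronglyMeasurable u) (hu : MemLp u (ENNReal.ofReal p) volume) {G : RN N → CN N}
    (hG : MemLp G (ENNReal.ofReal p) volume) (hGu : ∀ φ y, magGrad φ A u y = moll φ G y)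
    {e : ℝ≥0∞} (he : 0 < e) :
    ∃ δ > 0, ∀ h : RN N, ‖h‖ < δ →
      eLpNorm (fun x => magShift A h u x - u x - cdot (G x) h) (ENNReal.ofReal p) volume
        ≤ 8 * e * ‖h‖ₑ := by
  have hp' : (1 : ℝ≥0∞) ≤ ENNReal.ofReal p := by simpa using hp
  set q := ENNReal.ofReal p with hq
  have hul := hu.locallyIntegrable hp'
  have hGl := hG.locallyIntegrable hp'
  obtain ⟨δ₁, hδ₁, h1⟩ := exists_translation_close hp hG he
  obtain ⟨δ₂, hδ₂, h2⟩ := exists_phaseSize_mul_small hp hA.continuous hG he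
  obtain ⟨δ₃, hδ₃, h3⟩ : ∃ δ > 0, ENNReal.ofReal (L * (2 * δ)) * eLpNorm u q volume ≤ e := by
    have hc : Continuous fun δ : ℝ => ENNReal.ofReal (L * (2 * δ)) :=
      ENNReal.continuous_ofReal.comp (by fun_prop)
    have h0 : Tendsto (fun δ : ℝ => ENNReal.ofReal (L * (2 * δ)) * eLpNorm u q volume) (𝓝 0)
        (𝓝 0) := by
      have := ENNReal.Tendsto.mul_const (hc.tendsto 0) (Or.inr hu.2.ne)
      simpa using this
    have h4 : ∀ᶠ δ in 𝓝[>] (0 : ℝ), ENNReal.ofReal (L * (2 * δ)) * eLpNorm u q volume ≤ e :=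
      (h0.eventually (ge_mem_nhds he)).filter_mono nhdsWithin_le_nhds
    obtain ⟨δ, hδ, hd⟩ := (h4.and self_mem_nhdsWithin).exists
    exact ⟨δ, hd, hδ⟩
  refine ⟨min δ₁ (min δ₂ δ₃), by positivity, fun h hh => ?_⟩
  -- The bump below must have radius less than `‖h‖`, which excludes `h = 0`.
  rcases eq_or_ne h 0 with rfl | hne
  · have : (fun x => magShift A 0 u x - u x - cdot (G x) 0) = fun _ => 0 := by
      ext x
      simp [magShift, magPhase, cdot]
    rw [this]; simp
  have hh1 : ‖h‖ < δ₁ := hh.trans_le (min_le_left _ _)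
  have hh2 : ‖h‖ < δ₂ := hh.trans_le ((min_le_right _ _).trans (min_le_left _ _))
  have hh3 : ‖h‖ < δ₃ := hh.trans_le ((min_le_right _ _).trans (min_le_right _ _))
  have hpos : 0 < ‖h‖ := norm_pos_iff.2 hne
  have hepos : 0 < e * ‖h‖ₑ := ENNReal.mul_pos he.ne' (by simpa using hne)
  -- Chosen after `h`: a bump narrower than `δ₄` changes `u` by at most `e‖h‖` in `L^p`.
  obtain ⟨δ₄, hδ₄, h4⟩ := exists_translation_close hp hu hepos
  obtain ⟨φ, hφ⟩ := exists_bump_rOut_lt (N := N) (ε := min ‖h‖ (min δ₁ δ₄)) (by positivity)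
  have hφ1 : φ.rOut < ‖h‖ := hφ.trans_le (min_le_left _ _)
  have hφ2 : φ.rOut < δ₁ := hφ.trans_le ((min_le_right _ _).trans (min_le_left _ _))
  have hφ3 : φ.rOut < δ₄ := hφ.trans_le ((min_le_right _ _).trans (min_le_right _ _))
  have hmg : magGrad φ A u = moll φ G := funext (hGu φ)
  have hcu := continuous_moll hul φ
  have hcG := continuous_moll hGl φ
  have hdu : eLpNorm (fun x => moll φ u x - u x) q volume ≤ e * ‖h‖ₑ :=
    eLpNorm_moll_sub_le hp hul φ fun k hk => h4 k (hk.trans hφ3)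
  have hdG : eLpNorm (fun x => moll φ G x - G x) q volume ≤ e :=
    eLpNorm_moll_sub_le hp hGl φ fun k hk => h1 k (hk.trans hφ2)
  have hM : ∀ t ∈ Ioc (0 : ℝ) 1,
      eLpNorm (fun x => magGrad φ A u (x + t • h) - magGrad φ A u x) q volume ≤ e := by
    intro t ht
    have hGt := MemLp.comp_add_right hG (t • h)
    have : (fun x => magGrad φ A u (x + t • h) - magGrad φ A u x)
        = moll φ (fun y => G (y + t • h) - G y) := by
      ext1 x
      rw [moll_sub φ (hGt.locallyIntegrable hp') hGl, moll_comp_add_right, hmg]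
    rw [this]
    refine (eLpNorm_moll_le hp (hGt.1.sub hG.1) φ).trans (h1 _ ?_)
    rw [norm_smul, Real.norm_of_nonneg ht.1.le]
    exact (mul_le_of_le_one_left hpos.le ht.2).trans_lt hh1
  have hcore := eLpNorm_magShift_moll_sub_sub_le hp hA hum hul φ h hM
  have hphase : eLpNorm (fun x => phaseSize A h x * ‖magGrad φ A u x‖ₑ) q volume ≤ 3 * e := by
    have hpm := measurable_phaseSize hA.continuous h
    have hGe := hG.1.enorm
    have hde := (hcG.aestronglyMeasurable (μ := volume).sub hG.1).enorm
    calc _ ≤ eLpNorm ((fun x => phaseSize A h x * ‖G x‖ₑ) +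
          fun x => 2 * ‖(moll φ G - G) x‖ₑ) q volume := by
          refine eLpNorm_mono_enorm fun x => ?_
          simp only [enorm_eq_self, Pi.add_apply]
          rw [hmg]
          calc phaseSize A h x * ‖moll φ G x‖ₑ
              = phaseSize A h x * ‖G x + (moll φ G - G) x‖ₑ := by simp
            _ ≤ phaseSize A h x * (‖G x‖ₑ + ‖(moll φ G - G) x‖ₑ) := by
                gcongr; exact enorm_add_le _ _
            _ ≤ _ := by
                rw [mul_add]; gcongr; exact phaseSize_le_two A h x
      _ ≤ _ := eLpNorm_add_le (hpm.aemeasurable.mul hGe).aestronglyMeasurable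
          (hde.const_mul 2).aestronglyMeasurable hp'
      _ ≤ e + 2 * e := by
          refine add_le_add (h2 h hh2) ?_
          rw [eLpNorm_const_mul_ennreal hp (by simp), eLpNorm_enorm']
          gcongr
          exact hdG
      _ = 3 * e := by ring
  have hc : ENNReal.ofReal (‖h‖ * L * (φ.rOut + ‖h‖)) * eLpNorm u q volume ≤ ‖h‖ₑ * e := by
    calc _ ≤ ENNReal.ofReal (‖h‖ * (L * (2 * δ₃))) * eLpNorm u q volume := by
          rw [mul_assoc]
          gcongr
          linarith
      _ = ‖h‖ₑ * (ENNReal.ofReal (L * (2 * δ₃)) * eLpNorm u q volume) := by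
          rw [ENNReal.ofReal_mul (norm_nonneg _), ofReal_norm, mul_assoc]
      _ ≤ _ := by gcongr
  have hms : ∀ {v : RN N → ℂ}, AEStronglyMeasurable v volume →
      AEStronglyMeasurable (magShift A h v) volume := by
    intro v hv
    have hcp := continuous_magPhase hA.continuous h
    unfold magShift
    refine Continuous.aestronglyMeasurable (by fun_prop) |>.mul ?_
    exact hv.comp_measurePreserving (measurePreserving_add_right volume h)
  have hcd : Continuous fun v : CN N => cdot v h :=
    (cdotCLM h).continuous.congr (cdotCLM_apply h)
  have hsplit : (fun x => magShift A h u x - u x - cdot (G x) h) =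
      ((fun x => magShift A h (moll φ u) x - moll φ u x - cdot (magGrad φ A u x) h) +
      (fun x => moll φ u x - u x) + (fun x => cdot (moll φ G x - G x) h)) -
      magShift A h (fun x => moll φ u x - u x) := by
    ext1 x
    simp only [Pi.sub_apply, Pi.add_apply, magShift, hmg, cdot_sub_left]
    ring
  have m1 : AEStronglyMeasurable (fun x => moll φ u x - u x) volume :=
    hcu.aestronglyMeasurable.sub hum.aestronglyMeasurable
  have m2 : AEStronglyMeasurable (fun x => cdot (moll φ G x - G x) h) volume :=
    hcd.comp_aestronglyMeasurable (hcG.aestronglyMeasurable.sub hG.1)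
  have m3 : AEStronglyMeasurable
      (fun x => magShift A h (moll φ u) x - moll φ u x - cdot (magGrad φ A u x) h) volume := by
    rw [hmg]
    exact ((hms hcu.aestronglyMeasurable).sub hcu.aestronglyMeasurable).sub
      (hcd.comp hcG).aestronglyMeasurable
  have hcdG : eLpNorm (fun x => cdot (moll φ G x - G x) h) q volume ≤ ‖h‖ₑ * e := by
    calc _ ≤ eLpNorm (fun x => ‖h‖ₑ * ‖moll φ G x - G x‖ₑ) q volume :=
          eLpNorm_mono_enorm fun x => by simpa using enorm_cdot_le _ _
      _ = ‖h‖ₑ * eLpNorm (fun x => moll φ G x - G x) q volume := by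
          rw [eLpNorm_const_mul_ennreal hp (by simp), eLpNorm_enorm']
      _ ≤ _ := by gcongr
  rw [hsplit]
  calc _ ≤ _ := eLpNorm_sub_le ((m3.add m1).add m2) (hms m1) hp'
    _ ≤ _ := add_le_add ((eLpNorm_add_le (m3.add m1) m2 hp').trans
        (add_le_add (eLpNorm_add_le m3 m1 hp') le_rfl)) le_rfl
    -- Of the eight units of `e‖h‖`, five come from the mollified expansion, one from replacing the
    -- gradient, and two from replacing `u` at `x` and under the shift.
    _ ≤ ((‖h‖ₑ * e + ‖h‖ₑ * e + ‖h‖ₑ * (3 * e)) + e * ‖h‖ₑ + ‖h‖ₑ * e) + e * ‖h‖ₑ := by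
        rw [eLpNorm_magShift m1]
        gcongr
        exact hcore.trans (by gcongr)
    _ = _ := by ring

end Sobolev

/-! ### The weak gradient determines the mollified magnetic gradient. -/

section WeakGradient

variable {N : ℕ} {A : RN N → RN N} {u : RN N → ℂ} {g : RN N → CN N}

/-- The magnetic gradient `g - i A u`. -/
def magField (A : RN N → RN N) (u : RN N → ℂ) (g : RN N → CN N) (x : RN N) : CN N :=
  g x - (Complex.I * u x) • toCN (A x)

theorem IsWeakGradient.locallyIntegrable_magField (hA : Continuous A) (hw : IsWeakGradient u g) :
    LocallyIntegrable (magField A u g) volume := by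
  refine hw.2.1.sub ?_
  have h1 : LocallyIntegrable (fun x => Complex.I * u x) volume :=
    hw.1.continuous_mul continuous_const
  exact h1.smul_continuous (continuous_toCN.comp hA)

theorem locallyIntegrable_coord {f : RN N → CN N} (hf : LocallyIntegrable f volume) (j : Fin N) :
    LocallyIntegrable (fun z => f z j) volume :=
  hf.mono ((EuclideanSpace.proj j : CN N →L[ℂ] ℂ).continuous.comp_aestronglyMeasurable
    hf.aestronglyMeasurable) (Eventually.of_forall fun z => PiLp.norm_apply_le (f z) j)

theorem moll_apply_coord {f : RN N → CN N} (hf : LocallyIntegrable f volume)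
    (φ : ContDiffBump (0 : RN N)) (y : RN N) (j : Fin N) :
    moll φ f y j = moll φ (fun z => f z j) y := by
  have h := ((EuclideanSpace.proj j : CN N →L[ℂ] ℂ).restrictScalars ℝ).integral_comp_comm
    (integrable_normed_smul hf φ y)
  simp only [moll_apply]
  simpa using h.symm

/-- Test the weak gradient against `z ↦ φ(y - z)`: the sign from the chain rule cancels the sign of
the integration by parts. -/
theorem IsWeakGradient.magGrad_eq_moll (hA : Continuous A) (hw : IsWeakGradient u g)
    (φ : ContDiffBump (0 : RN N)) (y : RN N) :
    magGrad φ A u y = moll φ (magField A u g) y := by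
  have hloc := hw.locallyIntegrable_magField hA
  ext j
  rw [moll_apply_coord hloc]
  have hAj : LocallyIntegrable (fun z => (A z j : ℂ) * u z) volume :=
    locallyIntegrable_ofReal_mul (by fun_prop) hw.1
  have hgj := locallyIntegrable_coord hw.2.1 j
  have hψ : ContDiff ℝ ((⊤ : ℕ∞) : WithTop ℕ∞) (fun z => φ.normed volume (y - z)) :=
    φ.contDiff_normed.comp (contDiff_const.sub contDiff_id)
  have hψc : HasCompactSupport (fun z => φ.normed volume (y - z)) :=
    φ.hasCompactSupport_normed.comp_homeomorph (Homeomorph.subLeft y)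
  have hψd : ∀ z, fderiv ℝ (fun z => φ.normed volume (y - z)) z (EuclideanSpace.single j (1 : ℝ))
      = - fderiv ℝ (φ.normed volume) (y - z) (EuclideanSpace.single j (1 : ℝ)) := by
    intro z
    have h1 : HasFDerivAt (φ.normed volume) (fderiv ℝ (φ.normed volume) (y - z)) (y - z) :=
      ((φ.contDiff_normed (n := 1)).differentiable (by simp) _).hasFDerivAt
    have h2 : HasFDerivAt (fun z => y - z) (-(ContinuousLinearMap.id ℝ (RN N))) z :=
      (hasFDerivAt_id z).const_sub y
    have h3 : HasFDerivAt (fun z => φ.normed volume (y - z)) _ z := h1.comp z h2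
    rw [h3.fderiv]
    simp
  have h1 := hw.2.2 _ hψ hψc j
  simp only [hψd] at h1
  have h2 : fderiv ℝ (moll φ u) y (EuclideanSpace.single j (1 : ℝ)) = moll φ (fun z => g z j) y := by
    rw [fderiv_moll hw.1, moll_apply_swap]
    simp only [Complex.real_smul]
    have h3 : ∫ z, ((-fderiv ℝ (φ.normed volume) (y - z) (EuclideanSpace.single j (1 : ℝ)) : ℝ) : ℂ)
        * u z = - ∫ z, (fderiv ℝ (φ.normed volume) (y - z) (EuclideanSpace.single j (1 : ℝ)) : ℂ)
        * u z := by
      rw [← integral_neg]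
      congr 1 with z
      push_cast; ring
    rw [h3] at h1
    exact neg_injective h1
  have h3 : (fun z => magField A u g z j)
      = fun z => g z j - (fun z => Complex.I * ((A z j : ℂ) * u z)) z := by
    ext z
    simp [magField, toCN]
    ring
  have h4 : moll φ (fun z => Complex.I * ((A z j : ℂ) * u z)) y
      = Complex.I * moll φ (fun z => (A z j : ℂ) * u z) y := by
    simp only [moll_apply]
    rw [← integral_const_mul]
    congr 1 with z
    simp only [Complex.real_smul]; ring
  rw [h3, moll_sub φ hgj (hAj.continuous_mul continuous_const), h4, ← h2]
  simp [magGrad]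

theorem IsWeakGradient.ae_eq {g' : RN N → CN N} (hw : IsWeakGradient u g)
    (hw' : IsWeakGradient u g') : g =ᵐ[volume] g' := by
  have hj : ∀ j, (fun x => g x j) =ᵐ[volume] fun x => g' x j := by
    intro j
    refine ae_eq_of_integral_contDiff_smul_eq (locallyIntegrable_coord hw.2.1 j)
      (locallyIntegrable_coord hw'.2.1 j) ?_
    intro ψ hψ hψc
    have h1 := hw.2.2 ψ hψ hψc j
    rw [hw'.2.2 ψ hψ hψc j] at h1
    simpa [Complex.real_smul] using (neg_injective h1).symm
  filter_upwards [ae_all_iff.2 hj] with x hx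
  ext j
  exact hx j

theorem IsWeakGradient.congr {u' : RN N → ℂ} {g' : RN N → CN N} (hw : IsWeakGradient u g)
    (hu : u =ᵐ[volume] u') (hg : g =ᵐ[volume] g') : IsWeakGradient u' g' := by
  refine ⟨hw.1.congr hu, hw.2.1.congr hg, fun ψ hψ hψc j => ?_⟩
  have h1 := hw.2.2 ψ hψ hψc j
  calc _ = _ := integral_congr_ae (by filter_upwards [hu] with x hx; rw [hx])
    _ = _ := h1
    _ = _ := by
      congr 1
      exact integral_congr_ae (by filter_upwards [hg] with x hx; rw [hx])

end WeakGradient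

/-! ### From closeness in `L^p` to closeness of `p`-energies. -/

section Pow

/-- `|Re z|^p + |Im z|^p` as an extended nonnegative real. -/
def ePow (p : ℝ) (z : ℂ) : ℝ≥0∞ := ‖z.re‖ₑ ^ p + ‖z.im‖ₑ ^ p

variable {p : ℝ}

theorem ofReal_absP_rpow (hp : 1 ≤ p) (z : ℂ) : ENNReal.ofReal (absP p z ^ p) = ePow p z := by
  have hp0 : 0 < p := by linarith
  rw [absP, ← Real.rpow_mul (by positivity), one_div_mul_cancel hp0.ne', Real.rpow_one,
    ENNReal.ofReal_add (by positivity) (by positivity), ePow]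
  simp only [← ofReal_norm, Real.norm_eq_abs, ENNReal.ofReal_rpow_of_nonneg (abs_nonneg _) hp0.le]

theorem measurable_ePow (p : ℝ) : Measurable (ePow p) := by
  unfold ePow; fun_prop

theorem ePow_real_mul (hp : 0 ≤ p) (t : ℝ) (z : ℂ) :
    ePow p (t * z) = ‖t‖ₑ ^ p * ePow p z := by
  simp [ePow, ENNReal.mul_rpow_of_nonneg _ _ hp, mul_add]

theorem enorm_re_le (z : ℂ) : ‖z.re‖ₑ ≤ ‖z‖ₑ := by
  rw [← ofReal_norm, ← ofReal_norm]
  exact ENNReal.ofReal_le_ofReal (Complex.abs_re_le_norm z)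

theorem enorm_im_le (z : ℂ) : ‖z.im‖ₑ ≤ ‖z‖ₑ := by
  rw [← ofReal_norm, ← ofReal_norm]
  exact ENNReal.ofReal_le_ofReal (Complex.abs_im_le_norm z)

theorem ePow_le (hp : 0 ≤ p) (z : ℂ) : ePow p z ≤ 2 * ‖z‖ₑ ^ p := by
  rw [ePow, two_mul]
  gcongr
  · exact enorm_re_le z
  · exact enorm_im_le z

theorem lintegral_ePow {X : Type*} [MeasurableSpace X] {μ : Measure X} (hp : 1 ≤ p) {f : X → ℂ}
    (hf : AEStronglyMeasurable f μ) :
    ∫⁻ x, ePow p (f x) ∂μ = eLpNorm (fun x => (f x).re) (ENNReal.ofReal p) μ ^ p +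
      eLpNorm (fun x => (f x).im) (ENNReal.ofReal p) μ ^ p := by
  have hre : AEMeasurable (fun x => ‖(f x).re‖ₑ ^ p) μ :=
    (Complex.continuous_re.comp_aestronglyMeasurable hf).enorm.pow_const p
  rw [eLpNorm_ofReal_rpow hp, eLpNorm_ofReal_rpow hp, ← lintegral_add_left' hre]
  rfl

/-- Uniform continuity of `t ↦ t^p` on a compact interval settles the scale `s = 1`; homogeneity
carries it to every finite scale `s` with the same `e`. -/
theorem exists_rpow_le_add (p : ℝ) (hp : 1 ≤ p) {B a : ℝ≥0∞} (hB : B ≠ ⊤) (ha : 0 < a) :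
    ∃ e > 0, e ≠ ⊤ ∧ ∀ s x y : ℝ≥0∞, s ≠ ⊤ → y ≤ B * s → x ≤ y + e * s →
      x ^ p ≤ y ^ p + a * s ^ p := by
  have hp0 : 0 < p := by linarith
  have hcomp : IsCompact (Icc (0 : ℝ) (B.toReal + 1)) := isCompact_Icc
  have huc := hcomp.uniformContinuousOn_of_continuous
    (f := fun t : ℝ => t ^ p) (Continuous.continuousOn (Real.continuous_rpow_const hp0.le))
  rw [Metric.uniformContinuousOn_iff] at huc
  -- Truncated because `a` may be infinite, whereas uniform continuity needs a real tolerance.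
  set a' : ℝ≥0∞ := min a 1 with ha'
  have ha'0 : 0 < a' := lt_min ha one_pos
  have ha't : a' ≠ ⊤ := ne_top_of_le_ne_top ENNReal.one_ne_top (min_le_right _ _)
  obtain ⟨δ, hδ, hd⟩ := huc a'.toReal (ENNReal.toReal_pos ha'0.ne' ha't)
  -- The bound `1` keeps `y + e` inside the compact interval `[0, B + 1]`.
  set e : ℝ := min 1 (δ / 2) with he
  have he0 : 0 < e := by positivity
  refine ⟨ENNReal.ofReal e, by simpa using he0, by simp, ?_⟩
  have key : ∀ x y : ℝ≥0∞, y ≤ B → x ≤ y + ENNReal.ofReal e → x ^ p ≤ y ^ p + a := by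
    intro x y hy hx
    have hyt : y ≠ ⊤ := ne_top_of_le_ne_top hB hy
    calc x ^ p ≤ (y + ENNReal.ofReal e) ^ p := by gcongr
      _ = ENNReal.ofReal ((y.toReal + e) ^ p) := by
        rw [← ENNReal.ofReal_rpow_of_nonneg (by positivity) hp0.le,
          ENNReal.ofReal_add (by positivity) he0.le, ENNReal.ofReal_toReal hyt]
      _ ≤ ENNReal.ofReal (y.toReal ^ p + a'.toReal) := by
        apply ENNReal.ofReal_le_ofReal
        have hyB : y.toReal ≤ B.toReal := ENNReal.toReal_mono hB hy
        have he1 : e ≤ 1 := min_le_left _ _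
        have := hd (y.toReal + e) ⟨by positivity, by linarith⟩ y.toReal
          ⟨by positivity, by linarith⟩ (by
            rw [Real.dist_eq, add_sub_cancel_left, abs_of_pos he0]
            have : e ≤ δ / 2 := min_le_right _ _
            linarith)
        rw [Real.dist_eq] at this
        linarith [le_abs_self ((y.toReal + e) ^ p - y.toReal ^ p)]
      _ = y ^ p + a' := by
        rw [ENNReal.ofReal_add (by positivity) (by positivity),
          ← ENNReal.ofReal_rpow_of_nonneg (by positivity) hp0.le, ENNReal.ofReal_toReal hyt,
          ENNReal.ofReal_toReal ha't]
      _ ≤ y ^ p + a := by gcongr; exact min_le_left _ _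
  intro s x y hs hy hx
  rcases eq_or_ne s 0 with rfl | hs0
  · simp only [mul_zero, add_zero] at hx
    exact (ENNReal.rpow_le_rpow hx hp0.le).trans le_self_add
  · have h1 := key (x / s) (y / s) (ENNReal.div_le_of_le_mul hy) (by
      refine ENNReal.div_le_of_le_mul ?_
      rwa [add_mul, ENNReal.div_mul_cancel hs0 hs])
    rw [ENNReal.div_rpow_of_nonneg _ _ hp0.le, ENNReal.div_rpow_of_nonneg _ _ hp0.le] at h1
    have hsp0 : s ^ p ≠ 0 := by simp [hs0, hs]
    have hspt : s ^ p ≠ ⊤ := ENNReal.rpow_ne_top_of_nonneg hp0.le hs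
    have h2 := mul_le_mul_left h1 (s ^ p)
    rwa [add_mul, ENNReal.div_mul_cancel hsp0 hspt, ENNReal.div_mul_cancel hsp0 hspt] at h2

/-- Used at scale `s = ‖h‖`: an `L^p` error `e‖h‖` between functions of size `O(‖h‖)` changes the
energy by at most `a‖h‖^p`. As `|·|_p^p` is a sum of `p`-th powers, real and imaginary parts are
treated separately, with tolerance `a/2` each. -/
theorem exists_lintegral_ePow_close {X : Type*} [MeasurableSpace X] {μ : Measure X} (hp : 1 ≤ p)
    {B a : ℝ≥0∞} (hB : B ≠ ⊤) (ha : 0 < a) :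
    ∃ e > 0, e ≠ ⊤ ∧ ∀ (s : ℝ≥0∞) (f g : X → ℂ), s ≠ ⊤ → AEStronglyMeasurable f μ →
      AEStronglyMeasurable g μ → eLpNorm g (ENNReal.ofReal p) μ ≤ B * s →
      eLpNorm (fun x => f x - g x) (ENNReal.ofReal p) μ ≤ e * s →
      ∫⁻ x, ePow p (f x) ∂μ ≤ (∫⁻ x, ePow p (g x) ∂μ) + a * s ^ p ∧
      ∫⁻ x, ePow p (g x) ∂μ ≤ (∫⁻ x, ePow p (f x) ∂μ) + a * s ^ p := by
  have hp0 : 0 < p := by linarith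
  have hp' : (1 : ℝ≥0∞) ≤ ENNReal.ofReal p := by simpa using hp
  obtain ⟨e, he, het, hkey⟩ := exists_rpow_le_add p hp hB (ENNReal.half_pos ha.ne')
  -- the second comparison needs no bound on `x`: it is trivial when `y ≤ x`
  have hkey' : ∀ s x y : ℝ≥0∞, s ≠ ⊤ → y ≤ B * s → y ≤ x + e * s →
      y ^ p ≤ x ^ p + a / 2 * s ^ p := by
    intro s x y hs hy hx
    rcases le_total y x with h | h
    · exact (ENNReal.rpow_le_rpow h hp0.le).trans le_self_add
    · exact hkey s y x hs (h.trans hy) hx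
  refine ⟨e, he, het, fun s f g hs hf hg hgB hfg => ?_⟩
  rw [lintegral_ePow hp hf, lintegral_ePow hp hg]
  have hs2 : a * s ^ p = a / 2 * s ^ p + a / 2 * s ^ p := by
    rw [← add_mul, ENNReal.add_halves]
  have part : ∀ c : ℂ → ℝ, Continuous c → (∀ z w, c (z - w) = c z - c w) → (∀ z, ‖c z‖ₑ ≤ ‖z‖ₑ) →
      eLpNorm (fun x => c (f x)) (ENNReal.ofReal p) μ ^ p ≤
        eLpNorm (fun x => c (g x)) (ENNReal.ofReal p) μ ^ p + a / 2 * s ^ p ∧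
      eLpNorm (fun x => c (g x)) (ENNReal.ofReal p) μ ^ p ≤
        eLpNorm (fun x => c (f x)) (ENNReal.ofReal p) μ ^ p + a / 2 * s ^ p := by
    intro c hc hcs hcn
    have hcf : AEStronglyMeasurable (fun x => c (f x)) μ := hc.comp_aestronglyMeasurable hf
    have hcg : AEStronglyMeasurable (fun x => c (g x)) μ := hc.comp_aestronglyMeasurable hg
    have h1 : eLpNorm (fun x => c (g x)) (ENNReal.ofReal p) μ ≤ B * s :=
      (eLpNorm_mono_enorm fun x => hcn _).trans hgB
    have h2 : eLpNorm ((fun x => c (f x)) - fun x => c (g x)) (ENNReal.ofReal p) μ ≤ e * s := by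
      refine (eLpNorm_mono_enorm fun x => ?_).trans hfg
      simp only [Pi.sub_apply]
      rw [← hcs]; exact hcn _
    have h3 : eLpNorm (fun x => c (f x)) (ENNReal.ofReal p) μ ≤
        eLpNorm (fun x => c (g x)) (ENNReal.ofReal p) μ + e * s := by
      calc _ = eLpNorm ((fun x => c (g x)) + ((fun x => c (f x)) - fun x => c (g x)))
            (ENNReal.ofReal p) μ := by rw [add_sub_cancel]; 
        _ ≤ _ := eLpNorm_add_le hcg (hcf.sub hcg) hp'
        _ ≤ _ := by gcongr
    have h4 : eLpNorm (fun x => c (g x)) (ENNReal.ofReal p) μ ≤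
        eLpNorm (fun x => c (f x)) (ENNReal.ofReal p) μ + e * s := by
      calc _ = eLpNorm ((fun x => c (f x)) - ((fun x => c (f x)) - fun x => c (g x)))
            (ENNReal.ofReal p) μ := by rw [sub_sub_cancel]
        _ ≤ _ := eLpNorm_sub_le hcf (hcf.sub hcg) hp'
        _ ≤ _ := by gcongr
    exact ⟨hkey s _ _ hs h1 h3, hkey' s _ _ hs h1 h4⟩
  obtain ⟨r1, r2⟩ := part Complex.re Complex.continuous_re (fun z w => by simp) enorm_re_le
  obtain ⟨i1, i2⟩ := part Complex.im Complex.continuous_im (fun z w => by simp) enorm_im_le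
  rw [hs2]
  constructor
  · calc _ ≤ _ := add_le_add r1 i1
      _ = _ := by ring
  · calc _ ≤ _ := add_le_add r2 i2
      _ = _ := by ring

end Pow

/-! ### Shift energy, directional energy and the moment norm. -/

section Energy

variable {N : ℕ} {K : Set (RN N)} {A : RN N → RN N} {u : RN N → ℂ} {p : ℝ}

/-- `∫ |Ψ_u(x, x + h) - u(x)|_p^p dx`. -/
def shiftEnergy (p : ℝ) (A : RN N → RN N) (u : RN N → ℂ) (h : RN N) : ℝ≥0∞ :=
  ∫⁻ x, ePow p (magShift A h u x - u x)

/-- `∫ |G(x) · h|_p^p dx`. -/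
def dirEnergy (p : ℝ) (G : RN N → CN N) (h : RN N) : ℝ≥0∞ := ∫⁻ x, ePow p (cdot (G x) h)

theorem measurable_magShift_prod (hA : Continuous A) (hum : StronglyMeasurable u) :
    Measurable fun q : RN N × RN N => magShift A q.1 u q.2 := by
  unfold magShift magPhase
  have h1 : Measurable fun q : RN N × RN N => u (q.2 + q.1) :=
    hum.measurable.comp (by fun_prop)
  have h2 : Continuous fun q : RN N × RN N =>
    Complex.exp (((-inner ℝ q.1 (A (q.2 + (2 : ℝ)⁻¹ • q.1)) : ℝ) : ℂ) * Complex.I) := by fun_prop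
  exact h2.measurable.mul h1

theorem measurable_magShift (hA : Continuous A) (hum : StronglyMeasurable u) (h : RN N) :
    Measurable (magShift A h u) :=
  (measurable_magShift_prod hA hum).comp
    (g := fun q : RN N × RN N => magShift A q.1 u q.2) (f := fun x => (h, x))
    (measurable_const.prodMk measurable_id)

/-- Substitute `y = x + h` and apply Tonelli; the symmetry of `K` replaces `gauge K (x - y)` by
`gauge K h`. -/
theorem nonlocalEnergy_eq_lintegral (hN : 1 ≤ N) (hp : 1 ≤ p) (hKc : Convex ℝ K)
    (hKs : ∀ x ∈ K, -x ∈ K) (hKb : Bornology.IsBounded K)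
    (hK0 : (0 : RN N) ∈ interior K) {ρ : ℕ → ℝ → ℝ} (hρ : IsMollifierSeq N p ρ)
    (hA : Continuous A) (hum : StronglyMeasurable u) (n : ℕ) :
    nonlocalEnergy p K A (ρ n) u
      = ∫⁻ h, shiftEnergy p A u h * kern p (ρ n) (gauge K h) := by
  have hk := aemeasurable_comp_gauge hN hKc hKb hK0 (aemeasurable_kern hρ n)
  have h1 : ∀ z : RN N × RN N, ENNReal.ofReal
      (absP p (Psi A u z.1 z.2 - Psi A u z.1 z.1) ^ p / gauge K (z.1 - z.2) ^ p
      * ρ n (gauge K (z.1 - z.2))) = ePow p (magShift A (z.2 - z.1) u z.1 - u z.1) *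
        kern p (ρ n) (gauge K (z.2 - z.1)) := by
    intro z
    have hg : gauge K (z.1 - z.2) = gauge K (z.2 - z.1) := by
      rw [← gauge_neg hKs, neg_sub]
    have habs : 0 ≤ absP p (Psi A u z.1 z.2 - Psi A u z.1 z.1) := by
      unfold absP; positivity
    rw [hg, div_mul_eq_mul_div, mul_div_assoc, ENNReal.ofReal_mul (by positivity),
      ofReal_absP_rpow hp, ← Psi_add_eq_magShift, Psi_self, kern, add_sub_cancel]
  have hm1 : Measurable fun q : RN N × RN N => ePow p (magShift A q.1 u q.2 - u q.2) :=
    (measurable_ePow p).comp ((measurable_magShift_prod hA hum).sub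
      (hum.measurable.comp measurable_snd))
  have hm2 : AEMeasurable (fun q : RN N × RN N => ePow p (magShift A (q.2 - q.1) u q.1 - u q.1) *
        kern p (ρ n) (gauge K (q.2 - q.1))) ((volume : Measure (RN N)).prod volume) := by
    refine AEMeasurable.mul ?_ ?_
    · exact (hm1.comp (g := fun q : RN N × RN N => ePow p (magShift A q.1 u q.2 - u q.2))
        (f := fun q : RN N × RN N => (q.2 - q.1, q.1)) (by fun_prop)).aemeasurable
    · have hq : Measure.QuasiMeasurePreserving (fun q : RN N × RN N => q.2 - q.1)
          ((volume : Measure (RN N)).prod volume) volume := by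
        have := (quasiMeasurePreserving_sub (volume : Measure (RN N)) volume).comp
          (Measure.measurePreserving_swap (μ := (volume : Measure (RN N)))
            (ν := (volume : Measure (RN N)))).quasiMeasurePreserving
        exact this
      exact hk.comp_quasiMeasurePreserving hq
  unfold nonlocalEnergy
  simp only [h1]
  rw [Measure.volume_eq_prod, lintegral_prod _ hm2]
  have h2 : ∀ x : RN N, ∫⁻ y : RN N, ePow p (magShift A (y - x) u x - u x) *
        kern p (ρ n) (gauge K (y - x)) = ∫⁻ h : RN N, ePow p (magShift A h u x - u x) *
        kern p (ρ n) (gauge K h) := by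
    intro x
    exact lintegral_sub_right_eq_self
      (fun h => ePow p (magShift A h u x - u x) * kern p (ρ n) (gauge K h)) x
  simp only [h2]
  rw [lintegral_lintegral_swap
    (f := fun x h : RN N => ePow p (magShift A h u x - u x) * kern p (ρ n) (gauge K h))]
  · apply lintegral_congr
    intro h
    have hm3 : Measurable fun x : RN N => ePow p (magShift A h u x - u x) :=
      (measurable_ePow p).comp ((measurable_magShift hA hum h).sub hum.measurable)
    rw [shiftEnergy, lintegral_mul_const _ hm3]
  · have e1 : AEMeasurable (fun q : RN N × RN N => ePow p (magShift A q.2 u q.1 - u q.1))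
        ((volume : Measure (RN N)).prod volume) := (hm1.comp measurable_swap).aemeasurable
    have e2 : AEMeasurable (fun q : RN N × RN N => kern p (ρ n) (gauge K q.2))
        ((volume : Measure (RN N)).prod volume) := hk.comp_snd
    exact e1.mul e2

theorem measurable_ePow_cdot_prod {G : RN N → CN N} (hG : StronglyMeasurable G) :
    Measurable fun q : RN N × RN N => ePow p (cdot (G q.2) q.1) := by
  have h1 : Measurable fun q : RN N × RN N => (G q.2, q.1) :=
    (hG.measurable.comp measurable_snd).prodMk measurable_fst
  exact (measurable_ePow p).comp (continuous_cdot.measurable.comp h1)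

theorem measurable_dirEnergy {G : RN N → CN N} (hG : StronglyMeasurable G) :
    Measurable (dirEnergy p G) :=
  (measurable_ePow_cdot_prod hG).lintegral_prod_right'

theorem dirEnergy_smul (hp : 0 ≤ p) (G : RN N → CN N) (t : ℝ) (ht : 0 < t) (h : RN N) :
    dirEnergy p G (t • h) = ENNReal.ofReal (t ^ p) * dirEnergy p G h := by
  unfold dirEnergy
  rw [← lintegral_const_mul' _ _ ENNReal.ofReal_ne_top]
  apply lintegral_congr
  intro x
  rw [cdot_smul_right, ePow_real_mul hp, Real.enorm_eq_ofReal ht.le,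
    ENNReal.ofReal_rpow_of_nonneg ht.le hp]

theorem enorm_rpow_eq {V : Type*} [NormedAddCommGroup V] (hp : 0 ≤ p) (h : V) :
    ‖h‖ₑ ^ p = ENNReal.ofReal (‖h‖ ^ p) := by
  rw [← ofReal_norm, ENNReal.ofReal_rpow_of_nonneg (norm_nonneg _) hp]

/-- The normalization `(N + p)/p` of the moment norm is the origin of the factor `p` in the limit.
-/
theorem ofReal_polarMomentNorm_rpow (hp : 1 ≤ p) (hKb : Bornology.IsBounded K)
    (v : CN N) : ENNReal.ofReal p * ENNReal.ofReal (polarMomentNorm p K v ^ p)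
      = ENNReal.ofReal (N + p) * ∫⁻ h in K, ePow p (cdot v h) := by
  have hp0 : 0 < p := by linarith
  have hnn : ∀ x, 0 ≤ absP p (cdot v x) ^ p := by
    intro x
    have : 0 ≤ absP p (cdot v x) := by unfold absP; positivity
    positivity
  have hcd : Continuous fun h : RN N => cdot v h :=
    continuous_cdot.comp (continuous_const.prodMk continuous_id)
  have hcont : Continuous fun x => absP p (cdot v x) ^ p := by
    unfold absP
    refine Continuous.rpow_const (Continuous.rpow_const ?_ fun x => Or.inr (by positivity))
      fun x => Or.inr hp0.le
    refine Continuous.add ?_ ?_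
    · exact (Complex.continuous_re.comp hcd).abs.rpow_const fun x => Or.inr hp0.le
    · exact (Complex.continuous_im.comp hcd).abs.rpow_const fun x => Or.inr hp0.le
  have hint : IntegrableOn (fun x => absP p (cdot v x) ^ p) K := by
    obtain ⟨R, hR⟩ := hKb.subset_closedBall (0 : RN N)
    exact (hcont.continuousOn.integrableOn_compact (isCompact_closedBall _ _)).mono_set hR
  have hI : 0 ≤ ∫ x in K, absP p (cdot v x) ^ p := integral_nonneg hnn
  rw [polarMomentNorm, ← Real.rpow_mul (by positivity), one_div_mul_cancel hp0.ne', Real.rpow_one,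
    ENNReal.ofReal_mul (by positivity), ofReal_integral_eq_lintegral_ofReal hint
      (Eventually.of_forall hnn), ← mul_assoc, ← ENNReal.ofReal_mul hp0.le,
    mul_div_cancel₀ _ hp0.ne']
  simp only [ofReal_absP_rpow hp]

theorem ofReal_mul_lintegral_polarMomentNorm (hp : 1 ≤ p) (hKb : Bornology.IsBounded K)
    {G : RN N → CN N} (hG : StronglyMeasurable G) :
    ENNReal.ofReal p * ∫⁻ x, ENNReal.ofReal (polarMomentNorm p K (G x) ^ p)
      = coneMass K p (dirEnergy p G) := by
  rw [← lintegral_const_mul' _ _ ENNReal.ofReal_ne_top]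
  simp only [ofReal_polarMomentNorm_rpow hp hKb]
  rw [lintegral_const_mul' _ _ ENNReal.ofReal_ne_top, coneMass, lintegral_lintegral_swap]
  · rfl
  · exact ((measurable_ePow_cdot_prod hG).comp measurable_swap).aemeasurable

/-- Coercivity of the moment integral: `K` contains a ball, placed in the direction of `a`, on which
`h · a` is at least a fixed multiple of `‖a‖`. -/
theorem exists_ball_bound (hK0 : (0 : RN N) ∈ interior K) (hp : 1 ≤ p) :
    ∃ c : ℝ≥0∞, c ≠ 0 ∧ ∀ a : RN N, c * ‖a‖ₑ ^ p ≤ ∫⁻ h in K, ‖(inner ℝ h a : ℝ)‖ₑ ^ p := by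
  have hp0 : 0 < p := by linarith
  obtain ⟨r, hr, hrK⟩ := Metric.mem_nhds_iff.1 (mem_interior_iff_mem_nhds.1 hK0)
  refine ⟨ENNReal.ofReal (r / 4) ^ p * volume (Metric.ball (0 : RN N) (r / 4)), ?_, fun a => ?_⟩
  · refine mul_ne_zero ?_ (Metric.measure_ball_pos volume _ (by positivity)).ne'
    have : 0 < r / 4 := by positivity
    simp [ENNReal.rpow_eq_zero_iff, this]
  rcases eq_or_ne a 0 with rfl | ha
  · simp [hp0]
  have ha' : 0 < ‖a‖ := norm_pos_iff.2 ha
  -- With `‖w‖ = r/2`, the ball of radius `r/4` about `w` stays in the ball of radius `r` contained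
  -- in `K`, and on it `h · a ≥ (r/2 - r/4)‖a‖`.
  set w : RN N := (r / 2 / ‖a‖) • a with hw
  have hwn : ‖w‖ = r / 2 := by
    rw [hw, norm_smul, Real.norm_of_nonneg (by positivity)]
    field_simp
  have hsub : Metric.ball w (r / 4) ⊆ K := by
    intro h hh
    apply hrK
    rw [mem_ball_iff_norm] at hh
    rw [mem_ball_zero_iff]
    calc ‖h‖ = ‖(h - w) + w‖ := by simp
      _ ≤ ‖h - w‖ + ‖w‖ := norm_add_le _ _
      _ < r := by rw [hwn]; linarith
  calc ENNReal.ofReal (r / 4) ^ p * volume (Metric.ball (0 : RN N) (r / 4)) * ‖a‖ₑ ^ p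
      = ∫⁻ h in Metric.ball w (r / 4), (ENNReal.ofReal (r / 4) * ‖a‖ₑ) ^ p := by
        rw [setLIntegral_const, Measure.addHaar_ball_center volume w, ENNReal.mul_rpow_of_nonneg _ _ hp0.le]
        ring
    _ ≤ ∫⁻ h in Metric.ball w (r / 4), ‖(inner ℝ h a : ℝ)‖ₑ ^ p := by
        apply setLIntegral_mono' measurableSet_ball
        intro h hh
        gcongr
        rw [mem_ball_iff_norm] at hh
        rw [← ofReal_norm, ← ofReal_norm, ← ENNReal.ofReal_mul (by positivity)]
        apply ENNReal.ofReal_le_ofReal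
        have h1 : inner ℝ w a = r / 2 * ‖a‖ := by
          rw [hw, real_inner_smul_left, real_inner_self_eq_norm_sq]
          field_simp
        have h2 : |inner ℝ (h - w) a| ≤ r / 4 * ‖a‖ :=
          (abs_real_inner_le_norm _ _).trans (by gcongr)
        have h3 : inner ℝ h a = inner ℝ w a + inner ℝ (h - w) a := by
          rw [← inner_add_left, add_sub_cancel]
        rw [Real.norm_eq_abs]
        refine le_trans ?_ (le_abs_self _)
        rw [h3, h1]
        linarith [neg_le_of_abs_le h2]
    _ ≤ _ := lintegral_mono_set hsub

theorem exists_lower_bound (hK0 : (0 : RN N) ∈ interior K) (hp : 1 ≤ p) :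
    ∃ c : ℝ≥0∞, c ≠ 0 ∧ ∀ v : CN N, c * ‖v‖ₑ ^ p ≤ ∫⁻ h in K, ePow p (cdot v h) := by
  have hp0 : 0 < p := by linarith
  obtain ⟨c, hc0, hc⟩ := exists_ball_bound hK0 hp
  refine ⟨c / 2 ^ p, by simp [hc0], fun v => ?_⟩
  set a : RN N := WithLp.toLp 2 fun j => (v j).re with ha
  set b : RN N := WithLp.toLp 2 fun j => (v j).im with hb
  have hv : v = toCN a + Complex.I • toCN b := by
    ext j
    simp [toCN, ha, hb, mul_comm Complex.I]
  have hre : ∀ h, (cdot v h).re = inner ℝ h a := by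
    intro h
    rw [hv, cdot_add_left, cdot_smul_left, cdot_toCN, cdot_toCN]; simp
  have him : ∀ h, (cdot v h).im = inner ℝ h b := by
    intro h
    rw [hv, cdot_add_left, cdot_smul_left, cdot_toCN, cdot_toCN]; simp
  have hnorm : ‖v‖ₑ ≤ ‖a‖ₑ + ‖b‖ₑ := by
    calc ‖v‖ₑ ≤ ‖toCN a‖ₑ + ‖Complex.I • toCN b‖ₑ := by rw [hv]; exact enorm_add_le _ _
      _ = ‖a‖ₑ + ‖b‖ₑ := by
        simp only [← ofReal_norm, norm_smul, norm_toCN, Complex.norm_I, one_mul]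
  have hI : ∫⁻ h in K, ePow p (cdot v h) = (∫⁻ h in K, ‖(inner ℝ h a : ℝ)‖ₑ ^ p) +
      ∫⁻ h in K, ‖(inner ℝ h b : ℝ)‖ₑ ^ p := by
    rw [← lintegral_add_left (by fun_prop)]
    simp only [ePow, hre, him]
  rw [hI]
  have hmax : ‖v‖ₑ ^ p ≤ 2 ^ p * (‖a‖ₑ ^ p + ‖b‖ₑ ^ p) := by
    have h1 : ‖v‖ₑ ≤ 2 * max ‖a‖ₑ ‖b‖ₑ := by
      rw [two_mul]
      exact hnorm.trans (add_le_add (le_max_left _ _) (le_max_right _ _))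
    calc ‖v‖ₑ ^ p ≤ (2 * max ‖a‖ₑ ‖b‖ₑ) ^ p := by gcongr
      _ = 2 ^ p * (max ‖a‖ₑ ‖b‖ₑ) ^ p := ENNReal.mul_rpow_of_nonneg _ _ hp0.le
      _ ≤ _ := by
        gcongr
        rcases max_choice ‖a‖ₑ ‖b‖ₑ with h | h <;> rw [h]
        · exact le_self_add
        · exact le_add_self
  have h2 : (2 : ℝ≥0∞) ^ p ≠ 0 := by simp
  have h2' : (2 : ℝ≥0∞) ^ p ≠ ⊤ := ENNReal.rpow_ne_top_of_nonneg hp0.le (by simp)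
  calc c / 2 ^ p * ‖v‖ₑ ^ p ≤ c / 2 ^ p * (2 ^ p * (‖a‖ₑ ^ p + ‖b‖ₑ ^ p)) := by gcongr
    _ = c * ‖a‖ₑ ^ p + c * ‖b‖ₑ ^ p := by
      rw [← mul_assoc, ENNReal.div_mul_cancel h2 h2', mul_add]
    _ ≤ _ := add_le_add (hc a) (hc b)

end Energy

/-- Removes the slack `a · c` left by the radial comparison lemmas. -/
theorem le_of_forall_le_add_mul {x y c : ℝ≥0∞} (hc : c ≠ ⊤)
    (h : ∀ a : ℝ≥0∞, 0 < a → a ≠ ⊤ → x ≤ y + a * c) : x ≤ y := by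
  have hlim : Tendsto (fun a : ℝ≥0∞ => y + a * c) (𝓝[>] 0) (𝓝 y) := by
    have h1 : Tendsto (fun a : ℝ≥0∞ => a * c) (𝓝[>] 0) (𝓝 (0 * c)) :=
      (ENNReal.Tendsto.mul_const (tendsto_id) (Or.inr hc)).mono_left nhdsWithin_le_nhds
    simpa using h1.const_add y
  refine ge_of_tendsto hlim ?_
  filter_upwards [self_mem_nhdsWithin, nhdsWithin_le_nhds (gt_mem_nhds ENNReal.zero_lt_top)]
    with a ha hat
  exact h a ha (ne_of_lt hat)

/-! ### The limit for magnetic Sobolev functions. -/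

section Sobolev

variable {N : ℕ} {K : Set (RN N)} {A : RN N → RN N} {u : RN N → ℂ} {p : ℝ}

theorem nonlocalEnergy_congr {u' : RN N → ℂ} (hu : u =ᵐ[volume] u') (ρ : ℝ → ℝ) :
    nonlocalEnergy p K A ρ u = nonlocalEnergy p K A ρ u' := by
  apply lintegral_congr_ae
  have h1 : ∀ᵐ z : RN N × RN N, u z.1 = u' z.1 := Measure.quasiMeasurePreserving_fst.ae hu
  have h2 : ∀ᵐ z : RN N × RN N, u z.2 = u' z.2 := Measure.quasiMeasurePreserving_snd.ae hu
  filter_upwards [h1, h2] with z hz1 hz2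
  simp only [Psi, hz1, hz2]

theorem magEnergy_congr {u' : RN N → ℂ} {g g' : RN N → CN N} (hu : u =ᵐ[volume] u')
    (hg : g =ᵐ[volume] g') : magEnergy p K A u g = magEnergy p K A u' g' := by
  apply lintegral_congr_ae
  filter_upwards [hu, hg] with x h1 h2
  rw [h1, h2]

theorem shiftEnergy_le (hp : 1 ≤ p) (hA : Continuous A) (hum : StronglyMeasurable u) (h : RN N) :
    shiftEnergy p A u h ≤ 2 * (2 * eLpNorm u (ENNReal.ofReal p) volume) ^ p := by
  have hp' : (1 : ℝ≥0∞) ≤ ENNReal.ofReal p := by simpa using hp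
  have hms := (measurable_magShift hA hum h).aestronglyMeasurable (μ := volume)
  calc shiftEnergy p A u h ≤ ∫⁻ x, 2 * ‖magShift A h u x - u x‖ₑ ^ p :=
        lintegral_mono fun x => ePow_le (by linarith) _
    _ = 2 * eLpNorm (magShift A h u - u) (ENNReal.ofReal p) volume ^ p := by
        rw [eLpNorm_ofReal_rpow hp, lintegral_const_mul' _ _ (by simp)]
        rfl
    _ ≤ _ := by
        gcongr
        refine (eLpNorm_sub_le hms hum.aestronglyMeasurable hp').trans ?_
        rw [eLpNorm_magShift hum.aestronglyMeasurable, two_mul]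

/-- Coercivity of the moment norm upgrades finite magnetic energy to `G ∈ L^p`, which the
first-order expansion requires. Neither `∇u` nor `Au` is assumed to lie in `L^p` separately. -/
theorem memLp_of_coneMass_lt_top (hp : 1 ≤ p) (hN : 1 ≤ N)
    (hK0 : (0 : RN N) ∈ interior K) {G : RN N → CN N} (hG : StronglyMeasurable G)
    (hfin : coneMass K p (dirEnergy p G) < ⊤) : MemLp G (ENNReal.ofReal p) volume := by
  have hp0 : 0 < p := by linarith
  refine ⟨hG.aestronglyMeasurable, ?_⟩
  obtain ⟨c, hc0, hc⟩ := exists_lower_bound (K := K) hK0 hp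
  have hN' : 0 < ENNReal.ofReal (N + p) := by
    rw [ENNReal.ofReal_pos]; positivity
  have h1 : c * ∫⁻ x, ‖G x‖ₑ ^ p ≤ ∫⁻ h in K, dirEnergy p G h := by
    calc c * ∫⁻ x, ‖G x‖ₑ ^ p = ∫⁻ x, c * ‖G x‖ₑ ^ p := by
          rw [lintegral_const_mul _ (hG.measurable.enorm.pow_const p)]
      _ ≤ ∫⁻ x, ∫⁻ h in K, ePow p (cdot (G x) h) := lintegral_mono fun x => hc _
      _ = _ := by
          rw [lintegral_lintegral_swap]
          · rfl
          · exact ((measurable_ePow_cdot_prod hG).comp measurable_swap).aemeasurable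
  have h2 : ∫⁻ h in K, dirEnergy p G h < ⊤ := by
    by_contra hcon
    rw [not_lt_top_iff] at hcon
    rw [coneMass, hcon, ENNReal.mul_top hN'.ne'] at hfin
    exact lt_irrefl _ hfin
  have h3 : ∫⁻ x, ‖G x‖ₑ ^ p < ⊤ := by
    by_contra hcon
    rw [not_lt_top_iff] at hcon
    rw [hcon, ENNReal.mul_top hc0] at h1
    exact absurd h2 (not_lt.2 h1)
  rw [← eLpNorm_ofReal_rpow hp] at h3
  by_contra hcon
  rw [not_lt_top_iff] at hcon
  rw [hcon, ENNReal.top_rpow_of_pos hp0] at h3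
  exact lt_irrefl _ h3

theorem eLpNorm_cdot_le (hp : 1 ≤ p) (G : RN N → CN N) (h : RN N) :
    eLpNorm (fun x => cdot (G x) h) (ENNReal.ofReal p) volume ≤
      eLpNorm G (ENNReal.ofReal p) volume * ‖h‖ₑ := by
  calc _ ≤ eLpNorm (fun x => ‖h‖ₑ * ‖G x‖ₑ) (ENNReal.ofReal p) volume :=
        eLpNorm_mono_enorm fun x => by simpa using enorm_cdot_le _ _
    _ = _ := by
        rw [eLpNorm_const_mul_ennreal hp (by simp), eLpNorm_enorm', mul_comm]

theorem aestronglyMeasurable_cdot {G : RN N → CN N} (hG : AEStronglyMeasurable G volume)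
    (h : RN N) : AEStronglyMeasurable (fun x => cdot (G x) h) volume := by
  have := (cdotCLM h).continuous.comp_aestronglyMeasurable hG
  simpa using this

/-- The expansion `G·h + o(‖h‖)` makes shift and directional energies agree up to `a‖h‖^p` near `0`;
the directional energy is homogeneous, so both radial comparison lemmas apply. -/
theorem tendsto_lintegral_shiftEnergy (hN : 1 ≤ N) (hp : 1 ≤ p) (hKc : Convex ℝ K)
    (hKb : Bornology.IsBounded K) (hK0 : (0 : RN N) ∈ interior K) {ρ : ℕ → ℝ → ℝ}
    (hρ : IsMollifierSeq N p ρ) {L : NNReal} (hA : LipschitzWith L A)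
    (hum : StronglyMeasurable u) (hu : MemLp u (ENNReal.ofReal p) volume) {G : RN N → CN N}
    (hGm : StronglyMeasurable G) (hG : MemLp G (ENNReal.ofReal p) volume)
    (hGu : ∀ φ y, magGrad φ A u y = moll φ G y) :
    Tendsto (fun n => ∫⁻ h, shiftEnergy p A u h * kern p (ρ n) (gauge K h)) atTop
      (𝓝 (coneMass K p (dirEnergy p G))) := by
  have hp0 : 0 ≤ p := by linarith
  have hclose : ∀ a : ℝ≥0∞, 0 < a → ∃ δ > 0, ∀ h : RN N, ‖h‖ < δ →
      shiftEnergy p A u h ≤ dirEnergy p G h + a * ENNReal.ofReal (‖h‖ ^ p) ∧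
      dirEnergy p G h ≤ shiftEnergy p A u h + a * ENNReal.ofReal (‖h‖ ^ p) := by
    intro a ha
    obtain ⟨e, he, het, hkey⟩ := exists_lintegral_ePow_close (X := RN N) (μ := volume) hp hG.2.ne ha
    obtain ⟨δ, hδ, hd⟩ := exists_magShift_sub_sub_small hp hA hum hu hG hGu
      (e := e / 8) (ENNReal.div_pos he.ne' (by simp))
    refine ⟨δ, hδ, fun h hh => ?_⟩
    have h1 := hd h hh
    rw [ENNReal.mul_div_cancel (by simp) (by simp)] at h1
    have := hkey ‖h‖ₑ (fun x => magShift A h u x - u x) (fun x => cdot (G x) h) (by simp)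
      (((measurable_magShift hA.continuous hum h).sub hum.measurable).aestronglyMeasurable)
      (aestronglyMeasurable_cdot hG.1 h) (eLpNorm_cdot_le hp G h) h1
    rwa [enorm_rpow_eq hp0] at this
  have hc := (coneMass_norm_lt_top hKb hp0).ne
  refine tendsto_of_le_liminf_of_limsup_le ?_ ?_
  · refine le_of_forall_le_add_mul hc fun a ha hat => ?_
    obtain ⟨δ, hδ, hd⟩ := hclose a ha
    exact le_liminf_radial_add hN hp0 hKc hKb hK0 hρ (measurable_dirEnergy hGm)
      (dirEnergy_smul hp0 G) hat hδ fun h hh => (hd h hh).2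
  · refine le_of_forall_le_add_mul hc fun a ha hat => ?_
    obtain ⟨δ, hδ, hd⟩ := hclose a ha
    exact limsup_radial_le hN hp0 hKc hKb hK0 hρ (measurable_dirEnergy hGm)
      (dirEnergy_smul hp0 G) (C := 2 * (2 * eLpNorm u (ENNReal.ofReal p) volume) ^ p)
      (ENNReal.mul_ne_top (by simp) (ENNReal.rpow_ne_top_of_nonneg hp0
        (ENNReal.mul_ne_top (by simp) hu.2.ne)))
      (shiftEnergy_le hp hA.continuous hum) hδ fun h hh => (hd h hh).1

theorem stronglyMeasurable_magField (hA : Continuous A) (hum : StronglyMeasurable u)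
    {g : RN N → CN N} (hg : StronglyMeasurable g) : StronglyMeasurable (magField A u g) := by
  unfold magField
  exact hg.sub ((stronglyMeasurable_const.mul hum).smul
    (continuous_toCN.comp hA).stronglyMeasurable)

theorem tendsto_nonlocalEnergy_sobolev (hN : 1 ≤ N) (hp : 1 ≤ p) (hKc : Convex ℝ K)
    (hKs : ∀ x ∈ K, -x ∈ K) (hKb : Bornology.IsBounded K) (hK0 : (0 : RN N) ∈ interior K)
    {ρ : ℕ → ℝ → ℝ} (hρ : IsMollifierSeq N p ρ) {L : NNReal} (hA : LipschitzWith L A)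
    (hu : MemMagSobolev p K A u) {g : RN N → CN N} (hg : IsWeakGradient u g) :
    Tendsto (fun n => nonlocalEnergy p K A (ρ n) u) atTop
      (𝓝 (ENNReal.ofReal p * magEnergy p K A u g)) := by
  obtain ⟨huL, g₀, hg₀, hfin⟩ := hu
  have hgm := hg.2.1.aestronglyMeasurable
  -- The Tonelli arguments are stated for strongly measurable functions; both sides of the limit
  -- depend only on a.e. classes.
  set v := huL.1.mk u
  set f := hgm.mk g
  have huv : u =ᵐ[volume] v := huL.1.ae_eq_mk
  have hgf : g =ᵐ[volume] f := hgm.ae_eq_mk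
  have hvm : StronglyMeasurable v := huL.1.stronglyMeasurable_mk
  have hfm : StronglyMeasurable f := hgm.stronglyMeasurable_mk
  have hw : IsWeakGradient v f := hg.congr huv hgf
  have hGm := stronglyMeasurable_magField hA.continuous hvm hfm
  have hE : ENNReal.ofReal p * magEnergy p K A u g
      = coneMass K p (dirEnergy p (magField A v f)) := by
    rw [magEnergy_congr huv hgf]
    exact ofReal_mul_lintegral_polarMomentNorm hp hKb hGm
  have hfin' : coneMass K p (dirEnergy p (magField A v f)) < ⊤ := by
    rw [← hE, magEnergy_congr (EventuallyEq.refl _ u) (hg.ae_eq hg₀)]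
    exact ENNReal.mul_lt_top ENNReal.ofReal_lt_top hfin
  have hGL := memLp_of_coneMass_lt_top hp hN hK0 hGm hfin'
  rw [hE]
  have := tendsto_lintegral_shiftEnergy hN hp hKc hKb hK0 hρ hA hvm (huL.ae_eq huv) hGm hGL
    (fun φ y => hw.magGrad_eq_moll hA.continuous φ y)
  refine this.congr fun n => ?_
  rw [nonlocalEnergy_congr huv,
    nonlocalEnergy_eq_lintegral hN hp hKc hKs hKb hK0 hρ hA.continuous hvm]

end Sobolev

/-! ### The moment norm for `p = 1` and its dual. -/

section Moment

variable {N : ℕ} {K : Set (RN N)}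

/-- The real norm `(N + 1) ∫_K |h · w| dh`. -/
def momentNorm (K : Set (RN N)) (w : RN N) : ℝ := ((N : ℝ) + 1) * ∫ h in K, |inner ℝ h w|

theorem polarMomentNorm_one_toCN (w : RN N) : polarMomentNorm 1 K (toCN w) = momentNorm K w := by
  simp [polarMomentNorm, momentNorm, absP, cdot_toCN]

theorem momentNorm_nonneg (w : RN N) : 0 ≤ momentNorm K w := by
  unfold momentNorm
  have : 0 ≤ ∫ h in K, |inner ℝ h w| := integral_nonneg fun h => abs_nonneg _
  positivity

theorem integrableOn_inner (hKb : Bornology.IsBounded K) (w : RN N) :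
    IntegrableOn (fun h : RN N => (inner ℝ h w : ℝ)) K := by
  obtain ⟨R, hR⟩ := hKb.subset_closedBall (0 : RN N)
  have hc : Continuous fun h : RN N => (inner ℝ h w : ℝ) := by fun_prop
  exact (hc.continuousOn.integrableOn_compact (isCompact_closedBall _ _)).mono_set hR

theorem integrableOn_norm (hKb : Bornology.IsBounded K) :
    IntegrableOn (fun h : RN N => ‖h‖) K := by
  obtain ⟨R, hR⟩ := hKb.subset_closedBall (0 : RN N)
  exact (continuous_norm.continuousOn.integrableOn_compact (isCompact_closedBall _ _)).mono_set hR

theorem ofReal_momentNorm (hKb : Bornology.IsBounded K) (w : RN N) :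
    ENNReal.ofReal (momentNorm K w) =
      ENNReal.ofReal (N + 1) * ∫⁻ h in K, ‖(inner ℝ h w : ℝ)‖ₑ := by
  rw [momentNorm, ENNReal.ofReal_mul (by positivity),
    ofReal_integral_eq_lintegral_ofReal (integrableOn_inner hKb w).abs
      (Eventually.of_forall fun h => abs_nonneg _)]
  simp only [← ofReal_norm, Real.norm_eq_abs]

theorem measurable_momentNorm : Measurable (momentNorm K) := by
  have h1 : StronglyMeasurable fun q : RN N × RN N => |(inner ℝ q.2 q.1 : ℝ)| :=
    Continuous.stronglyMeasurable (by fun_prop)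
  exact (h1.integral_prod_right' (ν := volume.restrict K)).measurable.const_mul _

theorem momentNorm_smul {t : ℝ} (ht : 0 ≤ t) (w : RN N) :
    momentNorm K (t • w) = t * momentNorm K w := by
  simp only [momentNorm, real_inner_smul_right, abs_mul, abs_of_nonneg ht, integral_const_mul]
  ring

theorem exists_mul_norm_le_momentNorm (hKb : Bornology.IsBounded K)
    (hK0 : (0 : RN N) ∈ interior K) : ∃ c : ℝ, 0 < c ∧ ∀ w, c * ‖w‖ ≤ momentNorm K w := by
  obtain ⟨c, hc0, hc⟩ := exists_ball_bound hK0 le_rfl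
  set c' : ℝ≥0∞ := min c 1
  have hc'0 : c' ≠ 0 := (lt_min (pos_iff_ne_zero.2 hc0) one_pos).ne'
  have hc't : c' ≠ ⊤ := ne_top_of_le_ne_top ENNReal.one_ne_top (min_le_right _ _)
  refine ⟨c'.toReal, ENNReal.toReal_pos hc'0 hc't, fun w => ?_⟩
  rw [← ENNReal.ofReal_le_ofReal_iff (momentNorm_nonneg w), ofReal_momentNorm hKb,
    ENNReal.ofReal_mul (by positivity), ENNReal.ofReal_toReal hc't, ofReal_norm]
  have h1 := hc w
  simp only [ENNReal.rpow_one] at h1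
  calc c' * ‖w‖ₑ ≤ c * ‖w‖ₑ := by gcongr; exact min_le_left _ _
    _ ≤ _ := h1
    _ ≤ _ := by
      refine le_mul_of_one_le_left (by positivity) ?_
      rw [ENNReal.one_le_ofReal]
      have : (0 : ℝ) ≤ N := by positivity
      linarith

/-- Rescale `w` to moment norm `1` and use the definition of the dual norm. -/
theorem inner_le_momentNorm_of_dualMomentNorm_le_one (hKb : Bornology.IsBounded K)
    (hK0 : (0 : RN N) ∈ interior K) {v : RN N} (hv : dualMomentNorm K v ≤ 1) (w : RN N) :
    inner ℝ v w ≤ momentNorm K w := by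
  obtain ⟨c, hc0, hc⟩ := exists_mul_norm_le_momentNorm hKb hK0
  rcases eq_or_ne w 0 with rfl | hw
  · simpa using momentNorm_nonneg (K := K) (0 : RN N)
  have hpos : 0 < momentNorm K w := lt_of_lt_of_le (by positivity) (hc w)
  -- A real `sSup` of an unbounded set is `0` by default and would say nothing; coercivity of the
  -- moment norm gives the bound.
  have hbdd : BddAbove {t : ℝ | ∃ w : RN N, polarMomentNorm 1 K (toCN w) ≤ 1 ∧ t = inner ℝ v w} := by
    refine ⟨‖v‖ * c⁻¹, ?_⟩
    rintro t ⟨w', hw', rfl⟩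
    rw [polarMomentNorm_one_toCN] at hw'
    refine (real_inner_le_norm _ _).trans ?_
    gcongr
    rw [← one_div, le_div_iff₀ hc0, mul_comm]
    exact (hc w').trans hw'
  have hmem : inner ℝ v ((momentNorm K w)⁻¹ • w) ≤ dualMomentNorm K v := by
    apply le_csSup hbdd
    refine ⟨_, ?_, rfl⟩
    rw [polarMomentNorm_one_toCN, momentNorm_smul (by positivity), inv_mul_cancel₀ hpos.ne']
  rw [real_inner_smul_right] at hmem
  have h1 := hmem.trans hv
  rwa [inv_mul_le_iff₀ hpos, mul_one] at h1

theorem dualMomentNorm_le_one {v : RN N} (hv : ∀ w, inner ℝ v w ≤ momentNorm K w) :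
    dualMomentNorm K v ≤ 1 := by
  refine Real.sSup_le ?_ zero_le_one
  rintro t ⟨w, hw, rfl⟩
  rw [polarMomentNorm_one_toCN] at hw
  exact (hv w).trans hw

/-- The sign `±1` of a real number. -/
def pmSign (t : ℝ) : ℝ := if 0 ≤ t then 1 else -1

theorem pmSign_mul_self (t : ℝ) : pmSign t * t = |t| := by
  unfold pmSign
  split_ifs with h
  · rw [one_mul, abs_of_nonneg h]
  · rw [abs_of_neg (not_le.1 h)]; ring

theorem abs_pmSign (t : ℝ) : |pmSign t| = 1 := by
  unfold pmSign; split_ifs <;> simp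

theorem measurable_pmSign : Measurable pmSign :=
  Measurable.ite measurableSet_Ici measurable_const measurable_const

/-- The vector `-(N + 1) ∫_K sign(h · w) h dh`, at which the dual pairing with `w` is minimal. -/
def signField (K : Set (RN N)) (w : RN N) : RN N :=
  -(((N : ℝ) + 1) • ∫ h in K, pmSign (inner ℝ h w) • h)

theorem integrableOn_pmSign_smul (hKb : Bornology.IsBounded K) (w : RN N) :
    IntegrableOn (fun h : RN N => pmSign (inner ℝ h w) • h) K := by
  refine (integrableOn_norm hKb).mono' ?_ (Eventually.of_forall fun h => ?_)
  · have : Measurable fun h : RN N => pmSign (inner ℝ h w) := measurable_pmSign.comp (by fun_prop)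
    exact (this.smul measurable_id).aestronglyMeasurable
  · rw [norm_smul, Real.norm_eq_abs, abs_pmSign, one_mul]

theorem inner_signField (hKb : Bornology.IsBounded K) (w v : RN N) :
    inner ℝ (signField K w) v
      = -(((N : ℝ) + 1) * ∫ h in K, pmSign (inner ℝ h w) * inner ℝ h v) := by
  rw [signField, inner_neg_left, real_inner_smul_left]
  congr 2
  have h := ((innerSL ℝ) v).integral_comp_comm (integrableOn_pmSign_smul hKb w)
  simp only [innerSL_apply_apply] at h
  rw [real_inner_comm, ← h]
  congr 1 with x
  rw [real_inner_smul_right, real_inner_comm x v]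

theorem inner_signField_self (hKb : Bornology.IsBounded K) (w : RN N) :
    inner ℝ (signField K w) w = - momentNorm K w := by
  rw [inner_signField hKb, momentNorm]
  simp only [pmSign_mul_self]

/-- Signs have modulus one, so the field lies in the dual unit ball. With `inner_signField_self` it
is an explicit, measurable choice of extremal vector, making a selection theorem unnecessary. -/
theorem inner_signField_le (hKb : Bornology.IsBounded K) (w v : RN N) :
    inner ℝ (signField K w) v ≤ momentNorm K v := by
  rw [inner_signField hKb, momentNorm, ← mul_neg]
  gcongr
  have h1 := norm_integral_le_of_norm_le (μ := volume.restrict K)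
    (f := fun h : RN N => pmSign (inner ℝ h w) * inner ℝ h v) (integrableOn_inner hKb v).abs
    (Eventually.of_forall fun h => by
      rw [norm_mul, Real.norm_eq_abs, Real.norm_eq_abs, abs_pmSign, one_mul])
  exact (neg_le_abs _).trans h1

theorem norm_signField_le (hKb : Bornology.IsBounded K) (w : RN N) :
    ‖signField K w‖ ≤ ((N : ℝ) + 1) * ∫ h in K, ‖h‖ := by
  rw [signField, norm_neg, norm_smul, Real.norm_of_nonneg (by positivity)]
  gcongr
  refine norm_integral_le_of_norm_le (integrableOn_norm hKb) (Eventually.of_forall fun h => ?_)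
  rw [norm_smul, Real.norm_eq_abs, abs_pmSign, one_mul]

theorem stronglyMeasurable_signField : StronglyMeasurable (signField K) := by
  unfold signField
  have h1 : StronglyMeasurable fun q : RN N × RN N => pmSign (inner ℝ q.2 q.1) • q.2 := by
    have : Measurable fun q : RN N × RN N => pmSign (inner ℝ q.2 q.1) :=
      measurable_pmSign.comp (by fun_prop)
    exact (this.smul measurable_snd).stronglyMeasurable
  exact ((h1.integral_prod_right' (ν := volume.restrict K)).const_smul ((N : ℝ) + 1)).neg

/-- The real vector `(c(v_j))_j` of a complex vector `v` and a real functional `c` on `ℂ`. -/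
def part (c : ℂ →L[ℝ] ℝ) (v : CN N) : RN N := WithLp.toLp 2 fun j => c (v j)

theorem continuous_part (c : ℂ →L[ℝ] ℝ) : Continuous (part c : CN N → RN N) := by
  unfold part; fun_prop

theorem apply_cdot (c : ℂ →L[ℝ] ℝ) (v : CN N) (h : RN N) :
    c (cdot v h) = inner ℝ h (part c v) := by
  simp only [cdot, map_sum, part, PiLp.inner_apply]
  refine Finset.sum_congr rfl fun j _ => ?_
  rw [mul_comm, ← Complex.real_smul, map_smul]
  simp [mul_comm]

/-- For `p = 1`, `|z|_1` is the sum of `|Re z|` and `|Im z|`. Hence the energy splits into two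
parts, which will be compared with the two suprema of the variation. -/
theorem lintegral_ofReal_momentNorm_part (hKb : Bornology.IsBounded K) {G : RN N → CN N}
    (hG : StronglyMeasurable G) :
    (∫⁻ x, ENNReal.ofReal (momentNorm K (part Complex.reCLM (G x)))) +
      (∫⁻ x, ENNReal.ofReal (momentNorm K (part Complex.imCLM (G x))))
      = coneMass K 1 (dirEnergy 1 G) := by
  rw [← ofReal_mul_lintegral_polarMomentNorm le_rfl hKb hG, ENNReal.ofReal_one, one_mul,
    ← lintegral_add_left']
  · apply lintegral_congr
    intro x
    have h1 := ofReal_polarMomentNorm_rpow (K := K) le_rfl hKb (G x)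
    rw [ENNReal.ofReal_one, one_mul] at h1
    rw [h1, ofReal_momentNorm hKb, ofReal_momentNorm hKb, ← mul_add,
      ← lintegral_add_left (by fun_prop)]
    simp only [ePow, ENNReal.rpow_one, ← apply_cdot]
    rfl
  · exact ((measurable_momentNorm.comp (continuous_part _).measurable).comp
      hG.measurable).ennreal_ofReal.aemeasurable

end Moment

/-! ### Integration by parts against mollified fields. -/

section Pairing

variable {N : ℕ} {K : Set (RN N)} {A : RN N → RN N} {u : RN N → ℂ}

/-- The complex pairing `∫ (div ψ + i A · ψ) u`. -/
def magPairing (A : RN N → RN N) (u : RN N → ℂ) (ψ : RN N → RN N) : ℂ :=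
  ∑ j, ((∫ x, fderiv ℝ (fun y => ψ y j) x (EuclideanSpace.single j (1 : ℝ)) • u x) +
    Complex.I * ∫ x, ψ x j • ((A x j : ℂ) * u x))

theorem contDiff_coord {ψ : RN N → RN N} {n : WithTop ℕ∞} (hψ : ContDiff ℝ n ψ) (j : Fin N) :
    ContDiff ℝ n fun y => ψ y j :=
  (EuclideanSpace.proj j : RN N →L[ℝ] ℝ).contDiff.comp hψ

theorem hasCompactSupport_coord {ψ : RN N → RN N} (hψ : HasCompactSupport ψ) (j : Fin N) :
    HasCompactSupport fun y => ψ y j :=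
  hψ.comp_left (g := fun v : RN N => v j) rfl

theorem fderiv_coord {ψ : RN N → RN N} (hψ : ContDiff ℝ 1 ψ) (j : Fin N) (x h : RN N) :
    fderiv ℝ (fun y => ψ y j) x h = (fderiv ℝ ψ x h) j := by
  have h1 := (EuclideanSpace.proj j : RN N →L[ℝ] ℝ).hasFDerivAt.comp x
    ((hψ.differentiable (by simp) x).hasFDerivAt)
  have h2 : fderiv ℝ (fun y => ψ y j) x = _ := h1.fderiv
  rw [h2]
  rfl

/-- The real and imaginary parts of this single complex integrand are those of the two suprema, so
both can be treated through one functional `c`. -/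
theorem magPairing_eq_integral (hA : Continuous A) (hu : LocallyIntegrable u volume)
    {ψ : RN N → RN N} (hψ : ContDiff ℝ 1 ψ) (hψc : HasCompactSupport ψ) :
    Integrable (fun x => ((divergence ψ x : ℝ) : ℂ) * u x +
      Complex.I * (((inner ℝ (A x) (ψ x) : ℝ) : ℂ) * u x)) ∧
    magPairing A u ψ = ∫ x, (((divergence ψ x : ℝ) : ℂ) * u x +
      Complex.I * (((inner ℝ (A x) (ψ x) : ℝ) : ℂ) * u x)) := by
  have h1 : ∀ j, Integrable fun x =>
      fderiv ℝ (fun y => ψ y j) x (EuclideanSpace.single j (1 : ℝ)) • u x := by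
    intro j
    refine hu.integrable_smul_left_of_hasCompactSupport ?_ ?_
    · exact ((contDiff_coord hψ j).continuous_fderiv (by simp)).clm_apply continuous_const
    · exact (hasCompactSupport_coord hψc j).fderiv_apply (𝕜 := ℝ) _
  have h2 : ∀ j, Integrable fun x => ψ x j • ((A x j : ℂ) * u x) := by
    intro j
    exact (locallyIntegrable_ofReal_mul (by fun_prop) hu).integrable_smul_left_of_hasCompactSupport
      (contDiff_coord hψ j).continuous (hasCompactSupport_coord hψc j)
  have h3 : (fun x => ((divergence ψ x : ℝ) : ℂ) * u x +
      Complex.I * (((inner ℝ (A x) (ψ x) : ℝ) : ℂ) * u x)) = fun x =>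
      ∑ j, (fderiv ℝ (fun y => ψ y j) x (EuclideanSpace.single j (1 : ℝ)) • u x +
        Complex.I * (ψ x j • ((A x j : ℂ) * u x))) := by
    ext x
    simp only [Finset.sum_add_distrib, fderiv_coord hψ, divergence, PiLp.inner_apply,
      Complex.real_smul, Complex.ofReal_sum, Finset.sum_mul, Finset.mul_sum]
    congr 1
    refine Finset.sum_congr rfl fun j _ => ?_
    simp; ring
  have h4 : ∀ j, Integrable fun x => Complex.I * (ψ x j • ((A x j : ℂ) * u x)) :=
    fun j => (h2 j).const_mul _
  have h5 : ∀ j, Integrable fun x =>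
      fderiv ℝ (fun y => ψ y j) x (EuclideanSpace.single j (1 : ℝ)) • u x +
        Complex.I * (ψ x j • ((A x j : ℂ) * u x)) := fun j => (h1 j).add (h4 j)
  rw [h3]
  refine ⟨integrable_finsetSum _ fun j _ => h5 j, ?_⟩
  rw [integral_finsetSum _ fun j _ => h5 j, magPairing]
  refine Finset.sum_congr rfl fun j _ => ?_
  rw [integral_add (h1 j) (h4 j), integral_const_mul]

/-- The supremum of `c(∫ (div ψ + i A · ψ) u)` over admissible fields. -/
def partVariation (c : ℂ →L[ℝ] ℝ) (K : Set (RN N)) (A : RN N → RN N) (u : RN N → ℂ) : ℝ≥0∞ :=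
  ⨆ (ψ : RN N → RN N) (_ : IsAdmissible K ψ), ENNReal.ofReal (c (magPairing A u ψ))

theorem variationRe_eq (hA : Continuous A) (hu : LocallyIntegrable u volume) :
    variationRe K A u = partVariation Complex.reCLM K A u := by
  unfold variationRe partVariation
  refine iSup_congr fun ψ => iSup_congr fun hψ => ?_
  obtain ⟨h1, h2⟩ := magPairing_eq_integral hA hu hψ.1 hψ.2.1
  rw [h2, ← Complex.reCLM.integral_comp_comm h1]
  congr 2 with x
  simp; ring

theorem variationIm_eq (hA : Continuous A) (hu : LocallyIntegrable u volume) :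
    variationIm K A u = partVariation Complex.imCLM K A u := by
  unfold variationIm partVariation
  refine iSup_congr fun ψ => iSup_congr fun hψ => ?_
  obtain ⟨h1, h2⟩ := magPairing_eq_integral hA hu hψ.1 hψ.2.1
  rw [h2, ← Complex.imCLM.integral_comp_comm h1]
  congr 2 with x
  simp; ring

/-- Fubini with `f` only locally integrable: `x` is confined to a ball of radius `R` and `x - y` to
one of radius `r`, so `y` stays in a ball of radius `R + r`. -/
theorem integral_smul_integral_swap {κ : RN N → ℝ} (hκ : Continuous κ) (hκc : HasCompactSupport κ)
    {F : RN N → ℝ} (hF : StronglyMeasurable F) {C R : ℝ} (hC : ∀ x, ‖F x‖ ≤ C)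
    (hR : ∀ x, R < ‖x‖ → F x = 0) {f : RN N → ℂ} (hf : LocallyIntegrable f volume) :
    ∫ x, F x • ∫ y, κ (x - y) • f y = ∫ y, (∫ x, κ (x - y) * F x) • f y := by
  obtain ⟨C', hC'⟩ := hκc.exists_bound_of_continuous hκ
  obtain ⟨r, hr⟩ := hκc.isCompact.isBounded.subset_closedBall (0 : RN N)
  have hC0 : 0 ≤ C := (norm_nonneg _).trans (hC 0)
  have hC'0 : 0 ≤ C' := (norm_nonneg _).trans (hC' 0)
  have hint : Integrable (Function.uncurry fun x y : RN N => F x • (κ (x - y) • f y))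
      ((volume : Measure (RN N)).prod volume) := by
    have h1 : Integrable ((Metric.closedBall (0 : RN N) R).indicator fun _ => C * C') := by
      rw [integrable_indicator_iff measurableSet_closedBall]
      exact integrableOn_const measure_closedBall_lt_top.ne
    have h2 : Integrable ((Metric.closedBall (0 : RN N) (R + r)).indicator fun y => ‖f y‖) := by
      rw [integrable_indicator_iff measurableSet_closedBall]
      exact (hf.integrableOn_isCompact (isCompact_closedBall _ _)).norm
    refine (h1.mul_prod h2).mono' ?_ (Eventually.of_forall fun z => ?_)
    · simp only [Function.uncurry_def]
      have e1 : AEStronglyMeasurable (fun q : RN N × RN N => κ (q.1 - q.2))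
          ((volume : Measure (RN N)).prod volume) := Continuous.aestronglyMeasurable (by fun_prop)
      have e2 : AEStronglyMeasurable (fun q : RN N × RN N => f q.2)
          ((volume : Measure (RN N)).prod volume) := hf.aestronglyMeasurable.comp_snd
      exact (hF.comp_measurable measurable_fst).aestronglyMeasurable.smul (e1.smul e2)
    · obtain ⟨x, y⟩ := z
      simp only [Function.uncurry_apply_pair, norm_smul]
      by_cases hx : R < ‖x‖
      · rw [hR x hx, norm_zero, zero_mul]
        exact mul_nonneg (indicator_nonneg (fun _ _ => by positivity) _)
          (indicator_nonneg (fun _ _ => by positivity) _)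
      by_cases hxy : κ (x - y) = 0
      · rw [hxy, norm_zero, zero_mul, mul_zero]
        exact mul_nonneg (indicator_nonneg (fun _ _ => by positivity) _)
          (indicator_nonneg (fun _ _ => by positivity) _)
      · have hxy' : ‖x - y‖ ≤ r := by
          have := hr (subset_tsupport κ hxy)
          simpa using this
        have hy : ‖y‖ ≤ R + r := by
          calc ‖y‖ = ‖x - (x - y)‖ := by simp
            _ ≤ ‖x‖ + ‖x - y‖ := norm_sub_le _ _
            _ ≤ R + r := add_le_add (not_lt.1 hx) hxy'
        rw [indicator_of_mem (by simpa using hx), indicator_of_mem (by simpa using hy), ← mul_assoc]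
        gcongr
        · exact hC x
        · exact hC' _
  calc ∫ x, F x • ∫ y, κ (x - y) • f y = ∫ x, ∫ y, F x • (κ (x - y) • f y) := by
        simp only [integral_smul]
    _ = ∫ y, ∫ x, F x • (κ (x - y) • f y) := integral_integral_swap hint
    _ = _ := by
        congr 1 with y
        rw [← integral_smul_const]
        congr 1 with x
        rw [smul_smul, mul_comm]

theorem locallyIntegrable_of_bound {V : Type*} [NormedAddCommGroup V] {F : RN N → V}
    (hF : StronglyMeasurable F) {C : ℝ} (hC : ∀ x, ‖F x‖ ≤ C) : LocallyIntegrable F volume :=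
  (locallyIntegrable_const C).mono hF.aestronglyMeasurable
    (Eventually.of_forall fun x => (hC x).trans (le_abs_self C))

theorem moll_apply_coord_real {F : RN N → RN N} (hF : LocallyIntegrable F volume)
    (φ : ContDiffBump (0 : RN N)) (y : RN N) (j : Fin N) :
    moll φ F y j = moll φ (fun z => F z j) y := by
  have h := (EuclideanSpace.proj j : RN N →L[ℝ] ℝ).integral_comp_comm
    (integrable_normed_smul hF φ y)
  simp only [moll_apply]
  simpa using h.symm

theorem fderiv_normed_neg (φ : ContDiffBump (0 : RN N)) (x h : RN N) :
    fderiv ℝ (φ.normed volume) (-x) h = - fderiv ℝ (φ.normed volume) x h := by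
  have h1 : (fun x => φ.normed volume (-x)) = φ.normed volume := funext fun x => φ.normed_neg x
  have h2 : HasFDerivAt (φ.normed volume) (fderiv ℝ (φ.normed volume) (-x)) (-x) :=
    (((φ.contDiff_normed (n := 1)).differentiable (by simp)) (-x)).hasFDerivAt
  have h3 := h2.comp x (hasFDerivAt_id x).neg
  have h4 : fderiv ℝ (fun x => φ.normed volume (-x)) x = _ := h3.fderiv
  rw [h1] at h4
  rw [h4]; simp

/-- The bump is even, so mollification moves from the field to `u` and `A u`; its derivative is odd,
which produces the minus sign. `F` need only be bounded, measurable and supported in a ball, as the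
truncated sign field is. -/
theorem magPairing_moll (hA : Continuous A) (hu : LocallyIntegrable u volume)
    (φ : ContDiffBump (0 : RN N)) {F : RN N → RN N} (hF : StronglyMeasurable F) {C R : ℝ}
    (hC : ∀ x, ‖F x‖ ≤ C) (hR : ∀ x, R < ‖x‖ → F x = 0) :
    Integrable (fun x => cdot (magGrad φ A u x) (F x)) ∧
    magPairing A u (moll φ F) = - ∫ x, cdot (magGrad φ A u x) (F x) := by
  have hFl := locallyIntegrable_of_bound hF hC
  have hcg := continuous_magGrad hA hu φ
  have hC0 : 0 ≤ C := (norm_nonneg _).trans (hC 0)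
  have hFj : ∀ j, StronglyMeasurable fun x => F x j := fun j =>
    (EuclideanSpace.proj j : RN N →L[ℝ] ℝ).continuous.comp_stronglyMeasurable hF
  have hCj : ∀ j x, ‖F x j‖ ≤ C := fun j x => (PiLp.norm_apply_le (F x) j).trans (hC x)
  have hRj : ∀ j x, R < ‖x‖ → F x j = 0 := fun j x hx => by rw [hR x hx]; rfl
  have hFjl : ∀ j, LocallyIntegrable (fun x => F x j) volume := fun j =>
    locallyIntegrable_of_bound (hFj j) (hCj j)
  -- products of `F_j` with continuous functions
  have hprod : ∀ j, ∀ w : RN N → ℂ, Continuous w → Integrable fun x => F x j • w x := by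
    intro j w hw
    have h2 : Integrable ((Metric.closedBall (0 : RN N) R).indicator fun y => C * ‖w y‖) := by
      rw [integrable_indicator_iff measurableSet_closedBall]
      exact (hw.norm.const_mul C |>.continuousOn.integrableOn_compact (isCompact_closedBall _ _))
    refine h2.mono' ((hFj j).aestronglyMeasurable.smul hw.aestronglyMeasurable)
      (Eventually.of_forall fun x => ?_)
    by_cases hx : R < ‖x‖
    · rw [hRj j x hx, zero_smul, norm_zero]
      exact indicator_nonneg (fun _ _ => by positivity) _
    · rw [indicator_of_mem (by simpa using hx), norm_smul]
      gcongr
      exact hCj j x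
  have hgj : ∀ j, Continuous fun x => magGrad φ A u x j := fun j =>
    (EuclideanSpace.proj j : CN N →L[ℂ] ℂ).continuous.comp hcg
  have hsum : (fun x => cdot (magGrad φ A u x) (F x))
      = fun x => ∑ j, F x j • magGrad φ A u x j := by
    ext x
    simp only [cdot, Complex.real_smul]
    exact Finset.sum_congr rfl fun j _ => mul_comm _ _
  rw [hsum]
  refine ⟨integrable_finsetSum _ fun j _ => hprod j _ (hgj j), ?_⟩
  rw [integral_finsetSum _ fun j _ => hprod j _ (hgj j), ← Finset.sum_neg_distrib, magPairing]
  refine Finset.sum_congr rfl fun j _ => ?_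
  have hAj : LocallyIntegrable (fun z => (A z j : ℂ) * u z) volume :=
    locallyIntegrable_ofReal_mul (by fun_prop) hu
  have hmj : (fun y => moll φ F y j) = moll φ (fun z => F z j) :=
    funext fun y => moll_apply_coord_real hFl φ y j
  have hκ : Continuous fun x =>
      fderiv ℝ (φ.normed volume) x (EuclideanSpace.single j (1 : ℝ)) :=
    ((φ.contDiff_normed (n := 1)).continuous_fderiv (by simp)).clm_apply continuous_const
  have hκc : HasCompactSupport fun x =>
      fderiv ℝ (φ.normed volume) x (EuclideanSpace.single j (1 : ℝ)) :=
    φ.hasCompactSupport_normed.fderiv_apply (𝕜 := ℝ) _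
  have e1 : ∫ x, fderiv ℝ (fun y => moll φ F y j) x (EuclideanSpace.single j (1 : ℝ)) • u x
      = - ∫ x, F x j • fderiv ℝ (moll φ u) x (EuclideanSpace.single j (1 : ℝ)) := by
    simp only [hmj, fderiv_moll (hFjl j), fderiv_moll hu]
    rw [integral_smul_integral_swap hκ hκc (hFj j) (hCj j) (hRj j) hu, ← integral_neg]
    congr 1 with y
    rw [← neg_smul, ← integral_neg]
    congr 2 with x
    rw [← neg_sub x y, fderiv_normed_neg, smul_eq_mul, neg_mul]
  have e2 : ∫ x, moll φ F x j • ((A x j : ℂ) * u x)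
      = ∫ x, F x j • moll φ (fun z => (A z j : ℂ) * u z) x := by
    have h1 : ∀ x, moll φ F x j = moll φ (fun z => F z j) x := fun x =>
      moll_apply_coord_real hFl φ x j
    simp_rw [h1, moll_apply_swap]
    rw [integral_smul_integral_swap φ.continuous_normed φ.hasCompactSupport_normed (hFj j) (hCj j)
      (hRj j) hAj]
    congr 1 with y
    refine congrArg (· • _) (integral_congr_ae (Eventually.of_forall fun x => ?_))
    simp only [← neg_sub x y, φ.normed_neg, smul_eq_mul]
  have hcd : Continuous fun x => fderiv ℝ (moll φ u) x (EuclideanSpace.single j (1 : ℝ)) :=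
    ((contDiff_moll hu φ 1).continuous_fderiv (by simp)).clm_apply continuous_const
  have e3 : Integrable fun x =>
      -(F x j • fderiv ℝ (moll φ u) x (EuclideanSpace.single j (1 : ℝ))) := (hprod j _ hcd).neg
  have e4 : Integrable fun x => Complex.I * (F x j • moll φ (fun z => (A z j : ℂ) * u z) x) :=
    (hprod j _ (continuous_moll hAj φ)).const_mul _
  rw [e1, e2, ← integral_const_mul, ← integral_neg, ← integral_neg, ← integral_add e3 e4]
  congr 1 with x
  simp only [magGrad, Complex.real_smul]
  ring

theorem tendsto_integral_moll_smul {φ : ℕ → ContDiffBump (0 : RN N)}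
    (hφ : Tendsto (fun k => (φ k).rOut) atTop (𝓝 0)) {f : RN N → ℝ} (hf : Continuous f)
    (hfc : HasCompactSupport f) {w : RN N → ℂ} (hw : LocallyIntegrable w volume) :
    Tendsto (fun k => ∫ x, moll (φ k) f x • w x) atTop (𝓝 (∫ x, f x • w x)) := by
  obtain ⟨C, hC⟩ := hfc.exists_bound_of_continuous hf
  obtain ⟨R, hR⟩ := hfc.isCompact.isBounded.subset_closedBall (0 : RN N)
  have hC0 : 0 ≤ C := (norm_nonneg _).trans (hC 0)
  have hR0 : ∀ x, R < ‖x‖ → f x = 0 := by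
    intro x hx
    by_contra hne
    have := hR (subset_tsupport f hne)
    rw [mem_closedBall_zero_iff] at this
    linarith
  refine tendsto_integral_filter_of_dominated_convergence
    ((Metric.closedBall (0 : RN N) (R + 1)).indicator fun y => C * ‖w y‖) ?_ ?_ ?_ ?_
  · exact Eventually.of_forall fun k => (continuous_moll hf.locallyIntegrable
      (φ k)).aestronglyMeasurable.smul hw.aestronglyMeasurable
  · filter_upwards [hφ.eventually (gt_mem_nhds one_pos)] with k hk
    refine Eventually.of_forall fun x => ?_
    by_cases hx : R + 1 < ‖x‖
    · have h0 : moll (φ k) f x = 0 := by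
        rw [moll_apply]
        refine integral_eq_zero_of_ae (Eventually.of_forall fun z => ?_)
        by_cases hz : ‖z‖ < (φ k).rOut
        · have : R < ‖x - z‖ := by
            have := norm_sub_norm_le x z
            linarith
          simp [hR0 _ this]
        · have : (φ k).normed volume z = 0 := by
            rw [← Function.notMem_support, (φ k).support_normed_eq]
            simpa using hz
          simp [this]
      rw [h0, zero_smul, norm_zero]
      exact indicator_nonneg (fun _ _ => by positivity) _
    · rw [indicator_of_mem (by simpa using hx), norm_smul]
      gcongr
      rw [moll_apply]
      have h1 := norm_integral_le_of_norm_le ((φ k).integrable_normed (μ := volume) |>.mul_const C)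
        (f := fun z => (φ k).normed volume z • f (x - z)) (Eventually.of_forall fun z => by
          rw [norm_smul, Real.norm_of_nonneg ((φ k).nonneg_normed z)]
          exact mul_le_mul_of_nonneg_left (hC _) ((φ k).nonneg_normed z))
      rwa [integral_mul_const, (φ k).integral_normed, one_mul] at h1
  · rw [integrable_indicator_iff measurableSet_closedBall]
    exact (hw.integrableOn_isCompact (isCompact_closedBall _ _)).norm.const_mul C
  · refine Eventually.of_forall fun x => ?_
    exact (ContDiffBump.convolution_tendsto_right_of_continuous hφ hf x).smul_const _

theorem fderiv_moll_of_contDiff (φ : ContDiffBump (0 : RN N)) {f : RN N → ℝ}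
    (hf : ContDiff ℝ 1 f) (hfc : HasCompactSupport f) (x h : RN N) :
    fderiv ℝ (moll φ f) x h = moll φ (fun y => fderiv ℝ f y h) x := by
  have h1 := hfc.hasFDerivAt_convolution_right (μ := volume) (ContinuousLinearMap.lsmul ℝ ℝ)
    (φ.continuous_normed (μ := volume)).locallyIntegrable hf x
  have h2 : fderiv ℝ (moll φ f) x = _ := h1.fderiv
  rw [h2, convolution_precompR_apply _ (φ.continuous_normed (μ := volume)).locallyIntegrable
    (hfc.fderiv (𝕜 := ℝ)) (hf.continuous_fderiv (by simp))]
  rfl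

/-- For a `C^1` field both its components and their derivatives can be mollified, and mollifications
of continuous compactly supported functions converge pointwise under a common integrable bound. -/
theorem tendsto_magPairing_moll (hA : Continuous A) (hu : LocallyIntegrable u volume)
    {φ : ℕ → ContDiffBump (0 : RN N)} (hφ : Tendsto (fun k => (φ k).rOut) atTop (𝓝 0))
    {ψ : RN N → RN N} (hψ : ContDiff ℝ 1 ψ) (hψc : HasCompactSupport ψ) :
    Tendsto (fun k => magPairing A u (moll (φ k) ψ)) atTop (𝓝 (magPairing A u ψ)) := by
  unfold magPairing
  refine tendsto_finsetSum _ fun j _ => ?_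
  have hj := contDiff_coord hψ j
  have hjc := hasCompactSupport_coord hψc j
  have hmj' : ∀ k y, moll (φ k) ψ y j = moll (φ k) (fun z => ψ z j) y := fun k y =>
    moll_apply_coord_real hψ.continuous.locallyIntegrable (φ k) y j
  simp only [hmj', fderiv_moll_of_contDiff _ hj hjc]
  refine Tendsto.add ?_ (Tendsto.const_mul _ ?_)
  · exact tendsto_integral_moll_smul hφ
      ((hj.continuous_fderiv (by simp)).clm_apply continuous_const)
      (hjc.fderiv_apply (𝕜 := ℝ) _) hu
  · exact tendsto_integral_moll_smul hφ hj.continuous hjc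
      (locallyIntegrable_ofReal_mul (by fun_prop) hu)

end Pairing

theorem ofReal_integral_le_lintegral_ofReal {X : Type*} [MeasurableSpace X] {μ : Measure X}
    {f : X → ℝ} (hf : Integrable f μ) :
    ENNReal.ofReal (∫ x, f x ∂μ) ≤ ∫⁻ x, ENNReal.ofReal (f x) ∂μ := by
  rw [integral_eq_lintegral_pos_part_sub_lintegral_neg_part hf]
  refine (ENNReal.ofReal_le_ofReal (sub_le_self _ ENNReal.toReal_nonneg)).trans ?_
  exact ENNReal.ofReal_toReal_le

/-! ### The variation and the energies of mollified gradients. -/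

section Variation

variable {N : ℕ} {K : Set (RN N)} {A : RN N → RN N} {u : RN N → ℂ}

theorem momentNorm_neg (w : RN N) : momentNorm K (-w) = momentNorm K w := by
  simp [momentNorm]

/-- The dual unit ball is an intersection of half-spaces, and a mollification is an average, so the
constraint survives. -/
theorem dualMomentNorm_moll_le_one (φ : ContDiffBump (0 : RN N)) {F : RN N → RN N}
    (hF : LocallyIntegrable F volume) (h : ∀ x w, inner ℝ (F x) w ≤ momentNorm K w) (x : RN N) :
    dualMomentNorm K (moll φ F x) ≤ 1 := by
  refine dualMomentNorm_le_one fun w => ?_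
  have h1 := ((innerSL ℝ) w).integral_comp_comm (integrable_normed_smul hF φ x)
  simp only [innerSL_apply_apply, inner_smul_right] at h1
  rw [moll_apply, real_inner_comm, ← h1]
  have h2 : Integrable fun z => φ.normed volume z * inner ℝ w (F (x - z)) := by
    have := ((innerSL ℝ) w).integrable_comp (integrable_normed_smul hF φ x)
    simpa [inner_smul_right] using this
  calc ∫ z, φ.normed volume z * inner ℝ w (F (x - z))
      ≤ ∫ z, φ.normed volume z * momentNorm K w := by
        refine integral_mono h2 (φ.integrable_normed.mul_const _) fun z => ?_
        refine mul_le_mul_of_nonneg_left ?_ (φ.nonneg_normed z)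
        rw [real_inner_comm]
        exact h _ _
    _ = momentNorm K w := by rw [integral_mul_const, φ.integral_normed, one_mul]

theorem measurable_momentNorm_part (c : ℂ →L[ℝ] ℝ) {G : RN N → CN N} (hG : StronglyMeasurable G) :
    Measurable fun x => ENNReal.ofReal (momentNorm K (part c (G x))) :=
  ((measurable_momentNorm.comp (continuous_part c).measurable).comp hG.measurable).ennreal_ofReal

/-- Mollifying the extremal sign field, cut off to a ball, gives an admissible competitor whose
pairing with `u` is exactly the energy of the mollified gradient on that ball. Then the balls
exhaust the space. -/
theorem lintegral_momentNorm_magGrad_le_partVariation (hKb : Bornology.IsBounded K)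
    (hA : Continuous A) (hu : LocallyIntegrable u volume)
    (φ : ContDiffBump (0 : RN N)) (c : ℂ →L[ℝ] ℝ) :
    ∫⁻ x, ENNReal.ofReal (momentNorm K (part c (magGrad φ A u x))) ≤ partVariation c K A u := by
  have hG : StronglyMeasurable (magGrad φ A u) := (continuous_magGrad hA hu φ).stronglyMeasurable
  have hcov : AECover (volume : Measure (RN N)) atTop
      fun n : ℕ => Metric.closedBall (0 : RN N) n :=
    aecover_closedBall tendsto_natCast_atTop_atTop
  refine le_of_tendsto' (hcov.lintegral_tendsto_of_nat
    (measurable_momentNorm_part c hG).aemeasurable) fun n => ?_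
  set B := Metric.closedBall (0 : RN N) n with hB
  set F : RN N → RN N := B.indicator fun x => signField K (part c (magGrad φ A u x)) with hFdef
  have hFm : StronglyMeasurable F :=
    ((stronglyMeasurable_signField.comp_measurable (continuous_part c).measurable).comp_measurable
      hG.measurable).indicator measurableSet_closedBall
  have hFC : ∀ x, ‖F x‖ ≤ ((N : ℝ) + 1) * ∫ h in K, ‖h‖ := by
    intro x
    refine (norm_indicator_le_norm_self _ x).trans (norm_signField_le hKb _)
  have hFR : ∀ x, (n : ℝ) < ‖x‖ → F x = 0 := fun x hx =>
    indicator_of_notMem (by simpa [hB] using hx) _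
  have hFl := locallyIntegrable_of_bound hFm hFC
  have hFs : HasCompactSupport F :=
    HasCompactSupport.intro (isCompact_closedBall (0 : RN N) n) fun x hx =>
      indicator_of_notMem hx _
  have hadm : IsAdmissible K (moll φ F) := by
    refine ⟨contDiff_moll hFl φ 1, φ.hasCompactSupport_normed.convolution _ hFs, fun x => ?_⟩
    refine dualMomentNorm_moll_le_one φ hFl (fun x w => ?_) x
    by_cases hx : x ∈ B
    · rw [hFdef, indicator_of_mem hx]
      exact inner_signField_le hKb _ _
    · rw [hFdef, indicator_of_notMem hx, inner_zero_left]
      exact momentNorm_nonneg w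
  obtain ⟨hint, heq⟩ := magPairing_moll hA hu φ hFm hFC hFR
  have hpt : ∀ x, -c (cdot (magGrad φ A u x) (F x))
      = B.indicator (fun x => momentNorm K (part c (magGrad φ A u x))) x := by
    intro x
    rw [apply_cdot]
    by_cases hx : x ∈ B
    · rw [hFdef, indicator_of_mem hx, indicator_of_mem hx, inner_signField_self hKb, neg_neg]
    · rw [hFdef, indicator_of_notMem hx, indicator_of_notMem hx, inner_zero_left, neg_zero]
  have hci : Integrable fun x => -c (cdot (magGrad φ A u x) (F x)) :=
    (c.integrable_comp hint).neg
  refine le_trans (le_of_eq ?_) (le_iSup₂ (f := fun ψ (_ : IsAdmissible K ψ) =>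
    ENNReal.ofReal (c (magPairing A u ψ))) (moll φ F) hadm)
  rw [heq, map_neg, ← c.integral_comp_comm hint, ← integral_neg,
    ofReal_integral_eq_lintegral_ofReal hci (Eventually.of_forall fun x => by
      simp only [Pi.zero_apply, hpt]
      exact indicator_nonneg (fun _ _ => momentNorm_nonneg _) _),
    ← lintegral_indicator measurableSet_closedBall]
  refine lintegral_congr fun x => ?_
  rw [hpt]
  by_cases hx : x ∈ B
  · rw [indicator_of_mem hx, indicator_of_mem hx]
  · rw [indicator_of_notMem hx, indicator_of_notMem hx, ENNReal.ofReal_zero]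

theorem ofReal_magPairing_moll_le (hKb : Bornology.IsBounded K) (hK0 : (0 : RN N) ∈ interior K)
    (hA : Continuous A) (hu : LocallyIntegrable u volume) (φ : ContDiffBump (0 : RN N))
    (c : ℂ →L[ℝ] ℝ) {ψ : RN N → RN N} (hψ : IsAdmissible K ψ) {R : ℝ}
    (hR : ∀ x, R < ‖x‖ → ψ x = 0) :
    ENNReal.ofReal (c (magPairing A u (moll φ ψ))) ≤
      ∫⁻ x in Metric.closedBall 0 R,
        ENNReal.ofReal (momentNorm K (part c (magGrad φ A u x))) := by
  obtain ⟨C, hC⟩ := hψ.2.1.exists_bound_of_continuous hψ.1.continuous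
  obtain ⟨hint, heq⟩ := magPairing_moll hA hu φ hψ.1.continuous.stronglyMeasurable hC hR
  rw [heq, map_neg, ← c.integral_comp_comm hint, ← integral_neg]
  refine (ofReal_integral_le_lintegral_ofReal (c.integrable_comp hint).neg).trans ?_
  rw [← lintegral_indicator measurableSet_closedBall]
  refine lintegral_mono fun x => ?_
  rw [Pi.neg_apply, apply_cdot]
  by_cases hx : R < ‖x‖
  · simp [hR x hx]
  · rw [indicator_of_mem (by simpa using hx), ← inner_neg_right]
    refine ENNReal.ofReal_le_ofReal ?_
    rw [← momentNorm_neg]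
    exact inner_le_momentNorm_of_dualMomentNorm_le_one hKb hK0 (hψ.2.2 x) _

/-- A nearly optimal admissible field has compact support, and its mollified pairings with `u`
converge to its pairing. The bound holds for all larger radii, so that one ball can serve real and
imaginary parts. -/
theorem exists_eventually_partVariation_le (hKb : Bornology.IsBounded K)
    (hK0 : (0 : RN N) ∈ interior K) (hA : Continuous A) (hu : LocallyIntegrable u volume)
    {φ : ℕ → ContDiffBump (0 : RN N)} (hφ : Tendsto (fun k => (φ k).rOut) atTop (𝓝 0))
    (c : ℂ →L[ℝ] ℝ) (hfin : partVariation c K A u ≠ ⊤) {e : ℝ≥0∞} (he : 0 < e) :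
    ∃ R : ℝ, ∀ R' ≥ R, ∀ᶠ k in atTop, partVariation c K A u ≤
      (∫⁻ x in Metric.closedBall 0 R',
        ENNReal.ofReal (momentNorm K (part c (magGrad (φ k) A u x)))) + e := by
  rcases eq_or_ne (partVariation c K A u) 0 with h0 | h0
  · exact ⟨0, fun R' _ => Eventually.of_forall fun k => by rw [h0]; exact zero_le⟩
  have hlt : partVariation c K A u - e < partVariation c K A u :=
    ENNReal.sub_lt_self hfin h0 he.ne'
  obtain ⟨ψ, hψ'⟩ := lt_iSup_iff.1 (lt_of_lt_of_eq hlt rfl)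
  obtain ⟨hψ, hlt'⟩ := lt_iSup_iff.1 hψ'
  obtain ⟨R, hR⟩ := hψ.2.1.isCompact.isBounded.subset_closedBall (0 : RN N)
  refine ⟨R, fun R' hR' => ?_⟩
  have hR0 : ∀ x, R' < ‖x‖ → ψ x = 0 := by
    intro x hx
    by_contra hne
    have := hR (subset_tsupport ψ hne)
    rw [mem_closedBall_zero_iff] at this
    linarith
  have hlim : Tendsto (fun k => ENNReal.ofReal (c (magPairing A u (moll (φ k) ψ)))) atTop
      (𝓝 (ENNReal.ofReal (c (magPairing A u ψ)))) :=
    ENNReal.tendsto_ofReal ((c.continuous.tendsto _).comp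
      (tendsto_magPairing_moll hA hu hφ hψ.1 hψ.2.1))
  filter_upwards [hlim.eventually (lt_mem_nhds hlt')] with k hk
  rw [← tsub_le_iff_right]
  exact hk.le.trans (ofReal_magPairing_moll_le hKb hK0 hA hu (φ k) c hψ hR0)

/-- The sum of the norms of the real and the imaginary part of `v`. -/
def partNorm (K : Set (RN N)) (v : CN N) : ℝ≥0∞ :=
  ENNReal.ofReal (momentNorm K (part Complex.reCLM v)) +
    ENNReal.ofReal (momentNorm K (part Complex.imCLM v))

theorem lintegral_partNorm (hKb : Bornology.IsBounded K) {G : RN N → CN N}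
    (hG : StronglyMeasurable G) : ∫⁻ x, partNorm K (G x) = coneMass K 1 (dirEnergy 1 G) := by
  rw [← lintegral_ofReal_momentNorm_part hKb hG,
    ← lintegral_add_left (measurable_momentNorm_part _ hG)]
  rfl

theorem exists_mul_enorm_le_partNorm (hKb : Bornology.IsBounded K)
    (hK0 : (0 : RN N) ∈ interior K) :
    ∃ c : ℝ≥0∞, c ≠ 0 ∧ c ≠ ⊤ ∧ ∀ v : CN N, c * ‖v‖ₑ ≤ partNorm K v := by
  obtain ⟨c, hc0, hc⟩ := exists_mul_norm_le_momentNorm hKb hK0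
  refine ⟨ENNReal.ofReal c, by simpa using hc0, by simp, fun v => ?_⟩
  have hv : v = toCN (part Complex.reCLM v) + Complex.I • toCN (part Complex.imCLM v) := by
    ext j
    simp [toCN, part, mul_comm Complex.I]
  have hnorm : ‖v‖ ≤ ‖part Complex.reCLM v‖ + ‖part Complex.imCLM v‖ := by
    conv_lhs => rw [hv]
    refine (norm_add_le _ _).trans (le_of_eq ?_)
    rw [norm_smul, norm_toCN, norm_toCN, Complex.norm_I, one_mul]
  rw [partNorm, ← ENNReal.ofReal_add (momentNorm_nonneg _) (momentNorm_nonneg _), ← ofReal_norm,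
    ← ENNReal.ofReal_mul hc0.le]
  refine ENNReal.ofReal_le_ofReal ?_
  calc c * ‖v‖ ≤ c * (‖part Complex.reCLM v‖ + ‖part Complex.imCLM v‖) := by gcongr
    _ = c * ‖part Complex.reCLM v‖ + c * ‖part Complex.imCLM v‖ := by ring
    _ ≤ _ := add_le_add (hc _) (hc _)

theorem lintegral_partNorm_magGrad_le (hKb : Bornology.IsBounded K)
    (hA : Continuous A) (hu : LocallyIntegrable u volume) (φ : ContDiffBump (0 : RN N)) :
    ∫⁻ x, partNorm K (magGrad φ A u x) ≤ magVariation K A u := by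
  unfold partNorm
  rw [lintegral_add_left (measurable_momentNorm_part _
    (continuous_magGrad hA hu φ).stronglyMeasurable), magVariation, variationRe_eq hA hu,
    variationIm_eq hA hu]
  exact add_le_add (lintegral_momentNorm_magGrad_le_partVariation hKb hA hu φ _)
    (lintegral_momentNorm_magGrad_le_partVariation hKb hA hu φ _)

theorem exists_eventually_magVariation_le (hKb : Bornology.IsBounded K)
    (hK0 : (0 : RN N) ∈ interior K) (hA : Continuous A) (hu : LocallyIntegrable u volume)
    {φ : ℕ → ContDiffBump (0 : RN N)} (hφ : Tendsto (fun k => (φ k).rOut) atTop (𝓝 0))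
    (hfin : magVariation K A u < ⊤) {e : ℝ≥0∞} (he : 0 < e) :
    ∃ R : ℝ, ∀ᶠ k in atTop, magVariation K A u ≤
      (∫⁻ x in Metric.closedBall 0 R, partNorm K (magGrad (φ k) A u x)) + e := by
  rw [magVariation, variationRe_eq hA hu, variationIm_eq hA hu] at hfin ⊢
  rw [ENNReal.add_lt_top] at hfin
  have he2 : 0 < e / 2 := ENNReal.half_pos he.ne'
  obtain ⟨R₁, h1⟩ := exists_eventually_partVariation_le hKb hK0 hA hu hφ _ hfin.1.ne he2
  obtain ⟨R₂, h2⟩ := exists_eventually_partVariation_le hKb hK0 hA hu hφ _ hfin.2.ne he2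
  refine ⟨max R₁ R₂, ?_⟩
  filter_upwards [h1 _ (le_max_left _ _), h2 _ (le_max_right _ _)] with k hk1 hk2
  refine (add_le_add hk1 hk2).trans (le_of_eq ?_)
  unfold partNorm
  rw [lintegral_add_left (measurable_momentNorm_part _
    (continuous_magGrad hA hu (φ k)).stronglyMeasurable), add_add_add_comm, ENNReal.add_halves]

theorem exists_lintegral_enorm_magGrad_le (hKb : Bornology.IsBounded K)
    (hK0 : (0 : RN N) ∈ interior K) (hA : Continuous A) (hu : LocallyIntegrable u volume)
    (hfin : magVariation K A u < ⊤) :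
    ∃ W : ℝ≥0∞, W ≠ ⊤ ∧ ∀ φ : ContDiffBump (0 : RN N), ∫⁻ x, ‖magGrad φ A u x‖ₑ ≤ W := by
  obtain ⟨c, hc0, hct, hc⟩ := exists_mul_enorm_le_partNorm hKb hK0
  refine ⟨magVariation K A u / c, ENNReal.div_ne_top hfin.ne hc0, fun φ => ?_⟩
  rw [ENNReal.le_div_iff_mul_le (Or.inl hc0) (Or.inl hct), mul_comm,
    ← lintegral_const_mul' _ _ hct]
  exact (lintegral_mono fun x => hc _).trans (lintegral_partNorm_magGrad_le hKb hA hu φ)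

/-- Tightness of the mollified gradients: the total energy is at most the variation, and a fixed
ball already carries almost all of the variation, so little remains outside. -/
theorem exists_eventually_tail_magGrad_le (hKb : Bornology.IsBounded K)
    (hK0 : (0 : RN N) ∈ interior K) (hA : Continuous A) (hu : LocallyIntegrable u volume)
    {φ : ℕ → ContDiffBump (0 : RN N)} (hφ : Tendsto (fun k => (φ k).rOut) atTop (𝓝 0))
    (hfin : magVariation K A u < ⊤) {e : ℝ≥0∞} (he : 0 < e) :
    ∃ R : ℝ, ∀ᶠ k in atTop,
      ∫⁻ x in (Metric.closedBall 0 R)ᶜ, ‖magGrad (φ k) A u x‖ₑ ≤ e := by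
  obtain ⟨c, hc0, hct, hc⟩ := exists_mul_enorm_le_partNorm hKb hK0
  obtain ⟨R, hR⟩ := exists_eventually_magVariation_le hKb hK0 hA hu hφ hfin
    (e := c * e) (ENNReal.mul_pos hc0 he.ne')
  refine ⟨R, ?_⟩
  filter_upwards [hR] with k hk
  have h1 := lintegral_partNorm_magGrad_le hKb hA hu (φ k)
  rw [← lintegral_add_compl _ (measurableSet_closedBall (x := (0 : RN N)) (ε := R))] at h1
  have hb : ∫⁻ x in Metric.closedBall 0 R, partNorm K (magGrad (φ k) A u x) ≠ ⊤ :=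
    ne_top_of_le_ne_top hfin.ne (le_self_add.trans h1)
  have h2 := (ENNReal.add_le_add_iff_left hb).1 (h1.trans hk)
  rw [← ENNReal.mul_le_mul_iff_right hc0 hct, ← lintegral_const_mul' _ _ hct]
  exact (lintegral_mono fun x => hc _).trans h2

end Variation

/-! ### Energy comparisons for `p = 1`. -/

section EPowOne

theorem ePow_one (z : ℂ) : ePow 1 z = ‖z.re‖ₑ + ‖z.im‖ₑ := by simp [ePow]

theorem ePow_one_le (z : ℂ) : ePow 1 z ≤ 2 * ‖z‖ₑ := by
  simpa using ePow_le zero_le_one z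

theorem ePow_one_add_le (z w : ℂ) : ePow 1 (z + w) ≤ ePow 1 z + ePow 1 w := by
  simp only [ePow_one, Complex.add_re, Complex.add_im]
  rw [add_add_add_comm]
  exact add_le_add (enorm_add_le _ _) (enorm_add_le _ _)

theorem ePow_one_integral_le {X : Type*} [MeasurableSpace X] {μ : Measure X} (f : X → ℂ) :
    ePow 1 (∫ x, f x ∂μ) ≤ ∫⁻ x, ePow 1 (f x) ∂μ := by
  by_cases hf : Integrable f μ
  · have hre : AEMeasurable (fun x => ‖(f x).re‖ₑ) μ :=
      (Complex.continuous_re.comp_aestronglyMeasurable hf.1).enorm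
    have h1 : (∫ x, f x ∂μ).re = ∫ x, (f x).re ∂μ := (Complex.reCLM.integral_comp_comm hf).symm
    have h2 : (∫ x, f x ∂μ).im = ∫ x, (f x).im ∂μ := (Complex.imCLM.integral_comp_comm hf).symm
    simp only [ePow_one]
    rw [lintegral_add_left' hre, h1, h2]
    exact add_le_add (enorm_integral_le_lintegral_enorm _) (enorm_integral_le_lintegral_enorm _)
  · rw [integral_undef hf]
    simp [ePow_one]

end EPowOne

section BumpAverage

variable {N : ℕ}

theorem ePow_one_integral_normed_smul_le (φ : ContDiffBump (0 : RN N)) (f : RN N → ℂ) :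
    ePow 1 (∫ z, φ.normed volume z • f z) ≤ ∫⁻ z, ePow 1 (f z) ∂bumpMeasure φ := by
  refine (ePow_one_integral_le _).trans ?_
  rw [← lintegral_normed_mul]
  refine lintegral_mono fun z => ?_
  rw [Complex.real_smul, ePow_real_mul zero_le_one, ENNReal.rpow_one,
    Real.enorm_of_nonneg (φ.nonneg_normed z)]

theorem lintegral_lintegral_bumpMeasure_sub (φ : ContDiffBump (0 : RN N)) {H : RN N → ℝ≥0∞}
    (hH : Measurable H) : ∫⁻ x, ∫⁻ z, H (x - z) ∂bumpMeasure φ = ∫⁻ x, H x := by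
  have h1 : Measurable (Function.uncurry fun x z : RN N => H (x - z)) := hH.comp measurable_sub
  rw [lintegral_lintegral_swap h1.aemeasurable]
  simp [lintegral_sub_right_eq_self]

end BumpAverage

section ShiftEnergyOne

variable {N : ℕ} {K : Set (RN N)} {A : RN N → RN N} {u v : RN N → ℂ}

theorem enorm_magFactor_sub_le {L : NNReal} (hA : LipschitzWith L A) (h x y : RN N) :
    ‖Complex.exp (((-magPhase A h x : ℝ) : ℂ) * Complex.I) -
      Complex.exp (((-magPhase A h y : ℝ) : ℂ) * Complex.I)‖ₑ ≤
      ENNReal.ofReal (‖h‖ * L * ‖x - y‖) := by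
  have h1 : Complex.exp (((-magPhase A h x : ℝ) : ℂ) * Complex.I) -
      Complex.exp (((-magPhase A h y : ℝ) : ℂ) * Complex.I) =
      Complex.exp (((-magPhase A h y : ℝ) : ℂ) * Complex.I) *
        (Complex.exp (((magPhase A h y - magPhase A h x : ℝ) : ℂ) * Complex.I) - 1) := by
    rw [mul_sub, ← Complex.exp_add]
    congr 2
    · push_cast; ring
    · ring
  rw [h1, enorm_mul, enorm_exp_mul_I, one_mul, ← ofReal_norm]
  refine ENNReal.ofReal_le_ofReal ((norm_exp_mul_I_sub_one_le _).trans ((min_le_right _ _).trans ?_))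
  rw [magPhase, magPhase, ← inner_sub_right, mul_assoc]
  refine (abs_real_inner_le_norm _ _).trans ?_
  gcongr
  have h2 := hA.dist_le_mul (y + (2 : ℝ)⁻¹ • h) (x + (2 : ℝ)⁻¹ • h)
  rwa [dist_eq_norm, dist_eq_norm, add_sub_add_right_eq_sub, norm_sub_rev y x] at h2

/-- Without a potential, mollification would not increase the shift energy, by convexity and
translation invariance. With a potential the phase at `x` differs from the one at `x - z` by at most
`‖h‖ L ‖z‖`, which gives the extra term. -/
theorem shiftEnergy_one_moll_le {L : NNReal} (hA : LipschitzWith L A) (hum : StronglyMeasurable u)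
    (hu : LocallyIntegrable u volume) (φ : ContDiffBump (0 : RN N)) (h : RN N) :
    shiftEnergy 1 A (moll φ u) h ≤ shiftEnergy 1 A u h +
      2 * (ENNReal.ofReal (‖h‖ * L * φ.rOut) * eLpNorm u 1 volume) := by
  set c := ENNReal.ofReal (‖h‖ * L * φ.rOut) with hc
  set H : RN N → ℝ≥0∞ := fun x =>
    ePow 1 (magShift A h u x - u x) + 2 * (c * ‖u (x + h)‖ₑ) with hH
  have hm1 : Measurable fun x => ePow 1 (magShift A h u x - u x) :=
    (measurable_ePow 1).comp ((measurable_magShift hA.continuous hum h).sub hum.measurable)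
  have hm2 : Measurable fun x => ‖u (x + h)‖ₑ :=
    (hum.measurable.comp (measurable_add_const h)).enorm
  have hHm : Measurable H := hm1.add ((hm2.const_mul c).const_mul 2)
  have hpt : ∀ x, ePow 1 (magShift A h (moll φ u) x - moll φ u x)
      ≤ ∫⁻ z, H (x - z) ∂bumpMeasure φ := by
    intro x
    set e := Complex.exp (((-magPhase A h x : ℝ) : ℂ) * Complex.I) with he
    have h1 : magShift A h (moll φ u) x - moll φ u x
        = ∫ z, φ.normed volume z • (e * u (x + h - z) - u (x - z)) := by
      rw [magShift, moll_apply, moll_apply, ← integral_const_mul, ← integral_sub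
        ((integrable_normed_smul hu φ _).const_mul _) (integrable_normed_smul hu φ _)]
      congr 1 with z
      simp only [Complex.real_smul]
      ring
    rw [h1]
    refine (ePow_one_integral_normed_smul_le φ _).trans (lintegral_mono_ae ?_)
    filter_upwards [ae_bumpMeasure_norm_lt φ] with z hz
    have h2 : e * u (x + h - z) - u (x - z) = (magShift A h u (x - z) - u (x - z)) +
        (e - Complex.exp (((-magPhase A h (x - z) : ℝ) : ℂ) * Complex.I)) * u (x - z + h) := by
      rw [magShift, show x + h - z = x - z + h by abel]
      ring
    rw [h2]
    refine (ePow_one_add_le _ _).trans (add_le_add le_rfl ((ePow_one_le _).trans ?_))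
    rw [enorm_mul]
    gcongr
    refine (enorm_magFactor_sub_le hA h x (x - z)).trans (ENNReal.ofReal_le_ofReal ?_)
    rw [sub_sub_cancel]
    gcongr
  calc shiftEnergy 1 A (moll φ u) h ≤ ∫⁻ x, ∫⁻ z, H (x - z) ∂bumpMeasure φ := lintegral_mono hpt
    _ = ∫⁻ x, H x := lintegral_lintegral_bumpMeasure_sub φ hHm
    _ = _ := by
      simp only [hH]
      rw [lintegral_add_left hm1, lintegral_const_mul _ (hm2.const_mul c), lintegral_const_mul _ hm2,
        lintegral_add_right_eq_self (fun x => ‖u x‖ₑ), eLpNorm_one_eq_lintegral_enorm]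
      rfl

theorem dirEnergy_one_le_shiftEnergy_add (hA : Continuous A) (hv : StronglyMeasurable v)
    (G : RN N → CN N) (h : RN N) :
    dirEnergy 1 G h ≤ shiftEnergy 1 A v h +
      2 * eLpNorm (fun x => magShift A h v x - v x - cdot (G x) h) 1 volume := by
  have hm1 : Measurable fun x => ePow 1 (magShift A h v x - v x) :=
    (measurable_ePow 1).comp ((measurable_magShift hA hv h).sub hv.measurable)
  rw [eLpNorm_one_eq_lintegral_enorm, ← lintegral_const_mul' _ _ (by simp), shiftEnergy,
    ← lintegral_add_left hm1]
  refine lintegral_mono fun x => ?_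
  calc ePow 1 (cdot (G x) h)
      = ePow 1 ((magShift A h v x - v x) + (cdot (G x) h - (magShift A h v x - v x))) := by
        rw [add_sub_cancel]
    _ ≤ _ := (ePow_one_add_le _ _).trans (add_le_add le_rfl ((ePow_one_le _).trans ?_))
  rw [← ofReal_norm, norm_sub_rev, ofReal_norm]

theorem shiftEnergy_one_le_add (hA : Continuous A) (hu : StronglyMeasurable u)
    (hv : StronglyMeasurable v) (h : RN N) :
    shiftEnergy 1 A u h ≤ shiftEnergy 1 A v h +
      4 * eLpNorm (fun x => v x - u x) 1 volume := by
  have h1 := shiftEnergy_le le_rfl hA (hv.sub hu) h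
  rw [ENNReal.rpow_one, ENNReal.ofReal_one, ← mul_assoc] at h1
  have h2 : shiftEnergy 1 A u h ≤ shiftEnergy 1 A v h + shiftEnergy 1 A (v - u) h := by
    have hm1 : Measurable fun x => ePow 1 (magShift A h v x - v x) :=
      (measurable_ePow 1).comp ((measurable_magShift hA hv h).sub hv.measurable)
    rw [shiftEnergy, shiftEnergy, shiftEnergy, ← lintegral_add_left hm1]
    refine lintegral_mono fun x => ?_
    have h3 : magShift A h u x - u x
        = (magShift A h v x - v x) + -(magShift A h (v - u) x - (v - u) x) := by
      simp only [magShift, Pi.sub_apply]; ring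
    rw [h3]
    refine (ePow_one_add_le _ _).trans (add_le_add le_rfl (le_of_eq ?_))
    simp only [ePow_one, Complex.neg_re, Complex.neg_im, enorm_neg]
  refine h2.trans (add_le_add le_rfl (h1.trans (le_of_eq ?_)))
  norm_num
  rfl

/-- Only the upper comparison is needed here, so each point of the segment can be estimated by
itself: translation invariance makes the directional energy at `x + t•h` independent of `t`. Thus no
continuity of translations of `magGrad` enters, as would not be available uniformly in `φ`. -/
theorem shiftEnergy_one_moll_le_dirEnergy_add {L : NNReal} (hA : LipschitzWith L A)
    (hum : StronglyMeasurable u) (hu : LocallyIntegrable u volume) (φ : ContDiffBump (0 : RN N))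
    (h : RN N) {M : ℝ≥0∞}
    (hM : ∀ t ∈ Ioc (0 : ℝ) 1, ∫⁻ x, phaseSize A h x * ‖magGrad φ A u (x + t • h)‖ₑ ≤ M) :
    shiftEnergy 1 A (moll φ u) h ≤ dirEnergy 1 (magGrad φ A u) h + 2 * (‖h‖ₑ * M) +
      2 * (ENNReal.ofReal (‖h‖ * L * (φ.rOut + ‖h‖)) * eLpNorm u 1 volume) := by
  have hcg := continuous_magGrad hA.continuous hu φ
  set G := magGrad φ A u with hG
  set c := ENNReal.ofReal (‖h‖ * L * (φ.rOut + ‖h‖)) with hc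
  have hq : Measurable fun q : RN N × ℝ => q.1 + q.2 • h := by fun_prop
  have hd : Measurable fun y => ePow 1 (cdot (G y) h) :=
    (measurable_ePow 1).comp ((continuous_cdot (N := N)).comp
      (hcg.prodMk continuous_const)).measurable
  have hps := measurable_phaseSize hA.continuous h
  have hem := measurable_eMoll hum φ
  have hg := hcg.measurable.enorm
  set H : RN N → ℝ → ℝ≥0∞ := fun x t => ePow 1 (cdot (G (x + t • h)) h) +
    2 * (‖h‖ₑ * (phaseSize A h x * ‖G (x + t • h)‖ₑ)) + 2 * (c * eMoll φ u (x + t • h)) with hH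
  have hHm : Measurable (Function.uncurry H) := by
    have h1 := hd.comp hq
    have h2 := hg.comp hq
    have h3 := hem.comp hq
    have h4 : Measurable fun q : RN N × ℝ => phaseSize A h q.1 := hps.comp measurable_fst
    exact (h1.add (((h4.mul h2).const_mul _).const_mul _)).add ((h3.const_mul _).const_mul _)
  have hpt : ∀ x, ePow 1 (magShift A h (moll φ u) x - moll φ u x)
      ≤ ∫⁻ t in Ioc (0 : ℝ) 1, H x t := by
    intro x
    obtain ⟨R, -, hR, heq⟩ := exists_magShift_moll_sub_eq hA hu φ h x
    rw [heq]
    refine (ePow_one_integral_le _).trans (setLIntegral_mono' measurableSet_Ioc fun t ht => ?_)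
    have ht' := Ioc_subset_Icc_self ht
    set e := Complex.exp (((-(t * magPhase A h x) : ℝ) : ℂ) * Complex.I) with he
    have h1 : e * (cdot (G (x + t • h)) h + R t) = cdot (G (x + t • h)) h +
        (e - 1) * cdot (G (x + t • h)) h + e * R t := by ring
    rw [h1]
    refine (ePow_one_add_le _ _).trans (add_le_add ((ePow_one_add_le _ _).trans
      (add_le_add le_rfl ((ePow_one_le _).trans ?_))) ((ePow_one_le _).trans ?_))
    · rw [enorm_mul]
      refine mul_le_mul_right ?_ 2
      calc _ ≤ phaseSize A h x * (‖h‖ₑ * ‖G (x + t • h)‖ₑ) := by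
            gcongr
            · exact enorm_exp_mul_I_sub_one_le h x ht'
            · exact enorm_cdot_le _ _
        _ = _ := by ring
    · rw [enorm_mul, enorm_exp_mul_I, one_mul]
      gcongr
      exact hR t ht'
  calc shiftEnergy 1 A (moll φ u) h ≤ ∫⁻ x, ∫⁻ t in Ioc (0 : ℝ) 1, H x t := lintegral_mono hpt
    _ = ∫⁻ t in Ioc (0 : ℝ) 1, ∫⁻ x, H x t := lintegral_lintegral_swap hHm.aemeasurable
    _ ≤ ∫⁻ t in Ioc (0 : ℝ) 1, (dirEnergy 1 G h + 2 * (‖h‖ₑ * M) +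
          2 * (c * eLpNorm u 1 volume)) := by
        refine setLIntegral_mono' measurableSet_Ioc fun t ht => ?_
        have hq' : Measurable fun x : RN N => x + t • h := by fun_prop
        have m1 : Measurable fun x => ePow 1 (cdot (G (x + t • h)) h) := hd.comp hq'
        have m2 : Measurable fun x => phaseSize A h x * ‖G (x + t • h)‖ₑ := hps.mul (hg.comp hq')
        have m3 : Measurable fun x => eMoll φ u (x + t • h) := hem.comp hq'
        have m4 : Measurable fun x => ePow 1 (cdot (G (x + t • h)) h) +
            2 * (‖h‖ₑ * (phaseSize A h x * ‖G (x + t • h)‖ₑ)) :=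
          m1.add ((m2.const_mul _).const_mul _)
        simp only [hH]
        rw [lintegral_add_left m4, lintegral_add_left m1,
          lintegral_const_mul _ (m2.const_mul _), lintegral_const_mul _ m2,
          lintegral_const_mul _ (m3.const_mul _), lintegral_const_mul _ m3,
          lintegral_add_right_eq_self (fun y => ePow 1 (cdot (G y) h)),
          lintegral_add_right_eq_self (eMoll φ u)]
        gcongr
        · exact le_rfl
        · exact hM t ht
        · have := eLpNorm_eMoll_le (p := 1) le_rfl hum.aestronglyMeasurable φ
          rw [ENNReal.ofReal_one, eLpNorm_one_eq_lintegral_enorm] at this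
          simpa using this
    _ = _ := by simp

/-- On the ball `A` is bounded and the phase is `O(‖h‖)`; outside it the phase is at most `2` and
the tail of `G` is used. This replaces dominated convergence, which is not uniform over the
mollified gradients. -/
theorem lintegral_phaseSize_mul_le {B R : ℝ} (hB : ∀ y ∈ Metric.closedBall (0 : RN N) (R + 1),
      ‖A y‖ ≤ B) {h : RN N} (hh : ‖h‖ ≤ 1) {t : ℝ} (ht : t ∈ Ioc (0 : ℝ) 1) {G : RN N → CN N}
    (hG : Continuous G) :
    ∫⁻ x, phaseSize A h x * ‖G (x + t • h)‖ₑ ≤ ‖h‖ₑ * (ENNReal.ofReal B * ∫⁻ x, ‖G x‖ₑ) +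
      2 * ∫⁻ x in (Metric.closedBall 0 R)ᶜ, ‖G x‖ₑ := by
  have hGm := hG.measurable.enorm
  set S := (Metric.closedBall (0 : RN N) R)ᶜ with hS
  have hSm : MeasurableSet S := measurableSet_closedBall.compl
  set F : RN N → ℝ≥0∞ := fun y => ‖h‖ₑ * (ENNReal.ofReal B * ‖G y‖ₑ) +
    2 * S.indicator (fun y => ‖G y‖ₑ) y with hF
  have hpt : ∀ x, phaseSize A h x * ‖G (x + t • h)‖ₑ ≤ F (x + t • h) := by
    intro x
    by_cases hx : x + t • h ∈ S
    · simp only [hF]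
      rw [indicator_of_mem hx]
      refine le_trans ?_ le_add_self
      gcongr
      exact phaseSize_le_two A h x
    · simp only [hF]
      refine le_trans ?_ le_self_add
      rw [← mul_assoc]
      gcongr
      rw [hS, notMem_compl_iff, mem_closedBall_zero_iff] at hx
      have hy : x + (2 : ℝ)⁻¹ • h ∈ Metric.closedBall (0 : RN N) (R + 1) := by
        rw [mem_closedBall_zero_iff]
        have h1 : x + (2 : ℝ)⁻¹ • h = (x + t • h) + ((2 : ℝ)⁻¹ - t) • h := by
          rw [sub_smul]; abel
        rw [h1]
        refine (norm_add_le _ _).trans (add_le_add hx ?_)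
        rw [norm_smul]
        have : ‖(2 : ℝ)⁻¹ - t‖ ≤ 1 := by
          rw [Real.norm_eq_abs, abs_le]
          constructor <;> linarith [ht.1, ht.2]
        exact mul_le_one₀ this (norm_nonneg _) hh
      rw [phaseSize, ← ofReal_norm, ← ENNReal.ofReal_mul (norm_nonneg _)]
      refine ENNReal.ofReal_le_ofReal ((min_le_right _ _).trans ?_)
      refine (abs_real_inner_le_norm _ _).trans ?_
      gcongr
      exact hB _ hy
  calc _ ≤ ∫⁻ x, F (x + t • h) := lintegral_mono hpt
    _ = ∫⁻ x, F x := lintegral_add_right_eq_self F _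
    _ = _ := by
      simp only [hF]
      rw [lintegral_add_left ((hGm.const_mul _).const_mul _), lintegral_const_mul _
        (hGm.const_mul _), lintegral_const_mul _ hGm, lintegral_const_mul _ (hGm.indicator hSm),
        lintegral_indicator hSm]

end ShiftEnergyOne

theorem exists_ofReal_mul_norm_le {E : Type*} [NormedAddCommGroup E] (C : ℝ) {U a : ℝ≥0∞}
    (hU : U ≠ ⊤) (ha : 0 < a) :
    ∃ δ > 0, ∀ h : E, ‖h‖ < δ → ENNReal.ofReal (C * ‖h‖) * U ≤ a := by
  have hlim : Tendsto (fun h : E => ENNReal.ofReal (C * ‖h‖) * U) (𝓝 0)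
      (𝓝 (ENNReal.ofReal (C * ‖(0 : E)‖) * U)) :=
    ENNReal.Tendsto.mul_const (ENNReal.tendsto_ofReal
      ((continuous_const.mul continuous_norm).tendsto 0)) (Or.inr hU)
  simp only [norm_zero, mul_zero, ENNReal.ofReal_zero, zero_mul] at hlim
  obtain ⟨δ, hδ, hsub⟩ := Metric.mem_nhds_iff.1 (hlim.eventually (gt_mem_nhds ha))
  exact ⟨δ, hδ, fun h hh => le_of_lt (hsub (by simpa using hh))⟩

theorem le_liminf_add_of_eventually_le {x c : ℝ≥0∞} {y : ℕ → ℝ≥0∞}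
    (h : ∀ᶠ k in atTop, x ≤ y k + c) : x ≤ liminf y atTop + c := by
  rw [← tsub_le_iff_right]
  exact le_liminf_of_le (by isBoundedDefault) (h.mono fun k hk => tsub_le_iff_right.2 hk)

/-! ### The limit for functions of bounded variation. -/

section BV

variable {N : ℕ} {K : Set (RN N)} {A : RN N → RN N} {u : RN N → ℂ}

/-- The bump is fixed, so `δ` may depend on it and the `L^1` expansion is available. The part of the
error that does not shrink with `h` relative to `‖h‖` is proportional to `φ.rOut`. -/
theorem exists_dirEnergy_magGrad_le {L : NNReal} (hA : LipschitzWith L A)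
    (hum : StronglyMeasurable u) (hu : MemLp u 1 volume) (φ : ContDiffBump (0 : RN N))
    (hG : MemLp (magGrad φ A u) 1 volume) {a : ℝ≥0∞} (ha : 0 < a) :
    ∃ δ > 0, ∀ h : RN N, ‖h‖ < δ → dirEnergy 1 (magGrad φ A u) h ≤ shiftEnergy 1 A u h +
      (a + 4 * (ENNReal.ofReal (L * φ.rOut) * eLpNorm u 1 volume)) *
        ENNReal.ofReal (‖h‖ ^ (1 : ℝ)) := by
  have hul : LocallyIntegrable u volume := (memLp_one_iff_integrable.1 hu).locallyIntegrable
  have ha8 : 0 < a / 6 := ENNReal.div_pos ha.ne' (by simp)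
  rw [← ENNReal.ofReal_one] at hG
  obtain ⟨δ₁, hδ₁, h1⟩ := exists_translation_close le_rfl hG ha8
  obtain ⟨δ₂, hδ₂, h2⟩ := exists_phaseSize_mul_small le_rfl hA.continuous hG ha8
  obtain ⟨δ₃, hδ₃, h3⟩ := exists_ofReal_mul_norm_le (E := RN N) L hu.2.ne ha8
  set U := eLpNorm u 1 volume with hU
  refine ⟨min δ₁ (min δ₂ δ₃), by positivity, fun h hh => ?_⟩
  have hh1 := hh.trans_le (min_le_left _ _)
  have hh2 := hh.trans_le ((min_le_right _ _).trans (min_le_left _ _))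
  have hh3 := hh.trans_le ((min_le_right _ _).trans (min_le_right _ _))
  have key := eLpNorm_magShift_moll_sub_sub_le le_rfl hA hum hul φ h (M := a / 6) fun t ht =>
    h1 _ (by
      rw [norm_smul, Real.norm_of_nonneg ht.1.le]
      exact (mul_le_of_le_one_left (norm_nonneg _) ht.2).trans_lt hh1)
  rw [ENNReal.ofReal_one] at key
  have hL : (0 : ℝ) ≤ L := L.2
  have hr := φ.rOut_pos.le
  have e1 : ENNReal.ofReal (‖h‖ * L * (φ.rOut + ‖h‖)) * U
      = ‖h‖ₑ * (ENNReal.ofReal (L * φ.rOut) * U + ENNReal.ofReal (L * ‖h‖) * U) := by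
    rw [← add_mul, ← ENNReal.ofReal_add (by positivity) (by positivity), ← mul_add, ← mul_assoc,
      ← ofReal_norm, ← ENNReal.ofReal_mul (norm_nonneg _), mul_assoc]
  have e2 : ENNReal.ofReal (‖h‖ * L * φ.rOut) * U = ‖h‖ₑ * (ENNReal.ofReal (L * φ.rOut) * U) := by
    rw [← mul_assoc, ← ofReal_norm, ← ENNReal.ofReal_mul (norm_nonneg _), mul_assoc]
  have h2' := h2 h hh2
  rw [ENNReal.ofReal_one] at h2'
  rw [Real.rpow_one, ofReal_norm]
  set P := ENNReal.ofReal (L * φ.rOut) * U with hP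
  have h6 : a / 6 * 6 = a := ENNReal.div_mul_cancel (by simp) (by simp)
  calc dirEnergy 1 (magGrad φ A u) h ≤ shiftEnergy 1 A (moll φ u) h +
      2 * eLpNorm (fun x => magShift A h (moll φ u) x - moll φ u x - cdot (magGrad φ A u x) h) 1
        volume := dirEnergy_one_le_shiftEnergy_add hA.continuous
          (continuous_moll hul φ).stronglyMeasurable _ h
    _ ≤ (shiftEnergy 1 A u h + 2 * (‖h‖ₑ * P)) +
        2 * (‖h‖ₑ * (a / 6) + ‖h‖ₑ * (P + a / 6) + ‖h‖ₑ * (a / 6)) := by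
        gcongr
        · rw [← e2]
          exact shiftEnergy_one_moll_le hA hum hul φ h
        · refine key.trans ?_
          rw [e1]
          gcongr
          exact h3 h hh3
    _ = shiftEnergy 1 A u h + (a / 6 * 6 + 4 * P) * ‖h‖ₑ := by ring
    _ = _ := by rw [h6]

/-- Here `δ` must not depend on `k`: it uses only the uniform `L^1` bound and the tightness of the
mollified gradients. The errors that are not of order `‖h‖` are made smaller than any `b` by letting
`k → ∞` for fixed `h`. -/
theorem exists_shiftEnergy_le_liminf (hKb : Bornology.IsBounded K)
    (hK0 : (0 : RN N) ∈ interior K) {L : NNReal} (hA : LipschitzWith L A)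
    (hum : StronglyMeasurable u) (hu : MemLp u 1 volume) (hfin : magVariation K A u < ⊤)
    {φ : ℕ → ContDiffBump (0 : RN N)} (hφ : Tendsto (fun k => (φ k).rOut) atTop (𝓝 0))
    {a : ℝ≥0∞} (ha : 0 < a) :
    ∃ δ > 0, ∀ h : RN N, ‖h‖ < δ → shiftEnergy 1 A u h ≤
      liminf (fun k => dirEnergy 1 (magGrad (φ k) A u) h) atTop +
        a * ENNReal.ofReal (‖h‖ ^ (1 : ℝ)) := by
  have hul : LocallyIntegrable u volume := (memLp_one_iff_integrable.1 hu).locallyIntegrable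
  have ha8 : 0 < a / 8 := ENNReal.div_pos ha.ne' (by simp)
  obtain ⟨W, hWt, hW⟩ := exists_lintegral_enorm_magGrad_le hKb hK0 hA.continuous hul hfin
  obtain ⟨R, hR⟩ := exists_eventually_tail_magGrad_le hKb hK0 hA.continuous hul hφ hfin ha8
  obtain ⟨B, hB⟩ := (isCompact_closedBall (0 : RN N) (R + 1)).exists_bound_of_continuousOn
    hA.continuous.continuousOn
  set U := eLpNorm u 1 volume with hU
  obtain ⟨δ₁, hδ₁, h1⟩ := exists_ofReal_mul_norm_le (E := RN N) B hWt ha8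
  obtain ⟨δ₂, hδ₂, h2⟩ := exists_ofReal_mul_norm_le (E := RN N) L hu.2.ne ha8
  refine ⟨min 1 (min δ₁ δ₂), by positivity, fun h hh => ?_⟩
  have hh0 := hh.trans_le (min_le_left _ _)
  have hh1 := hh.trans_le ((min_le_right _ _).trans (min_le_left _ _))
  have hh2 := hh.trans_le ((min_le_right _ _).trans (min_le_right _ _))
  rw [Real.rpow_one, ofReal_norm]
  refine le_of_forall_le_add_mul (c := 1) (by simp) fun b hb _ => ?_
  rw [mul_one, add_assoc]
  refine le_liminf_add_of_eventually_le ?_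
  have hb8 : 0 < b / 8 := ENNReal.div_pos hb.ne' (by simp)
  have hu' := hu
  rw [← ENNReal.ofReal_one] at hu'
  obtain ⟨δ₃, hδ₃, h3⟩ := exists_translation_close le_rfl hu' hb8
  obtain ⟨δ₄, hδ₄, h4⟩ := exists_ofReal_mul_norm_le (E := ℝ) (‖h‖ * L) hu.2.ne hb8
  filter_upwards [hR, hφ.eventually (gt_mem_nhds hδ₃), hφ.eventually (gt_mem_nhds hδ₄)]
    with k hk hk3 hk4
  have hcg := continuous_magGrad hA.continuous hul (φ k)
  have hr := (φ k).rOut_pos.le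
  have hL : (0 : ℝ) ≤ L := L.2
  have hclose : eLpNorm (fun x => moll (φ k) u x - u x) 1 volume ≤ b / 8 := by
    have := eLpNorm_moll_sub_le le_rfl hul (φ k) (M := b / 8) fun z hz => h3 z (hz.trans hk3)
    rwa [ENNReal.ofReal_one] at this
  have hM : ∀ t ∈ Ioc (0 : ℝ) 1, ∫⁻ x, phaseSize A h x * ‖magGrad (φ k) A u (x + t • h)‖ₑ
      ≤ 3 * (a / 8) := by
    intro t ht
    refine (lintegral_phaseSize_mul_le hB hh0.le ht hcg).trans ?_
    calc _ ≤ ‖h‖ₑ * (ENNReal.ofReal B * W) + 2 * (a / 8) := by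
          gcongr
          exact hW _
      _ ≤ a / 8 + 2 * (a / 8) := by
          gcongr
          refine le_trans (le_of_eq ?_) (h1 h hh1)
          rw [← mul_assoc, ← ofReal_norm, ← ENNReal.ofReal_mul (norm_nonneg _), mul_comm B]
      _ = 3 * (a / 8) := by ring
  have e1 : ENNReal.ofReal (‖h‖ * L * ((φ k).rOut + ‖h‖)) * U
      = ENNReal.ofReal (‖h‖ * L * (φ k).rOut) * U + ‖h‖ₑ * (ENNReal.ofReal (L * ‖h‖) * U) := by
    rw [← mul_assoc, ← ofReal_norm, ← ENNReal.ofReal_mul (norm_nonneg _), ← add_mul,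
      ← ENNReal.ofReal_add (by positivity) (by positivity)]
    congr 2; ring
  have h4' : ENNReal.ofReal (‖h‖ * L * (φ k).rOut) * U ≤ b / 8 := by
    have := h4 (φ k).rOut (by rwa [Real.norm_of_nonneg hr])
    rwa [Real.norm_of_nonneg hr] at this
  have ha' : a / 8 * 8 = a := ENNReal.div_mul_cancel (by simp) (by simp)
  have hb' : b / 8 * 8 = b := ENNReal.div_mul_cancel (by simp) (by simp)
  calc shiftEnergy 1 A u h ≤ shiftEnergy 1 A (moll (φ k) u) h +
        4 * eLpNorm (fun x => moll (φ k) u x - u x) 1 volume :=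
        shiftEnergy_one_le_add hA.continuous hum (continuous_moll hul (φ k)).stronglyMeasurable h
    _ ≤ (dirEnergy 1 (magGrad (φ k) A u) h + 2 * (‖h‖ₑ * (3 * (a / 8))) +
        2 * (b / 8 + ‖h‖ₑ * (a / 8))) + 4 * (b / 8) := by
        gcongr
        refine (shiftEnergy_one_moll_le_dirEnergy_add hA hum hul (φ k) h hM).trans ?_
        rw [e1]
        gcongr
        exact h2 h hh2
    _ = dirEnergy 1 (magGrad (φ k) A u) h + (a / 8 * 8 * ‖h‖ₑ + 6 * (b / 8)) := by ring
    _ ≤ dirEnergy 1 (magGrad (φ k) A u) h + (a / 8 * 8 * ‖h‖ₑ + b / 8 * 8) := by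
        rw [mul_comm (6 : ℝ≥0∞)]
        gcongr
        norm_num
    _ = _ := by rw [ha', hb']

theorem tendsto_lintegral_shiftEnergy_one (hN : 1 ≤ N) (hKc : Convex ℝ K)
    (hKb : Bornology.IsBounded K) (hK0 : (0 : RN N) ∈ interior K) {ρ : ℕ → ℝ → ℝ}
    (hρ : IsMollifierSeq N 1 ρ) {L : NNReal} (hA : LipschitzWith L A)
    (hum : StronglyMeasurable u) (hu : MemLp u 1 volume) (hfin : magVariation K A u < ⊤) :
    Tendsto (fun n => ∫⁻ h, shiftEnergy 1 A u h * kern 1 (ρ n) (gauge K h)) atTop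
      (𝓝 (magVariation K A u)) := by
  have hul : LocallyIntegrable u volume := (memLp_one_iff_integrable.1 hu).locallyIntegrable
  have hc := (coneMass_norm_lt_top hKb zero_le_one).ne
  choose φ hφ using fun k : ℕ => exists_bump_rOut_lt (N := N) (ε := 1 / ((k : ℝ) + 1)) (by positivity)
  have hφ0 : Tendsto (fun k => (φ k).rOut) atTop (𝓝 0) :=
    squeeze_zero (fun k => (φ k).rOut_pos.le) (fun k => (hφ k).le) tendsto_one_div_add_atTop_nhds_zero_nat
  have hcg : ∀ k, Continuous (magGrad (φ k) A u) := fun k =>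
    continuous_magGrad hA.continuous hul (φ k)
  have hGm : ∀ k, StronglyMeasurable (magGrad (φ k) A u) := fun k => (hcg k).stronglyMeasurable
  have hcone : ∀ k, coneMass K 1 (dirEnergy 1 (magGrad (φ k) A u)) ≤ magVariation K A u := fun k => by
    rw [← lintegral_partNorm hKb (hGm k)]
    exact lintegral_partNorm_magGrad_le hKb hA.continuous hul (φ k)
  refine tendsto_of_le_liminf_of_limsup_le ?_ ?_
  · refine le_of_forall_le_add_mul (c := 1 + coneMass K 1 fun h => ENNReal.ofReal (‖h‖ ^ (1 : ℝ)))
      (by simpa using hc) fun a ha hat => ?_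
    have ha2 : 0 < a / 2 := ENNReal.half_pos ha.ne'
    obtain ⟨R, hR⟩ := exists_eventually_magVariation_le hKb hK0 hA.continuous hul hφ0 hfin ha
    obtain ⟨δ₁, hδ₁, h1⟩ := exists_ofReal_mul_norm_le (E := ℝ) L hu.2.ne
      (ENNReal.div_pos (a := a / 2) (b := 4) ha2.ne' (by simp))
    -- One index suffices: its energy is within `a` of the variation, and its bump is narrow enough
    -- for the commutator error to cost at most `a/2`.
    obtain ⟨k, hk, hk1⟩ := (hR.and (hφ0.eventually (gt_mem_nhds hδ₁))).exists
    have hr := (φ k).rOut_pos.le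
    have h1' := h1 (φ k).rOut (by rwa [Real.norm_of_nonneg hr])
    rw [Real.norm_of_nonneg hr] at h1'
    have hGL : MemLp (magGrad (φ k) A u) 1 volume := by
      have := memLp_of_coneMass_lt_top le_rfl hN hK0 (hGm k) ((hcone k).trans_lt hfin)
      rwa [ENNReal.ofReal_one] at this
    obtain ⟨δ, hδ, hd⟩ := exists_dirEnergy_magGrad_le hA hum hu (φ k) hGL ha2
    have hlow := le_liminf_radial_add hN zero_le_one hKc hKb hK0 hρ (measurable_dirEnergy (hGm k))
      (dirEnergy_smul zero_le_one _) hat hδ (D := shiftEnergy 1 A u) fun h hh => by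
        refine (hd h hh).trans ?_
        gcongr
        calc a / 2 + 4 * (ENNReal.ofReal (L * (φ k).rOut) * eLpNorm u 1 volume)
            ≤ a / 2 + 4 * (a / 2 / 4) := by gcongr
          _ = a := by rw [ENNReal.mul_div_cancel (by simp) (by simp), ENNReal.add_halves]
    calc magVariation K A u
        ≤ (∫⁻ x in Metric.closedBall 0 R, partNorm K (magGrad (φ k) A u x)) + a := hk
      _ ≤ coneMass K 1 (dirEnergy 1 (magGrad (φ k) A u)) + a := by
          rw [← lintegral_partNorm hKb (hGm k)]
          gcongr
          exact Measure.restrict_le_self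
      _ ≤ _ := by
          rw [mul_add, mul_one, add_left_comm, add_comm a]
          gcongr
  · refine le_of_forall_le_add_mul hc fun a ha hat => ?_
    obtain ⟨δ, hδ, hd⟩ := exists_shiftEnergy_le_liminf hKb hK0 hA hum hu hfin hφ0 ha
    -- There is no limiting gradient function, but this liminf is measurable and homogeneous of
    -- degree one, as the radial comparison requires, and Fatou bounds its integral over `K`.
    set f : RN N → ℝ≥0∞ := fun h => liminf (fun k => dirEnergy 1 (magGrad (φ k) A u) h) atTop with hf
    have hfm : Measurable f := Measurable.liminf fun k => measurable_dirEnergy (hGm k)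
    have hom : ∀ t : ℝ, 0 < t → ∀ h, f (t • h) = ENNReal.ofReal (t ^ (1 : ℝ)) * f h := by
      intro t ht h
      simp only [hf, dirEnergy_smul zero_le_one _ t ht]
      exact ENNReal.liminf_const_mul_of_ne_top ENNReal.ofReal_ne_top
    have hup := limsup_radial_le hN zero_le_one hKc hKb hK0 hρ hfm hom
      (C := 2 * (2 * eLpNorm u (ENNReal.ofReal 1) volume) ^ (1 : ℝ))
      (by
        rw [ENNReal.ofReal_one, ENNReal.rpow_one]
        exact ENNReal.mul_ne_top (by simp) (ENNReal.mul_ne_top (by simp) hu.2.ne))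
      (shiftEnergy_le le_rfl hA.continuous hum) hδ hd
    refine hup.trans (add_le_add ?_ le_rfl)
    calc coneMass K 1 f ≤ ENNReal.ofReal (N + 1) *
          liminf (fun k => ∫⁻ h in K, dirEnergy 1 (magGrad (φ k) A u) h) atTop := by
          unfold coneMass
          gcongr
          exact lintegral_liminf_le fun k => measurable_dirEnergy (hGm k)
      _ = liminf (fun k => coneMass K 1 (dirEnergy 1 (magGrad (φ k) A u))) atTop :=
          (ENNReal.liminf_const_mul_of_ne_top ENNReal.ofReal_ne_top).symm
      _ ≤ liminf (fun _ : ℕ => magVariation K A u) atTop :=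
          liminf_le_liminf (Eventually.of_forall hcone)
      _ = magVariation K A u := liminf_const _

theorem magVariation_congr {v : RN N → ℂ} (h : u =ᵐ[volume] v) :
    magVariation K A u = magVariation K A v := by
  unfold magVariation variationRe variationIm
  congr 1
  · refine iSup_congr fun ψ => iSup_congr fun _ => congrArg _ (integral_congr_ae ?_)
    filter_upwards [h] with x hx
    rw [hx]
  · refine iSup_congr fun ψ => iSup_congr fun _ => congrArg _ (integral_congr_ae ?_)
    filter_upwards [h] with x hx
    rw [hx]

theorem tendsto_nonlocalEnergy_bv (hN : 1 ≤ N) (hKc : Convex ℝ K) (hKs : ∀ x ∈ K, -x ∈ K)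
    (hKb : Bornology.IsBounded K) (hK0 : (0 : RN N) ∈ interior K) {ρ : ℕ → ℝ → ℝ}
    (hρ : IsMollifierSeq N 1 ρ) {L : NNReal} (hA : LipschitzWith L A) (hu : MemMagBV K A u) :
    Tendsto (fun n => nonlocalEnergy 1 K A (ρ n) u) atTop (𝓝 (magVariation K A u)) := by
  obtain ⟨huL, hfin⟩ := hu
  have huv := huL.1.ae_eq_mk
  have hvm := huL.1.stronglyMeasurable_mk
  rw [magVariation_congr huv] at hfin ⊢
  refine (tendsto_lintegral_shiftEnergy_one hN hKc hKb hK0 hρ hA hvm (huL.ae_eq huv)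
    hfin).congr fun n => ?_
  rw [nonlocalEnergy_congr huv,
    nonlocalEnergy_eq_lintegral hN le_rfl hKc hKs hKb hK0 hρ hA.continuous hvm]

end BV

/-! ### Power kernels and Ludwig's formula. -/

section Power

variable {N : ℕ} {K : Set (RN N)} {p : ℝ}

/-- Both integrals are explicit: the tail equals `(1 - s)/s · δ^(-ps)`, which vanishes as `s → 1`,
and the factor `p(1 - s)` normalizes the mass to `1`. -/
theorem isMollifierSeq_rpow (hp : 1 ≤ p) {s : ℕ → ℝ} (hs : ∀ n, 0 < s n ∧ s n < 1)
    (hlim : Tendsto s atTop (𝓝 1)) :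
    IsMollifierSeq N p (fun n r => p * (1 - s n) * r ^ (p - (N : ℝ) - p * s n)) := by
  have hp0 : 0 < p := by linarith
  have hpos : ∀ n, 0 < p * (1 - s n) := fun n => mul_pos hp0 (by linarith [(hs n).2])
  refine ⟨fun n => by fun_prop, fun n r hr => ?_, fun δ hδ => ?_, fun n => ?_⟩
  · have := hpos n
    positivity
  · have h1 : ∀ n, ∫⁻ r in Ioi δ, ENNReal.ofReal
        (p * (1 - s n) * r ^ (p - (N : ℝ) - p * s n) * r ^ ((N : ℝ) - 1 - p))
        = ENNReal.ofReal ((1 - s n) / s n * δ ^ (-(p * s n))) := by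
      intro n
      have hps : 0 < p * s n := mul_pos hp0 (hs n).1
      have h2 : ∀ r ∈ Ioi δ, ENNReal.ofReal
          (p * (1 - s n) * r ^ (p - (N : ℝ) - p * s n) * r ^ ((N : ℝ) - 1 - p))
          = ENNReal.ofReal (p * (1 - s n) * r ^ (-(p * s n) - 1)) := by
        intro r hr
        rw [mul_assoc, ← Real.rpow_add (hδ.trans hr)]
        congr 3; ring
      rw [setLIntegral_congr_fun measurableSet_Ioi h2, ← ofReal_integral_eq_lintegral_ofReal,
        integral_const_mul, integral_Ioi_rpow_of_lt (by linarith) hδ]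
      · congr 1
        rw [sub_add_cancel]
        have := (hs n).1
        field_simp
      · exact (integrableOn_Ioi_rpow_of_lt (by linarith) hδ).const_mul _
      · filter_upwards [ae_restrict_mem measurableSet_Ioi] with r hr
        have := hpos n
        have : 0 < r := hδ.trans hr
        simp only [Pi.zero_apply]
        positivity
    simp only [h1]
    have h3 : Tendsto (fun n => (1 - s n) / s n * δ ^ (-(p * s n))) atTop
        (𝓝 ((1 - 1) / 1 * δ ^ (-(p * 1)))) :=
      ((hlim.const_sub 1).div hlim one_ne_zero).mul
        (Tendsto.rpow tendsto_const_nhds (hlim.const_mul p).neg (Or.inl hδ.ne'))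
    simpa using ENNReal.tendsto_ofReal h3
  · have h2 : ∀ r ∈ Ioo (0 : ℝ) 1, ENNReal.ofReal
        (p * (1 - s n) * r ^ (p - (N : ℝ) - p * s n) * r ^ ((N : ℝ) - 1))
        = ENNReal.ofReal (p * (1 - s n)) * ENNReal.ofReal (r ^ (p * (1 - s n) - 1)) := by
      intro r hr
      rw [mul_assoc, ← Real.rpow_add hr.1, ENNReal.ofReal_mul (hpos n).le]
      congr 3; ring
    rw [setLIntegral_congr_fun measurableSet_Ioo h2, lintegral_const_mul' _ _ ENNReal.ofReal_ne_top,
      lintegral_Ioo_rpow (by linarith [hpos n]) one_pos, ← ENNReal.ofReal_mul (hpos n).le,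
      sub_add_cancel, Real.one_rpow, mul_one_div_cancel (hpos n).ne', ENNReal.ofReal_one]

theorem nonlocalEnergy_rpow (hp : 1 ≤ p) (hKb : Bornology.IsBounded K)
    (hK0 : (0 : RN N) ∈ interior K) (u : RN N → ℝ) {s : ℝ} (hs : s < 1) :
    nonlocalEnergy p K 0 (fun r => p * (1 - s) * r ^ (p - (N : ℝ) - p * s)) (fun x => (u x : ℂ))
      = ENNReal.ofReal p * (ENNReal.ofReal (1 - s) * fractionalEnergy p s K u) := by
  have hp0 : 0 < p := by linarith
  have hc : 0 ≤ p * (1 - s) := mul_nonneg hp0.le (by linarith)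
  rw [← mul_assoc, ← ENNReal.ofReal_mul hp0.le, nonlocalEnergy, fractionalEnergy,
    ← lintegral_const_mul' _ _ ENNReal.ofReal_ne_top]
  refine lintegral_congr fun z => ?_
  rw [← ENNReal.ofReal_mul hc]
  congr 1
  have h1 : absP p (Psi 0 (fun x => (u x : ℂ)) z.1 z.2 - Psi 0 (fun x => (u x : ℂ)) z.1 z.1) ^ p
      = |u z.1 - u z.2| ^ p := by
    have h2 : Psi 0 (fun x => (u x : ℂ)) z.1 z.2 - Psi 0 (fun x => (u x : ℂ)) z.1 z.1
        = ((u z.2 - u z.1 : ℝ) : ℂ) := by simp [Psi]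
    rw [h2, absP, Complex.ofReal_re, Complex.ofReal_im, abs_zero, Real.zero_rpow hp0.ne', add_zero,
      ← Real.rpow_mul (by positivity), one_div_mul_cancel hp0.ne', Real.rpow_one, abs_sub_comm]
  rw [h1]
  -- On the diagonal the gauge vanishes and cannot be cancelled; both sides are zero because the
  -- difference of `u` is.
  rcases eq_or_ne z.1 z.2 with hz | hz
  · simp [hz, Real.zero_rpow hp0.ne']
  · have hg : 0 < gauge K (z.1 - z.2) := (gauge_pos_iff_ne_zero hKb hK0).2 (sub_ne_zero.2 hz)
    have h3 : gauge K (z.1 - z.2) ^ (p - (N : ℝ) - p * s)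
        = gauge K (z.1 - z.2) ^ p / gauge K (z.1 - z.2) ^ ((N : ℝ) + p * s) := by
      rw [← Real.rpow_sub hg]; congr 1; ring
    rw [h3]
    have h4 := (Real.rpow_pos_of_pos hg p).ne'
    field_simp

theorem tendsto_fractionalEnergy (hp : 1 ≤ p) (hKb : Bornology.IsBounded K)
    (hK0 : (0 : RN N) ∈ interior K) (u : RN N → ℝ) {E : ℝ≥0∞}
    (hE : ∀ ρ : ℕ → ℝ → ℝ, IsMollifierSeq N p ρ →
      Tendsto (fun n => nonlocalEnergy p K 0 (ρ n) (fun x => (u x : ℂ))) atTop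
        (𝓝 (ENNReal.ofReal p * E))) :
    Tendsto (fun s : ℝ => ENNReal.ofReal (1 - s) * fractionalEnergy p s K u) (𝓝[<] 1) (𝓝 E) := by
  have hp0 : ENNReal.ofReal p ≠ 0 := by
    rw [← pos_iff_ne_zero, ENNReal.ofReal_pos]; linarith
  refine tendsto_of_seq_tendsto fun s hs => ?_
  obtain ⟨hs1, hs2⟩ := tendsto_nhdsWithin_iff.1 hs
  -- A sequence tending to `1` from the left lies in `(0,1)` only eventually, whereas the mollifier
  -- conditions concern every index; the value `1/2` fills in the others.
  set s' : ℕ → ℝ := fun n => if 0 < s n ∧ s n < 1 then s n else 1 / 2 with hs'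
  have heq : s' =ᶠ[atTop] s := by
    filter_upwards [hs1.eventually (lt_mem_nhds one_pos), hs2] with n h1 h2
    exact if_pos ⟨h1, h2⟩
  have hmem : ∀ n, 0 < s' n ∧ s' n < 1 := by
    intro n
    simp only [hs']
    split_ifs with h
    · exact h
    · norm_num
  have h1 := hE _ (isMollifierSeq_rpow hp hmem (hs1.congr' heq.symm))
  simp only [nonlocalEnergy_rpow hp hKb hK0 u (hmem _).2] at h1
  have h2 := ENNReal.Tendsto.const_mul (a := (ENNReal.ofReal p)⁻¹) h1
    (Or.inr (ENNReal.inv_ne_top.2 hp0))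
  simp only [← mul_assoc (ENNReal.ofReal p)⁻¹, ENNReal.inv_mul_cancel hp0 ENNReal.ofReal_ne_top,
    one_mul] at h2
  refine h2.congr' ?_
  filter_upwards [heq] with n hn
  simp only [Function.comp_apply, hn]

theorem toCN_zero : toCN (0 : RN N) = 0 := by
  ext j; simp [toCN]

theorem magEnergy_zero (u : RN N → ℂ) (g : RN N → CN N) :
    magEnergy p K 0 u g = ∫⁻ x, ENNReal.ofReal (polarMomentNorm p K (g x) ^ p) := by
  simp [magEnergy, toCN_zero]

/-- The moment norm is bounded by a multiple of the Euclidean norm since `K` is bounded, so for `A =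
0` an `L^p` weak gradient has finite energy. -/
theorem lintegral_polarMomentNorm_lt_top (hp : 1 ≤ p) (hKb : Bornology.IsBounded K)
    {g : RN N → CN N} (hg : MemLp g (ENNReal.ofReal p) volume) :
    ∫⁻ x, ENNReal.ofReal (polarMomentNorm p K (g x) ^ p) < ⊤ := by
  have hp0 : 0 ≤ p := by linarith
  set C := coneMass K p fun h => ENNReal.ofReal (‖h‖ ^ p) with hC
  have hCt : C < ⊤ := coneMass_norm_lt_top hKb hp0
  have hpt : ∀ x, ENNReal.ofReal (polarMomentNorm p K (g x) ^ p) ≤ 2 * C * ‖g x‖ₑ ^ p := by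
    intro x
    calc ENNReal.ofReal (polarMomentNorm p K (g x) ^ p)
        ≤ ENNReal.ofReal p * ENNReal.ofReal (polarMomentNorm p K (g x) ^ p) :=
          le_mul_of_one_le_left zero_le (ENNReal.one_le_ofReal.2 hp)
      _ = ENNReal.ofReal (N + p) * ∫⁻ h in K, ePow p (cdot (g x) h) :=
          ofReal_polarMomentNorm_rpow hp hKb _
      _ ≤ ENNReal.ofReal (N + p) * ∫⁻ h in K, (2 * ‖g x‖ₑ ^ p) * ENNReal.ofReal (‖h‖ ^ p) := by
          gcongr with h
          refine (ePow_le hp0 _).trans ?_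
          rw [mul_assoc, mul_comm (‖g x‖ₑ ^ p), ← enorm_rpow_eq hp0,
            ← ENNReal.mul_rpow_of_nonneg _ _ hp0]
          gcongr
          exact enorm_cdot_le _ _
      _ = 2 * C * ‖g x‖ₑ ^ p := by
          rw [lintegral_const_mul' _ _ (ENNReal.mul_ne_top (by simp)
            (ENNReal.rpow_ne_top_of_nonneg hp0 (by simp))), hC, coneMass]
          ring
  refine (lintegral_mono hpt).trans_lt ?_
  rw [lintegral_const_mul' _ _ (ENNReal.mul_ne_top (by simp) hCt.ne), ← eLpNorm_ofReal_rpow hp]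
  exact ENNReal.mul_lt_top (ENNReal.mul_lt_top (by simp) hCt)
    (ENNReal.rpow_lt_top_of_nonneg hp0 hg.2.ne)

end Power

end AnisotropicBBM

end

theorem theorem2 (N : ℕ) (hN : 1 ≤ N) (p : ℝ) (hp : 1 ≤ p)
    (K : Set (AnisotropicBBM.RN N)) (hKconv : Convex ℝ K) (hKsymm : ∀ x ∈ K, -x ∈ K)
    (hKbdd : Bornology.IsBounded K) (hKint : (0 : AnisotropicBBM.RN N) ∈ interior K) :
    -- the anisotropic magnetic formula, for Sobolev and for BV functions
    (∀ A : AnisotropicBBM.RN N → AnisotropicBBM.RN N, (∃ L, LipschitzWith L A) →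
      ∀ ρ : ℕ → ℝ → ℝ, AnisotropicBBM.IsMollifierSeq N p ρ →
        (∀ u : AnisotropicBBM.RN N → ℂ, AnisotropicBBM.MemMagSobolev p K A u →
          ∀ g : AnisotropicBBM.RN N → AnisotropicBBM.CN N, AnisotropicBBM.IsWeakGradient u g →
            Tendsto (fun n => AnisotropicBBM.nonlocalEnergy p K A (ρ n) u) atTop
              (𝓝 (ENNReal.ofReal p * AnisotropicBBM.magEnergy p K A u g))) ∧
        (p = 1 → ∀ u : AnisotropicBBM.RN N → ℂ, AnisotropicBBM.MemMagBV K A u →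
          Tendsto (fun n => AnisotropicBBM.nonlocalEnergy p K A (ρ n) u) atTop
            (𝓝 (AnisotropicBBM.magVariation K A u)))) ∧
    -- the power-type profiles are admissible
    (∀ s : ℕ → ℝ, (∀ n, 0 < s n ∧ s n < 1) → Tendsto s atTop (𝓝 1) →
      AnisotropicBBM.IsMollifierSeq N p
        (fun n r => p * (1 - s n) * r ^ (p - (N : ℝ) - p * s n))) ∧
    -- Ludwig's formula for `u ∈ W^{1,p}(ℝ^N)` real-valued
    (∀ u : AnisotropicBBM.RN N → ℝ, MemLp u (ENNReal.ofReal p) volume →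
      ∀ g : AnisotropicBBM.RN N → AnisotropicBBM.CN N,
        AnisotropicBBM.IsWeakGradient (fun x => (u x : ℂ)) g →
        MemLp g (ENNReal.ofReal p) volume →
          Tendsto (fun s : ℝ =>
              ENNReal.ofReal (1 - s) * AnisotropicBBM.fractionalEnergy p s K u) (𝓝[<] 1)
            (𝓝 (∫⁻ x, ENNReal.ofReal (AnisotropicBBM.polarMomentNorm p K (g x) ^ p)))) ∧
    -- Ludwig's formula for real-valued functions of bounded variation
    (p = 1 → ∀ u : AnisotropicBBM.RN N → ℝ,
      AnisotropicBBM.MemMagBV K 0 (fun x => (u x : ℂ)) →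
        Tendsto (fun s : ℝ =>
            ENNReal.ofReal (1 - s) * AnisotropicBBM.fractionalEnergy p s K u) (𝓝[<] 1)
          (𝓝 (AnisotropicBBM.magVariation K 0 (fun x => (u x : ℂ))))) := by
  refine ⟨fun A hA ρ hρ => ?_, fun s hs hlim => AnisotropicBBM.isMollifierSeq_rpow hp hs hlim,
    fun u hu g hg hgL => ?_, fun hp1 u hu => ?_⟩
  · obtain ⟨L, hL⟩ := hA
    refine ⟨fun u hu g hg => AnisotropicBBM.tendsto_nonlocalEnergy_sobolev hN hp hKconv hKsymm hKbdd
      hKint hρ hL hu hg, fun hp1 u hu => ?_⟩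
    subst hp1
    exact AnisotropicBBM.tendsto_nonlocalEnergy_bv hN hKconv hKsymm hKbdd hKint hρ hL hu
  · refine AnisotropicBBM.tendsto_fractionalEnergy hp hKbdd hKint u fun ρ hρ => ?_
    rw [← AnisotropicBBM.magEnergy_zero (fun x => (u x : ℂ)) g]
    refine AnisotropicBBM.tendsto_nonlocalEnergy_sobolev hN hp hKconv hKsymm hKbdd hKint hρ
      (LipschitzWith.const 0) ⟨hu.ofReal, g, hg, ?_⟩ hg
    have := AnisotropicBBM.lintegral_polarMomentNorm_lt_top hp hKbdd hgL
    rwa [← AnisotropicBBM.magEnergy_zero (fun x => (u x : ℂ)) g] at this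
  · subst hp1
    refine AnisotropicBBM.tendsto_fractionalEnergy le_rfl hKbdd hKint u fun ρ hρ => ?_
    rw [ENNReal.ofReal_one, one_mul]
    exact AnisotropicBBM.tendsto_nonlocalEnergy_bv hN hKconv hKsymm hKbdd hKint hρ
      (LipschitzWith.const 0) hu
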